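/- Logarithms $\log$ are to base $2$. Let $\mathcal X\subset\mathbb R^D$ and $\mathcal Y\subset\mathbb R^{D'}$ be contained in Euclidean balls of diameter $\Delta_{\mathcal X}$ and $\Delta_{\mathcal Y}$, let $\rho$ be a probability law on $\mathcal X\times\mathcal Y$ with first marginal $\mu$, let $(X_1,Y_1),\dots,(X_n,Y_n)$ be i.i.d. from $\rho$, and assume that the regression function $f(x)=\mathbb E[Y\mid X=x]$ is $\lambda$-Lipschitz on $\mathcal X$. Suppose $\mathcal X$ has Assouad dimension $d>1$, i.e. $d$ is the smallest real number such that for every ball $B$ of $\mathbb R^D$ the set $B\cap\mathcal X$ is covered by at most $2^d$ balls of half the radius. Let $0<\delta<1$, let $n\ge 1$, and assume that $n\ge 3$ or $\delta\le 1/2$. Put $$\alpha(n)=(\log^2 n)\,\log\log(n/\delta)+\log(1/\delta).$$ For $A\subset\mathbb R^D$ let $\mu_n(A)$ be the fraction of sample points in $A$ and $\Delta_n(A)$ the diameter of the set of sample points in $A$ ($0$ if there are none); for a finite family $\mathbf A$ of disjoint cells let $|\mathbf A|$ be their number and $\Delta_n(\mathbf A)^2=\sum_{A}\mu_n(A)\Delta_n(A)^2/\sum_A\mu_n(A)$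 ($0$ if there are no sample points). *basicRPtree*$(A_0,\Delta,l)$: start with the single cell $A_0$, of level $l$. At iteration $i=1,2,\dots$, stop if the average data diameter of the current leaves is at most $\Delta$; otherwise draw $v\sim\mathcal N(0,\frac1D I_D)$ and $\tau$ uniform on $[-1,1]\cdot\frac{6}{\sqrt D}\Delta_n(A_0)$ and split every leaf $A$ into $\{x\in A: x^\top v\le t\}$ and its complement in $A$, where $t$ is the median of $\{X_j^\top v: X_j\in A_0\}$ plus $\tau$ if $l+i$ is odd, and the median of $\{X_j^\top v: X_j\in A\}$ if $l+i$ is even. *coreRPtree*$(A,\Delta_n(A)/2,\delta,l)$ runs *basicRPtree*$(A,\Delta_n(A)/2,l)$ independently $\lceil\log(6n^2/\delta)\rceil$ times and returns a shortest tree. *adaptiveRPtree* with automatic stopping: let $\mathbf A^0=\{\mathcal X\}$. At round $i=1,2,\dots$, replace every cell $A\in\mathbf A^{i-1}$, of level $l$ in the current tree (the root has level $0$), by the leaves of the tree returned by *coreRPtree*$(A,\Delta_n(A)/2,\delta,l)$; this gives $\mathbf A^i$, and $\mathrm{lev}(\mathbf A^i)$ is the largest level of its cells. Stop as soon as $\mathrm{lev}(\mathbf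 A^i)\ge\log\big(n\Delta_n(\mathbf A^i)^2/(\alpha(n)\Delta_n(\mathcal X)^2)\big)$ (this holds by convention if $\Delta_n(\mathbf A^i)=0$), and let $\mathbf A^*$ be a minimizer of $\frac{\alpha(n)}n|\mathbf A|+\Delta_n(\mathbf A)^2$ over $\mathbf A\in\{\mathbf A^{i-1},\mathbf A^i\}$. Return the regressor $f_n$ whose value at $x$ is the average of the $Y_j$ with $X_j$ in the cell of $\mathbf A^*$ that contains $x$, or a fixed $y_0\in\mathcal Y$ if there is no such $X_j$. The procedure *attains a diameter decrease rate of* $k\ge d$ if every call to *coreRPtree* made before it stops returns a tree of depth at most $k$. **Theorem.** There exist absolute constants $C,C'>0$ such that, in this situation, with probability at least $1-\delta$ over the sample and the draws of the algorithm, the procedure stops, it attains a diameter decrease rate of some $k\le C'd\log d$, and for every diameter decrease rate $k$ that it attains the excess risk $\|f_n-f\|^2:=\mathbb E_{X\sim\mu}\|f_n(X)-f(X)\|^2=\mathbb E_{(X,Y)\sim\rho}\|Y-f_n(X)\|^2-\mathbb E_{(X,Y)\sim\rho}\|Y-f(X)\|^2$ satisfies $$\|f_n-f\|^2\le C\,(\Delta_{\mathcal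 Y}^2+\lambda^2)(\Delta_{\mathcal X}^2+1)\Big(\frac{\alpha(n)}{n}\Big)^{2/(2+k)} .$$ -/

import Mathlib

open MeasureTheory ProbabilityTheory
open scoped ENNReal

noncomputable section

namespace RPTree

/-- Euclidean space `ℝ^D` with the `l₂` norm. -/
abbrev E (D : ℕ) := EuclideanSpace ℝ (Fin D)

/-- `d` is the Assouad (doubling) dimension of `S ⊆ ℝ^D`: the smallest `d ≥ 0` such that for every
ball `B` of `ℝ^D` the set `B ∩ S` is covered by (at most) `2 ^ d` balls of half the radius. -/
def HasAssouadDim {D : ℕ} (S : Set (E D)) (d : ℝ) : Prop :=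
  IsLeast {s : ℝ | 0 ≤ s ∧ ∀ (c : E D) (r : ℝ), 0 < r →
    ∃ T : Finset (E D), (T.card : ℝ) ≤ (2 : ℝ) ^ s ∧
      Metric.closedBall c r ∩ S ⊆ ⋃ t ∈ T, Metric.closedBall t (r / 2)} d

/-! ### Tree nodes and data diameters -/

/-- A node of a partition tree: its path from the root (`true` = left, `false` = right)
and its cell. -/
structure Node (D : ℕ) where
  path : List Bool
  cell : Set (E D)

/-- The level of a node in the global tree; the root is at level `0`. -/
def Node.level {D : ℕ} (A : Node D) : ℕ := A.path.length

section Data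

variable {D n : ℕ} (X : Fin n → E D)

open scoped Classical in
/-- Indices of the sample points that lie in `A`. -/
def indicesIn (A : Set (E D)) : Finset (Fin n) := Finset.univ.filter fun i => X i ∈ A

/-- Empirical measure `μ_n(A)`. -/
def empMass (A : Set (E D)) : ℝ := ((indicesIn X A).card : ℝ) / n

/-- Data diameter `Δ_n(A)`: the diameter of the set of sample points in `A`
(`0` if there are none). -/
def dataDiam (A : Set (E D)) : ℝ := Metric.diam (X '' {i | X i ∈ A})

/-- Average data diameter `Δ_n(𝐀)` of a collection of cells
(`0` if the collection contains no sample point). -/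
def avgDiam (L : List (Node D)) : ℝ :=
  Real.sqrt ((L.map fun A => empMass X A.cell * dataDiam X A.cell ^ 2).sum /
    (L.map fun A => empMass X A.cell).sum)

/-- The median of a finite multiset of reals: the average of the two middle order statistics
(which coincide if the cardinality is odd); `0` for the empty multiset. -/
def median (s : Multiset ℝ) : ℝ :=
  ((s.sort (· ≤ ·)).getD ((s.card - 1) / 2) 0 + (s.sort (· ≤ ·)).getD (s.card / 2) 0) / 2

/-- `median {zᵀ v : z ∈ 𝐗 ∩ A}`, sample points being counted with multiplicity. -/
def projMedian (A : Set (E D)) (v : E D) : ℝ :=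
  median ((indicesIn X A).val.map fun i => inner ℝ (X i) v)

/-! ### The core procedure -/

/-- The threshold `t` used to split the cell `A` at iteration `i` of the basic procedure that was
started on `A₀`. The random draw is `(v, u)` with `u` uniform on `[-1,1]`. At odd global levels
the split is at the median of `A₀` plus the noise `τ = u · (6 / √D) · Δ_n(A₀)`, at even levels it
is at the median of `A`. -/
def threshold (A₀ : Node D) (i : ℕ) (w : E D × ℝ) (A : Node D) : ℝ :=
  if Odd (A₀.level + i) then
    projMedian X A₀.cell w.1 + w.2 * (6 / Real.sqrt D * dataDiam X A₀.cell)
  else projMedian X A.cell w.1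

/-- The two children of `A` for the split `{x ∈ A : xᵀ v ≤ t}` and its complement in `A`. -/
def children (A : Node D) (v : E D) (t : ℝ) : List (Node D) :=
  [⟨A.path ++ [true], {x ∈ A.cell | inner ℝ x v ≤ t}⟩,
   ⟨A.path ++ [false], A.cell \ {x ∈ A.cell | inner ℝ x v ≤ t}⟩]

/-- The leaves of the subtree grown by the basic procedure from `A₀` in `i` iterations; iteration
`i` uses the draw `w i = (v, u)`, the same one for all cells. -/
def basicLeaves (A₀ : Node D) (w : ℕ → E D × ℝ) : ℕ → List (Node D)
  | 0 => [A₀]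
  | i + 1 => (basicLeaves A₀ w i).flatMap fun A =>
      children A (w (i + 1)).1 (threshold X A₀ (i + 1) (w (i + 1)) A)

/-- The depth of the tree returned by the basic procedure called on `A₀` with target diameter
`Δ`: the first `i` at which the average data diameter is at most `Δ` (`⊤` if there is none). -/
def basicDepth (A₀ : Node D) (Δ : ℝ) (w : ℕ → E D × ℝ) : ℕ∞ :=
  sInf ((fun i : ℕ => (i : ℕ∞)) '' {i | avgDiam X (basicLeaves X A₀ w i) ≤ Δ})

/-- The random draws of the algorithm: the draw used at iteration `i` of the `j`-th run of the
basic procedure in the call of the core procedure at the node with path `p` is `ω (p, j, i)`. -/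
abbrev Draws (D : ℕ) := List Bool × ℕ × ℕ → E D × ℝ

/-- Number of runs of the basic procedure in a call of the core procedure. -/
def numRuns (n : ℕ) (δ : ℝ) : ℕ := ⌈Real.logb 2 (6 * (n : ℝ) ^ 2 / δ)⌉₊

variable (δ : ℝ) (ω : Draws D)

/-- Depth of the `j`-th tree in the call of the core procedure on `A` with target
`Δ_n(A) / 2`. -/
def runDepth (A : Node D) (j : ℕ) : ℕ∞ :=
  basicDepth X A (dataDiam X A.cell / 2) fun i => ω (A.path, j, i)

/-- Depth of the (shortest) tree returned by the core procedure on `A`. -/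
def coreDepth (A : Node D) : ℕ∞ := ⨅ j : Fin (numRuns n δ), runDepth X ω A j

/-- The index of the run that is kept: the first one that gives a shortest tree. -/
def coreRun (A : Node D) : ℕ :=
  sInf {j : ℕ | j < numRuns n δ ∧ runDepth X ω A j = coreDepth X δ ω A}

/-- The leaves of the subtree rooted at `A` returned by the core procedure. -/
def coreLeaves (A : Node D) : List (Node D) :=
  basicLeaves X A (fun i => ω (A.path, coreRun X δ ω A, i)) (coreDepth X δ ω A).toNat

/-! ### The adaptive procedure with automatic stopping -/

/-- The partition `𝐀^i` reached after `i` rounds, as the list of leaves of the current tree. -/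
def partition (𝒳 : Set (E D)) : ℕ → List (Node D)
  | 0 => [⟨[], 𝒳⟩]
  | i + 1 => (partition 𝒳 i).flatMap fun A => coreLeaves X δ ω A

/-- The level of a partition: the largest level of one of its leaves. -/
def listLevel (L : List (Node D)) : ℕ := (L.map Node.level).foldr max 0

/-- `α(n) = (log² n) log log (n/δ) + log (1/δ)`, logarithms to base `2`. -/
def alpha (n : ℕ) (δ : ℝ) : ℝ :=
  Real.logb 2 n ^ 2 * Real.logb 2 (Real.logb 2 (n / δ)) + Real.logb 2 (1 / δ)

/-- The automatic stopping condition at round `i`. If `Δ_n(𝐀^i) = 0` the condition holds, in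
agreement with the convention `log 0 = -∞`. -/
def StopCond (𝒳 : Set (E D)) (i : ℕ) : Prop :=
  Real.logb 2 (n * avgDiam X (partition X δ ω 𝒳 i) ^ 2 / (alpha n δ * dataDiam X 𝒳 ^ 2))
    ≤ (listLevel (partition X δ ω 𝒳 i) : ℝ)

/-- The procedure stops at round `i` (the condition is tested after each round `1, 2, …`). -/
def StopsAt (𝒳 : Set (E D)) (i : ℕ) : Prop :=
  1 ≤ i ∧ StopCond X δ ω 𝒳 i ∧ ∀ j, 1 ≤ j → j < i → ¬ StopCond X δ ω 𝒳 j

/-- With `I` the round at which the procedure stops, the procedure attains the diameter decrease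
rate `k ≥ d`: every call of the core procedure in the rounds `1, …, I` returns a tree of depth at
most `k`. -/
def AttainsRate (𝒳 : Set (E D)) (d : ℝ) (I : ℕ) (k : ℝ) : Prop :=
  d ≤ k ∧ ∀ i < I, ∀ A ∈ partition X δ ω 𝒳 i, ∃ m : ℕ, coreDepth X δ ω A = m ∧ (m : ℝ) ≤ k

/-- The criterion `(α(n)/n) |𝐀| + Δ_n(𝐀)²` for selecting the returned partition. -/
def score (L : List (Node D)) : ℝ := alpha n δ / n * L.length + avgDiam X L ^ 2

/-- `𝐀*` is returned by the procedure stopped at round `I`: it minimizes the criterion over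
`{𝐀^{I-1}, 𝐀^I}` (either one may be returned in case of a tie). -/
def IsReturned (𝒳 : Set (E D)) (I : ℕ) (L : List (Node D)) : Prop :=
  (L = partition X δ ω 𝒳 (I - 1) ∨ L = partition X δ ω 𝒳 I) ∧
    score X δ L ≤ score X δ (partition X δ ω 𝒳 (I - 1)) ∧
    score X δ L ≤ score X δ (partition X δ ω 𝒳 I)

/-! ### The regressor and its risk -/

/-- `𝐀(x)`: the cell of the partition to which `x` belongs (empty if there is none). -/
def cellOf (L : List (Node D)) (x : E D) : Set (E D) :=
  {z | ∃ A ∈ L, x ∈ A.cell ∧ z ∈ A.cell}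

/-- The piecewise constant regressor `f_{n,𝐀}`: the average of the `Y_i` with `X_i` in the cell
of `x`, and `y₀` if that cell contains no sample point. -/
def regressor {D' : ℕ} (Y : Fin n → E D') (y₀ : E D') (L : List (Node D)) (x : E D) : E D' :=
  if (indicesIn X (cellOf L x)).card = 0 then y₀
  else ((indicesIn X (cellOf L x)).card : ℝ)⁻¹ • ∑ i ∈ indicesIn X (cellOf L x), Y i

end Data

/-- The integrated `l₂` risk `R(g) = 𝔼 ‖Y - g(X)‖²`. -/
def risk {D D' : ℕ} (ρ : Measure (E D × E D')) (g : E D → E D') : ℝ :=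
  ∫ z, ‖z.2 - g z.1‖ ^ 2 ∂ρ

/-- The integrated squared distance `𝔼 ‖f(X) - g(X)‖²`, as an element of `[0, ∞]`. -/
def sqDist {D D' : ℕ} (ρ : Measure (E D × E D')) (g f : E D → E D') : ℝ≥0∞ :=
  ∫⁻ x, ENNReal.ofReal (‖f x - g x‖ ^ 2) ∂(ρ.map Prod.fst)

/-- `f` is a version of the regression function `x ↦ 𝔼[Y | X = x]`. -/
def IsRegressionFunction {D D' : ℕ} (ρ : Measure (E D × E D')) (f : E D → E D') : Prop :=
  ρ[Prod.snd | MeasurableSpace.comap (Prod.fst : E D × E D' → E D) inferInstance]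
    =ᵐ[ρ] fun z => f z.1

/-! ### Law of the random draws -/

/-- Law of one draw: `v ∼ 𝒩(0, I_D / D)` and, independently, `u ∼ 𝒰[-1, 1]`. -/
def drawLaw (D : ℕ) : Measure (E D × ℝ) :=
  (multivariateGaussian (0 : E D) ((D : ℝ)⁻¹ • (1 : Matrix (Fin D) (Fin D) ℝ))).prod
    (ProbabilityTheory.cond volume (Set.Icc (-1 : ℝ) 1))

instance drawLaw_isProbabilityMeasure (D : ℕ) : IsProbabilityMeasure (drawLaw D) := by
  have : IsProbabilityMeasure (ProbabilityTheory.cond volume (Set.Icc (-1 : ℝ) 1)) :=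
    cond_isProbabilityMeasure_of_finite (by simp) (by simp)
  unfold drawLaw
  infer_instance

/-- All draws are independent with the same law. -/
def drawsLaw (D : ℕ) : Measure (Draws D) := Measure.infinitePi fun _ => drawLaw D

/-- Joint law of the i.i.d. sample of size `n` and the independent random draws. -/
def jointLaw {D D' : ℕ} (ρ : Measure (E D × E D')) [IsProbabilityMeasure ρ] (n : ℕ) :
    Measure ((Fin n → E D × E D') × Draws D) :=
  (Measure.pi fun _ : Fin n => ρ).prod (drawsLaw D)

end RPTree

end

open RPTree

/-!
The proof combines a bound for the depths of the trees returned by the core procedure, which decides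
how many rounds and cells are needed to reach a given average data diameter, with a uniform
concentration bound over all cells that the procedure may produce.

*Depths.* The splits, the stopping conditions and the paths of the cells only depend on the sets of
indices of the sample points in the cells. So the procedure takes values in a countable set
(`map_toIndex_partition`), its events are measurable, and whether a node is reached is independent
of the draws attached to this node. In a cell of data diameter `Δ`, take two balls of radius of
order `Δ / √d` whose centers are at distance at least `Δ / 4`. By chaining in the doubling set, a
random direction projects each of them to an interval of length of order `Δ / √D`, at most a small
part of the typical distance between the projected centers (`dirLaw_projection_ball`), and the
median is not far away. So the noisy threshold falls between the two intervals with probability at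
least `1 / 500` (`drawLaw_separating`). There are `2 ^ O(d log d)` pairs of such balls in a cover,
and once all of them have been separated every leaf has data diameter at most `Δ / 2`. Hence a run
has depth `O(d log d)` with probability at least `1 / 2`, and the shortest of `⌈log (6 n² / δ)⌉`
runs fails to be that short with probability at most `δ / (6 n²)`. As at most `n` calls in each of
`n` rounds concern cells with distinct sample points, a union bound in expectation gives
`drawsLaw_exists_call_gt`.

*Stopping.* Each round halves the average data diameter, while the level of any cell with distinct
sample points increases; so the procedure stops after at most `n` rounds (`exists_stopsAt`). If all
calls return trees of depth at most `k`, there are at most `2 ^ (k i)` cells after `i` rounds.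
Before the last round the failure of the stopping condition controls the number of cells by the
average diameter, at the last round the condition controls the average diameter by the number of
cells. Whether the procedure stops before or after the round at which the two terms of the score
balance, one of its last two partitions has a score of order `(α(n) / n) ^ (2 / (2 + k))`
(`score_le`).

*Concentration.* The cells depend on the sample through medians, so that concentration must hold
uniformly. A cell has the same sample points as a larger polyhedron whose faces are orthogonal to
drawn directions and pass through sample points (`exists_polytope`). For given draws such a
polyhedron, and its part outside of a ball centered at a sample point, is determined by `O(log n)`
of the sample points, and the logarithm of the number of these regions is of order `α(n)`
(`confLevel_le`). A Chernoff bound for the remaining sample points controls the mass of the regions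
(`pi_region_mass`). Given the `X_j` the set of sample points in a polyhedron is fixed and the
residuals are centered, so that a dimension-free inequality of Pinelis type controls the norm of
their sum (`pi_norm_sum_gt_le`). Then the error in a cell is at most a constant times
`α(n) / n + μ_n(A) Δ_n(A)²` (`setIntegral_cell_le`): points of the cell that are far from its sample
points lie in a region without sample points, the mass of which is small. Summation over the cells
yields a constant times the score of the partition.

The set `𝒳` and the regression function `f` need not be measurable. The former is handled by
comparison with the partition of the whole space by the same hyperplanes (`regressor_eq_univ`), the
latter by a measurable version with values in the ball that contains `𝒴`
(`exists_measurable_version`). If the sample is small, if `α(n) ≥ n` or if `k ≥ log n`, the bound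
follows from the boundedness of the response (`one_div_sixteen_le_rpow`).
-/

noncomputable section

namespace RPTree

/-! ### Order statistics and medians -/

lemma getElem_le_iff_lt_countP (l : List ℝ) (hl : l.Pairwise (· ≤ ·)) (t : ℝ) (m : ℕ)
    (hm : m < l.length) : l[m] ≤ t ↔ m < l.countP (fun x => decide (x ≤ t)) := by
  induction l generalizing m with
  | nil => simp at hm
  | cons a l ih =>
    rw [List.pairwise_cons] at hl
    by_cases ha : a ≤ t
    · cases m with
      | zero => simp [ha]
      | succ m =>
        have := ih hl.2 m (by simpa using hm)
        simp [ha, this]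
    · have h0 : l.countP (fun x => decide (x ≤ t)) = 0 := by
        rw [List.countP_eq_zero]
        intro x hx
        have := hl.1 x hx
        simp only [decide_eq_true_eq]
        intro h
        exact ha (this.trans h)
      cases m with
      | zero => simp [ha, h0]
      | succ m =>
        have hm' : m < l.length := by simpa using hm
        have := hl.1 l[m] (List.getElem_mem hm')
        simp only [List.getElem_cons_succ, List.countP_cons, h0, ha]
        constructor
        · intro h; exact absurd (this.trans h) ha
        · simp

lemma sort_getD_le_iff (s : Multiset ℝ) (t : ℝ) (m : ℕ) (hm : m < s.card) :
    (s.sort (· ≤ ·)).getD m 0 ≤ t ↔ m < s.countP (· ≤ t) := by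
  have hlen : m < (s.sort (· ≤ ·)).length := by simpa using hm
  rw [List.getD_eq_getElem _ _ hlen, getElem_le_iff_lt_countP _ (Multiset.pairwise_sort _ _)]
  conv_rhs => rw [← Multiset.sort_eq s (· ≤ ·)]
  rw [Multiset.coe_countP]

/-- If more than half of the elements lie in `[a, b]`, so does the median. -/
lemma median_mem_Icc (s : Multiset ℝ) (a b : ℝ)
    (h : s.card < 2 * s.countP (fun x => a ≤ x ∧ x ≤ b)) : median s ∈ Set.Icc a b := by
  have hle : s.countP (fun x => a ≤ x ∧ x ≤ b) ≤ s.card := Multiset.countP_le_card _ _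
  have hpos : 0 < s.card := by omega
  have hb : s.countP (fun x => a ≤ x ∧ x ≤ b) ≤ s.countP (· ≤ b) := by
    rw [Multiset.countP_eq_card_filter, Multiset.countP_eq_card_filter]
    exact Multiset.card_le_card (Multiset.monotone_filter_right s fun x hx => hx.2)
  have ha : ∀ c < a, s.countP (· ≤ c) + s.countP (fun x => a ≤ x ∧ x ≤ b) ≤ s.card := by
    intro c hc
    rw [Multiset.card_eq_countP_add_countP (fun x => x ≤ c) s]
    gcongr
    rw [Multiset.countP_eq_card_filter, Multiset.countP_eq_card_filter]
    exact Multiset.card_le_card (Multiset.monotone_filter_right s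
      fun x hx => not_le.2 (hc.trans_le hx.1))
  have key : ∀ m, m < s.card → (s.card - 1) / 2 ≤ m → m ≤ s.card / 2 →
      (s.sort (· ≤ ·)).getD m 0 ∈ Set.Icc a b := by
    intro m hm h1 h2
    constructor
    · by_contra! hlt
      have h3 := (sort_getD_le_iff s _ m hm).1 le_rfl
      have := ha _ hlt
      omega
    · rw [sort_getD_le_iff s b m hm]
      omega
  have k1 := key ((s.card - 1) / 2) (by omega) le_rfl (by omega)
  have k2 := key (s.card / 2) (by omega) (by omega) le_rfl
  unfold median
  exact ⟨by linarith [k1.1, k2.1], by linarith [k1.2, k2.2]⟩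

lemma measurable_median {Ω : Type*} [MeasurableSpace Ω] {ι : Type*} (J : Finset ι)
    (g : Ω → ι → ℝ) (hg : ∀ i, Measurable fun a => g a i) :
    Measurable fun a => median (J.val.map (g a)) := by
  have key : ∀ m, Measurable fun a => ((J.val.map (g a)).sort (· ≤ ·)).getD m 0 := by
    intro m
    by_cases hm : m < J.card
    · refine measurable_of_Iic fun t => ?_
      have : (fun a => ((J.val.map (g a)).sort (· ≤ ·)).getD m 0) ⁻¹' Set.Iic t =
          {a | m < ∑ i ∈ J, if g a i ≤ t then 1 else 0} := by
        ext a
        simp only [Set.mem_preimage, Set.mem_Iic, Set.mem_ofPred_eq]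
        rw [sort_getD_le_iff _ _ _ (by simpa using hm), Multiset.countP_map,
          ← Finset.card_filter]
        rfl
      rw [this]
      refine measurableSet_lt measurable_const ?_
      refine Finset.measurable_sum _ fun i _ => ?_
      exact Measurable.ite (measurableSet_le (hg i) measurable_const) measurable_const
        measurable_const
    · have : (fun a => ((J.val.map (g a)).sort (· ≤ ·)).getD m 0) = fun _ => 0 := by
        funext a
        rw [List.getD_eq_default]
        simpa using hm
      rw [this]; exact measurable_const
  unfold median
  simp only [Multiset.card_map]
  exact ((key _).add (key _)).div_const 2

/-! ### The procedure seen through the indices of the sample points -/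

section IndexProcess

variable {D n : ℕ} (X : Fin n → E D)

/-- A node of the tree reduced to its path and the set of indices of its sample points. Apart from
the cells themselves, all quantities used by the procedure depend on a node only through
this pair, which takes countably many values. -/
abbrev IndexNode (n : ℕ) := List Bool × Finset (Fin n)

/-- The reduction of a node. -/
def Node.toIndex (A : Node D) : IndexNode n := (A.path, indicesIn X A.cell)

/-- Data diameter of a set of indices. -/
def idxDiam (J : Finset (Fin n)) : ℝ := Metric.diam (X '' (J : Set (Fin n)))

/-- Average data diameter of a list of reduced nodes. -/
def idxAvgDiam (L : List (IndexNode n)) : ℝ :=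
  Real.sqrt ((L.map fun a => (a.2.card : ℝ) / n * idxDiam X a.2 ^ 2).sum /
    (L.map fun a => (a.2.card : ℝ) / n).sum)

/-- Median of the projections of the sample points with index in `J`. -/
def idxMedian (J : Finset (Fin n)) (v : E D) : ℝ := median (J.val.map fun i => inner ℝ (X i) v)

/-- Counterpart of `threshold` for reduced nodes. -/
def idxThreshold (a₀ : IndexNode n) (i : ℕ) (w : E D × ℝ) (a : IndexNode n) : ℝ :=
  if Odd (a₀.1.length + i) then
    idxMedian X a₀.2 w.1 + w.2 * (6 / Real.sqrt D * idxDiam X a₀.2)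
  else idxMedian X a.2 w.1

/-- Counterpart of `children` for reduced nodes. -/
def idxChildren (a : IndexNode n) (v : E D) (t : ℝ) : List (IndexNode n) :=
  [(a.1 ++ [true], a.2.filter fun i => inner ℝ (X i) v ≤ t),
   (a.1 ++ [false], a.2.filter fun i => ¬ inner ℝ (X i) v ≤ t)]

/-- Counterpart of `basicLeaves` for reduced nodes. -/
def idxLeaves (a₀ : IndexNode n) (w : ℕ → E D × ℝ) : ℕ → List (IndexNode n)
  | 0 => [a₀]
  | i + 1 => (idxLeaves a₀ w i).flatMap fun a =>
      idxChildren X a (w (i + 1)).1 (idxThreshold X a₀ (i + 1) (w (i + 1)) a)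

/-- Counterpart of `basicDepth` for reduced nodes. -/
def idxDepth (a₀ : IndexNode n) (Δ : ℝ) (w : ℕ → E D × ℝ) : ℕ∞ :=
  sInf ((fun i : ℕ => (i : ℕ∞)) '' {i | idxAvgDiam X (idxLeaves X a₀ w i) ≤ Δ})

variable (δ : ℝ) (ω : Draws D)

/-- Counterpart of `runDepth` for reduced nodes. -/
def idxRunDepth (a : IndexNode n) (j : ℕ) : ℕ∞ :=
  idxDepth X a (idxDiam X a.2 / 2) fun i => ω (a.1, j, i)

/-- Counterpart of `coreDepth` for reduced nodes. -/
def idxCoreDepth (a : IndexNode n) : ℕ∞ := ⨅ j : Fin (numRuns n δ), idxRunDepth X ω a j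

/-- Counterpart of `coreRun` for reduced nodes. -/
def idxCoreRun (a : IndexNode n) : ℕ :=
  sInf {j : ℕ | j < numRuns n δ ∧ idxRunDepth X ω a j = idxCoreDepth X δ ω a}

/-- Counterpart of `coreLeaves` for reduced nodes. -/
def idxCoreLeaves (a : IndexNode n) : List (IndexNode n) :=
  idxLeaves X a (fun i => ω (a.1, idxCoreRun X δ ω a, i)) (idxCoreDepth X δ ω a).toNat

/-- Counterpart of `partition` for reduced nodes, for a sample contained in the root cell. -/
def idxPartition : ℕ → List (IndexNode n)
  | 0 => [([], Finset.univ)]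
  | i + 1 => (idxPartition i).flatMap fun a => idxCoreLeaves X δ ω a

variable {X δ ω}

lemma mem_indicesIn {A : Set (E D)} {i : Fin n} : i ∈ indicesIn X A ↔ X i ∈ A := by
  simp [indicesIn]

lemma dataDiam_eq_idxDiam (A : Set (E D)) : dataDiam X A = idxDiam X (indicesIn X A) := by
  unfold dataDiam idxDiam
  congr 2
  ext i
  simp [mem_indicesIn]

lemma avgDiam_eq_idxAvgDiam (L : List (Node D)) :
    avgDiam X L = idxAvgDiam X (L.map (Node.toIndex X)) := by
  simp only [avgDiam, idxAvgDiam, List.map_map, empMass, dataDiam_eq_idxDiam]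
  rfl

lemma threshold_eq_idxThreshold (A₀ A : Node D) (i : ℕ) (w : E D × ℝ) :
    threshold X A₀ i w A = idxThreshold X (A₀.toIndex X) i w (A.toIndex X) := by
  simp only [threshold, idxThreshold, Node.toIndex, dataDiam_eq_idxDiam, Node.level]
  rfl

lemma map_toIndex_children (A : Node D) (v : E D) (t : ℝ) :
    (children A v t).map (Node.toIndex X) = idxChildren X (A.toIndex X) v t := by
  simp only [children, idxChildren, Node.toIndex, List.map_cons, List.map_nil]
  congr 2
  · ext i
    simp [mem_indicesIn]
  · congr 2
    ext i
    simp only [mem_indicesIn, Set.mem_sdiff, Set.mem_ofPred_eq, Finset.mem_filter]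
    tauto

lemma map_toIndex_basicLeaves (A₀ : Node D) (w : ℕ → E D × ℝ) (i : ℕ) :
    (basicLeaves X A₀ w i).map (Node.toIndex X) = idxLeaves X (A₀.toIndex X) w i := by
  induction i with
  | zero => rfl
  | succ i ih =>
    simp only [basicLeaves, idxLeaves, ← ih, List.map_flatMap, List.flatMap_map,
      map_toIndex_children, threshold_eq_idxThreshold]

lemma runDepth_eq (A : Node D) (j : ℕ) :
    runDepth X ω A j = idxRunDepth X ω (A.toIndex X) j := by
  simp only [runDepth, idxRunDepth, basicDepth, idxDepth, avgDiam_eq_idxAvgDiam,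
    map_toIndex_basicLeaves, dataDiam_eq_idxDiam]
  rfl

lemma coreDepth_eq (A : Node D) : coreDepth X δ ω A = idxCoreDepth X δ ω (A.toIndex X) := by
  simp only [coreDepth, idxCoreDepth, runDepth_eq]

lemma map_toIndex_coreLeaves (A : Node D) :
    (coreLeaves X δ ω A).map (Node.toIndex X) = idxCoreLeaves X δ ω (A.toIndex X) := by
  simp only [coreLeaves, idxCoreLeaves, map_toIndex_basicLeaves, coreRun, idxCoreRun, runDepth_eq,
    coreDepth_eq]
  rfl

lemma map_toIndex_partition {𝒳 : Set (E D)} (hX : ∀ i, X i ∈ 𝒳) (i : ℕ) :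
    (partition X δ ω 𝒳 i).map (Node.toIndex X) = idxPartition X δ ω i := by
  induction i with
  | zero =>
    simp only [partition, idxPartition, List.map_cons, List.map_nil, Node.toIndex]
    congr 2
    ext i
    simp [mem_indicesIn, hX]
  | succ i ih =>
    simp only [partition, idxPartition, ← ih, List.map_flatMap, List.flatMap_map,
      map_toIndex_coreLeaves]

lemma idxDiam_nonneg (J : Finset (Fin n)) : 0 ≤ idxDiam X J := Metric.diam_nonneg

lemma dist_le_idxDiam {J : Finset (Fin n)} {i j : Fin n} (hi : i ∈ J) (hj : j ∈ J) :
    dist (X i) (X j) ≤ idxDiam X J :=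
  Metric.dist_le_diam_of_mem (J.finite_toSet.image X).isBounded ⟨i, hi, rfl⟩ ⟨j, hj, rfl⟩

lemma idxDiam_le_iff {J : Finset (Fin n)} {r : ℝ} (hr : 0 ≤ r) :
    idxDiam X J ≤ r ↔ ∀ i ∈ J, ∀ j ∈ J, dist (X i) (X j) ≤ r := by
  constructor
  · intro h i hi j hj
    exact (dist_le_idxDiam hi hj).trans h
  · intro h
    refine Metric.diam_le_of_forall_dist_le hr ?_
    rintro _ ⟨i, hi, rfl⟩ _ ⟨j, hj, rfl⟩
    exact h i hi j hj

lemma idxDiam_mono {J K : Finset (Fin n)} (h : J ⊆ K) : idxDiam X J ≤ idxDiam X K :=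
  (idxDiam_le_iff (idxDiam_nonneg _)).2 fun _ hi _ hj => dist_le_idxDiam (h hi) (h hj)

lemma idxDepth_le_iff {a₀ : IndexNode n} {Δ : ℝ} {w : ℕ → E D × ℝ} {m : ℕ} :
    idxDepth X a₀ Δ w ≤ m ↔ ∃ i ≤ m, idxAvgDiam X (idxLeaves X a₀ w i) ≤ Δ := by
  unfold idxDepth
  constructor
  · intro h
    by_contra! hc
    have : ((m + 1 : ℕ) : ℕ∞) ≤ sInf ((fun i : ℕ => (i : ℕ∞)) ''
        {i | idxAvgDiam X (idxLeaves X a₀ w i) ≤ Δ}) := by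
      refine le_sInf ?_
      rintro _ ⟨i, hi, rfl⟩
      by_contra! hlt
      have : i ≤ m := by
        have : i < m + 1 := by exact_mod_cast hlt
        omega
      exact absurd hi (not_le.2 (hc i this))
    have h2 : ((m + 1 : ℕ) : ℕ∞) ≤ m := this.trans h
    have : m + 1 ≤ m := by exact_mod_cast h2
    omega
  · rintro ⟨i, hi, h⟩
    have hi' : (i : ℕ∞) ≤ m := Nat.cast_le.2 hi
    exact le_trans (sInf_le (Set.mem_image_of_mem (fun i : ℕ => (i : ℕ∞)) h)) hi'

end IndexProcess

/-! ### Measurability of the reduced procedure -/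

/-- A map to a type without `σ`-algebra, to be thought of as countable and discrete, is measurable
if its fibers are. -/
def MeasurableFibers {Ω α : Type*} [MeasurableSpace Ω] (F : Ω → α) : Prop :=
  ∀ x, MeasurableSet {a | F a = x}

namespace MeasurableFibers

variable {Ω α β : Type*} [MeasurableSpace Ω]

lemma const (x : α) : MeasurableFibers fun _ : Ω => x := fun y => by
  by_cases h : x = y <;> simp [h]

lemma setOf_rel [Countable α] {F : Ω → α} (hF : MeasurableFibers F) {P : α → Ω → Prop}
    (hP : ∀ x, MeasurableSet {a | P x a}) : MeasurableSet {a | P (F a) a} := by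
  have : {a | P (F a) a} = ⋃ x, {a | F a = x} ∩ {a | P x a} := by
    ext a; simp
  rw [this]
  exact MeasurableSet.iUnion fun x => (hF x).inter (hP x)

lemma bind [Countable α] {F : Ω → α} (hF : MeasurableFibers F) {G : α → Ω → β}
    (hG : ∀ x, MeasurableFibers (G x)) : MeasurableFibers fun a => G (F a) a :=
  fun y => hF.setOf_rel fun x => hG x y

lemma map [Countable α] {F : Ω → α} (hF : MeasurableFibers F) (g : α → β) :
    MeasurableFibers fun a => g (F a) := hF.bind fun x => const (g x)

lemma map₂ {γ : Type*} [Countable α] [Countable β] {F : Ω → α} {G : Ω → β}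
    (hF : MeasurableFibers F) (hG : MeasurableFibers G) (g : α → β → γ) :
    MeasurableFibers fun a => g (F a) (G a) := hF.bind fun x => hG.map (g x)

lemma setOf_mem [Countable α] {F : Ω → α} (hF : MeasurableFibers F) (S : Set α) :
    MeasurableSet {a | F a ∈ S} :=
  hF.setOf_rel (P := fun x _ => x ∈ S) fun _ => MeasurableSet.const _

lemma flatMap [Countable β] (L : List α) {G : α → Ω → List β}
    (hG : ∀ x, MeasurableFibers (G x)) : MeasurableFibers fun a => L.flatMap fun x => G x a := by
  induction L with
  | nil => exact const _
  | cons x L ih =>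
    simp only [List.flatMap_cons]
    exact (hG x).map₂ ih (· ++ ·)

lemma pi {ι : Type*} [Countable ι] {F : Ω → ι → α}
    (hF : ∀ i, MeasurableFibers fun a => F a i) :
    MeasurableFibers F := fun y => by
  have : {a | F a = y} = ⋂ i, {a | F a i = y i} := by
    ext a; simp [funext_iff]
  rw [this]
  exact MeasurableSet.iInter fun i => hF i (y i)

lemma enat_of_le {F : Ω → ℕ∞} (hF : ∀ m : ℕ, MeasurableSet {a | F a ≤ m}) :
    MeasurableFibers F := by
  intro x
  have hlt : ∀ m : ℕ, MeasurableSet {a | F a < m} := by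
    intro m
    cases m with
    | zero => simp
    | succ m =>
      convert hF m using 3 with a
      push_cast
      exact ENat.lt_natCast_add_one_iff
  induction x using ENat.recTopCoe with
  | top =>
    have : {a | F a = ⊤} = (⋃ m : ℕ, {a | F a ≤ m})ᶜ := by
      ext a
      simp only [Set.mem_ofPred_eq, Set.mem_compl_iff, Set.mem_iUnion, not_exists, not_le]
      constructor
      · intro h m; rw [h]; exact ENat.natCast_lt_top m
      · intro h
        by_contra hne
        obtain ⟨k, hk⟩ := ENat.ne_top_iff_exists.1 hne
        have := h k
        rw [← hk] at this
        exact lt_irrefl _ this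
    rw [this]
    exact (MeasurableSet.iUnion hF).compl
  | coe m =>
    have : {a | F a = m} = {a | F a ≤ m} \ {a | F a < m} := by
      ext a
      simp only [Set.mem_ofPred_eq, Set.mem_sdiff, not_lt]
      exact le_antisymm_iff
    rw [this]
    exact (hF m).diff (hlt m)

end MeasurableFibers

section Measurability

variable {D n : ℕ} {Ω : Type*} [MeasurableSpace Ω] {X : Ω → Fin n → E D}

lemma measurable_idxDiam (hX : Measurable X) (J : Finset (Fin n)) :
    Measurable fun a => idxDiam (X a) J := by
  have hXi : ∀ i, Measurable fun a => X a i := fun i => (measurable_pi_apply i).comp hX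
  refine measurable_of_Iic fun r => ?_
  by_cases hr : 0 ≤ r
  · have : (fun a => idxDiam (X a) J) ⁻¹' Set.Iic r =
        ⋂ i ∈ J, ⋂ j ∈ J, {a | dist (X a i) (X a j) ≤ r} := by
      ext a
      simp only [Set.mem_preimage, Set.mem_Iic, idxDiam_le_iff hr, Set.mem_iInter,
        Set.mem_ofPred_eq]
    rw [this]
    refine Finset.measurableSet_biInter _ fun i _ => Finset.measurableSet_biInter _ fun j _ => ?_
    exact measurableSet_le ((hXi i).dist (hXi j)) measurable_const
  · have : (fun a => idxDiam (X a) J) ⁻¹' Set.Iic r = ∅ := by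
      ext a
      simp only [Set.mem_preimage, Set.mem_Iic, Set.mem_empty_iff_false, iff_false, not_le]
      exact (not_le.1 hr).trans_le (idxDiam_nonneg J)
    rw [this]; exact MeasurableSet.empty

lemma measurable_idxAvgDiam (hX : Measurable X) (L : List (IndexNode n)) :
    Measurable fun a => idxAvgDiam (X a) L := by
  have h1 : Measurable fun a =>
      (L.map fun b => (b.2.card : ℝ) / n * idxDiam (X a) b.2 ^ 2).sum := by
    induction L with
    | nil => simp
    | cons b L ih =>
      simp only [List.map_cons, List.sum_cons]
      exact (((measurable_idxDiam hX _).pow_const 2).const_mul _).add ih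
  exact (h1.div_const _).sqrt

lemma measurable_inner_sample (hX : Measurable X) {v : Ω → E D} (hv : Measurable v) (i : Fin n) :
    Measurable fun a => (inner ℝ (X a i) (v a) : ℝ) :=
  ((measurable_pi_apply i).comp hX).inner hv

lemma measurable_idxMedian (hX : Measurable X) {v : Ω → E D} (hv : Measurable v)
    (J : Finset (Fin n)) : Measurable fun a => idxMedian (X a) J (v a) :=
  measurable_median J (fun a i => inner ℝ (X a i) (v a)) (measurable_inner_sample hX hv)

lemma measurable_idxThreshold (hX : Measurable X) {w : Ω → E D × ℝ} (hw : Measurable w)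
    (a₀ b : IndexNode n) (i : ℕ) : Measurable fun a => idxThreshold (X a) a₀ i (w a) b := by
  unfold idxThreshold
  split_ifs
  · exact (measurable_idxMedian hX hw.fst _).add
      (hw.snd.mul ((measurable_idxDiam hX _).const_mul _))
  · exact measurable_idxMedian hX hw.fst _

lemma measurableFibers_filter (J : Finset (Fin n)) {f : Ω → Fin n → ℝ} {t : Ω → ℝ}
    (hf : ∀ i, Measurable fun a => f a i) (ht : Measurable t) :
    MeasurableFibers fun a => J.filter fun i => f a i ≤ t a := by
  intro K
  have : {a | (J.filter fun i => f a i ≤ t a) = K} =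
      ⋂ i, {a | (i ∈ J ∧ f a i ≤ t a) ↔ i ∈ K} := by
    ext a
    simp [Finset.ext_iff]
  rw [this]
  refine MeasurableSet.iInter fun i => ?_
  have h := measurableSet_le (hf i) ht
  by_cases h1 : i ∈ J <;> by_cases h2 : i ∈ K <;> simp only [h1, h2, true_and, false_and, iff_true,
    iff_false]
  · exact h
  · exact h.compl
  · simp
  · simp

lemma measurableFibers_idxChildren (hX : Measurable X) (b : IndexNode n) {v : Ω → E D}
    {t : Ω → ℝ} (hv : Measurable v) (ht : Measurable t) :
    MeasurableFibers fun a => idxChildren (X a) b (v a) (t a) := by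
  have h := measurableFibers_filter b.2 (measurable_inner_sample hX hv) ht
  have h2 := h.map fun K => ([(b.1 ++ [true], K), (b.1 ++ [false], b.2 \ K)] : List (IndexNode n))
  convert h2 using 1
  funext a
  simp only [idxChildren, Finset.filter_not]

lemma measurableFibers_idxLeaves (hX : Measurable X) (a₀ : IndexNode n) {w : Ω → ℕ → E D × ℝ}
    (hw : Measurable w) (i : ℕ) : MeasurableFibers fun a => idxLeaves (X a) a₀ (w a) i := by
  induction i with
  | zero => exact MeasurableFibers.const _
  | succ i ih =>
    have hwi : Measurable fun a => w a (i + 1) := (measurable_pi_apply (i + 1)).comp hw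
    refine ih.bind (G := fun L a => L.flatMap fun b => idxChildren (X a) b (w a (i + 1)).1
      (idxThreshold (X a) a₀ (i + 1) (w a (i + 1)) b)) fun L =>
        MeasurableFibers.flatMap L fun b => ?_
    exact measurableFibers_idxChildren hX b hwi.fst (measurable_idxThreshold hX hwi _ _ _)

lemma measurableFibers_idxDepth (hX : Measurable X) (a₀ : IndexNode n) {w : Ω → ℕ → E D × ℝ}
    (hw : Measurable w) {r : Ω → ℝ} (hr : Measurable r) :
    MeasurableFibers fun a => idxDepth (X a) a₀ (r a) (w a) := by
  refine MeasurableFibers.enat_of_le fun m => ?_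
  have : {a | idxDepth (X a) a₀ (r a) (w a) ≤ m} =
      ⋃ i ≤ m, {a | idxAvgDiam (X a) (idxLeaves (X a) a₀ (w a) i) ≤ r a} := by
    ext a; simp [idxDepth_le_iff]
  rw [this]
  refine MeasurableSet.iUnion fun i => MeasurableSet.iUnion fun _ => ?_
  exact (measurableFibers_idxLeaves hX a₀ hw i).setOf_rel
    (P := fun L a => idxAvgDiam (X a) L ≤ r a)
    fun L => measurableSet_le (measurable_idxAvgDiam hX L) hr

variable {δ : ℝ} {ω : Ω → Draws D}

lemma measurableFibers_idxRunDepth (hX : Measurable X) (hω : Measurable ω) (b : IndexNode n)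
    (j : ℕ) : MeasurableFibers fun a => idxRunDepth (X a) (ω a) b j := by
  refine measurableFibers_idxDepth hX b ?_ ((measurable_idxDiam hX _).div_const 2)
  exact measurable_pi_lambda _ fun i => (measurable_pi_apply (b.1, j, i)).comp hω

lemma measurableFibers_idxCoreDepth (hX : Measurable X) (hω : Measurable ω) (b : IndexNode n) :
    MeasurableFibers fun a => idxCoreDepth (X a) δ (ω a) b :=
  (MeasurableFibers.pi (F := fun a (j : Fin (numRuns n δ)) => idxRunDepth (X a) (ω a) b j)
    fun j => measurableFibers_idxRunDepth hX hω b j).map fun F => ⨅ j, F j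

lemma measurableFibers_idxCoreRun (hX : Measurable X) (hω : Measurable ω) (b : IndexNode n) :
    MeasurableFibers fun a => idxCoreRun (X a) δ (ω a) b := by
  have h := (MeasurableFibers.pi
    (F := fun a (j : Fin (numRuns n δ)) => idxRunDepth (X a) (ω a) b j)
    fun j => measurableFibers_idxRunDepth hX hω b j).map
      fun F => sInf {j : ℕ | ∃ hj : j < numRuns n δ, F ⟨j, hj⟩ = ⨅ j, F j}
  convert h using 1
  funext a
  simp only [idxCoreRun, idxCoreDepth, exists_prop]

lemma measurableFibers_idxCoreLeaves (hX : Measurable X) (hω : Measurable ω) (b : IndexNode n) :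
    MeasurableFibers fun a => idxCoreLeaves (X a) δ (ω a) b := by
  refine (measurableFibers_idxCoreRun (δ := δ) hX hω b).bind
    (G := fun r a => idxLeaves (X a) b (fun i => ω a (b.1, r, i))
      (idxCoreDepth (X a) δ (ω a) b).toNat) fun r => ?_
  refine (measurableFibers_idxCoreDepth (δ := δ) hX hω b).bind
    (G := fun m a => idxLeaves (X a) b (fun i => ω a (b.1, r, i)) m.toNat) fun m => ?_
  refine measurableFibers_idxLeaves hX b ?_ _
  exact measurable_pi_lambda _ fun i => (measurable_pi_apply (b.1, r, i)).comp hω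

lemma measurableFibers_idxPartition (hX : Measurable X) (hω : Measurable ω) (i : ℕ) :
    MeasurableFibers fun a => idxPartition (X a) δ (ω a) i := by
  induction i with
  | zero => exact MeasurableFibers.const _
  | succ i ih =>
    exact ih.bind (G := fun L a => L.flatMap fun b => idxCoreLeaves (X a) δ (ω a) b)
      fun L => MeasurableFibers.flatMap L fun b =>
      measurableFibers_idxCoreLeaves hX hω b

end Measurability

/-! ### Gaussian projections -/

section Gaussian

open Real

variable {D : ℕ}

/-- Law of a random direction `v ∼ 𝒩(0, I_D / D)`. -/
def dirLaw (D : ℕ) : Measure (E D) :=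
  multivariateGaussian (0 : E D) ((D : ℝ)⁻¹ • (1 : Matrix (Fin D) (Fin D) ℝ))

instance dirLaw_isProbabilityMeasure (D : ℕ) : IsProbabilityMeasure (dirLaw D) := by
  unfold dirLaw; infer_instance

/-- The standard deviation of the projection `⟨x, v⟩` for a random direction `v`. -/
def projStd (x : E D) : ℝ := ‖x‖ / √D

lemma projStd_nonneg (x : E D) : 0 ≤ projStd x := by unfold projStd; positivity

lemma map_inner_dirLaw (x : E D) :
    (dirLaw D).map (fun v => inner ℝ x v) = gaussianReal 0 (projStd x ^ 2).toNNReal := by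
  refine Measure.ext_of_charFun ?_
  funext t
  have hS : ((D : ℝ)⁻¹ • (1 : Matrix (Fin D) (Fin D) ℝ)).PosSemidef :=
    Matrix.PosSemidef.one.smul (by positivity)
  have h1 : charFun ((dirLaw D).map (fun v => (inner ℝ x v : ℝ))) t
      = charFun (dirLaw D) (t • x) := by
    rw [charFun_apply, charFun_apply, integral_map (by fun_prop) (by fun_prop)]
    refine integral_congr_ae (Filter.Eventually.of_forall fun v => ?_)
    simp [real_inner_smul_right, real_inner_comm, mul_comm]
  rw [h1, dirLaw, charFun_multivariateGaussian hS, charFun_gaussianReal,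
    Real.coe_toNNReal _ (sq_nonneg _)]
  have h2 : ((t • x : E D) : Fin D → ℝ) ⬝ᵥ
      ((D : ℝ)⁻¹ • (1 : Matrix (Fin D) (Fin D) ℝ)).mulVec ((t • x : E D) : Fin D → ℝ)
      = projStd x ^ 2 * t ^ 2 := by
    rw [Matrix.smul_mulVec, Matrix.one_mulVec, dotProduct_smul, projStd, div_pow,
      Real.sq_sqrt (by positivity), EuclideanSpace.norm_sq_eq]
    simp only [dotProduct, PiLp.smul_apply, smul_eq_mul, Real.norm_eq_abs, sq_abs,
      Finset.mul_sum, Finset.sum_mul, Finset.sum_div]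
    refine Finset.sum_congr rfl fun i _ => ?_
    ring
  rw [h2]
  push_cast
  simp

lemma hasSubgaussianMGF_inner (x : E D) :
    HasSubgaussianMGF (fun v => (inner ℝ x v : ℝ)) (projStd x ^ 2).toNNReal (dirLaw D) := by
  refine ⟨fun t => ?_, fun t => ?_⟩
  · have h := integrable_exp_mul_gaussianReal (μ := 0) (v := (projStd x ^ 2).toNNReal) t
    rw [← map_inner_dirLaw] at h
    exact h.comp_measurable (by fun_prop)
  · rw [mgf_gaussianReal (map_inner_dirLaw x)]
    simp

/-- Gaussian tail of a projection. In the degenerate case `x = 0` both sides of the inequality that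
defines the event vanish, and the event is empty. -/
lemma dirLaw_abs_inner_gt (x : E D) {s : ℝ} (hs : 0 ≤ s) :
    dirLaw D {v | s * projStd x < |inner ℝ x v|} ≤ ENNReal.ofReal (2 * exp (-s ^ 2 / 2)) := by
  rcases eq_or_ne (projStd x) 0 with h0 | h0
  · have hx : x = 0 := by
      by_contra hne
      have : Nonempty (Fin D) := by
        by_contra hD
        rw [not_nonempty_iff] at hD
        exact hne (Subsingleton.elim _ _)
      have hD : 0 < D := Fin.pos_iff_nonempty.2 this
      have : 0 < projStd x := by unfold projStd; positivity
      exact this.ne' h0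
    simp [hx, projStd]
  have key : ∀ y : E D, projStd y = projStd x →
      dirLaw D {v | s * projStd x ≤ inner ℝ y v} ≤ ENNReal.ofReal (exp (-s ^ 2 / 2)) := by
    intro y hy
    have h := (hasSubgaussianMGF_inner y).measure_ge_le (ε := s * projStd x)
      (mul_nonneg hs (projStd_nonneg x))
    rw [hy, Real.coe_toNNReal _ (sq_nonneg _)] at h
    have he : -(s * projStd x) ^ 2 / (2 * projStd x ^ 2) = -s ^ 2 / 2 := by field_simp
    rw [he] at h
    rw [← ENNReal.ofReal_toReal (measure_ne_top (dirLaw D) _)]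
    exact ENNReal.ofReal_le_ofReal h
  have hsub : {v | s * projStd x < |inner ℝ x v|} ⊆
      {v | s * projStd x ≤ inner ℝ x v} ∪ {v | s * projStd x ≤ inner ℝ (-x) v} := by
    intro v hv
    rcases lt_abs.1 (show s * projStd x < |inner ℝ x v| from hv) with h | h
    · exact Or.inl h.le
    · refine Or.inr ?_
      change s * projStd x ≤ inner ℝ (-x) v
      rw [inner_neg_left]; exact h.le
  refine (measure_mono hsub).trans ((measure_union_le _ _).trans ?_)
  rw [two_mul, ENNReal.ofReal_add (by positivity) (by positivity)]
  exact add_le_add (key x rfl) (key (-x) (by simp [projStd]))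

/-- A projection is unlikely to be small compared with its standard deviation, since its density is
at most `1 / (√(2π) σ) ≤ 2 / (5 σ)`. -/
lemma dirLaw_abs_inner_lt (x : E D) (hx : 0 < projStd x) {t : ℝ} :
    dirLaw D {v | |inner ℝ x v| < t * projStd x} ≤ ENNReal.ofReal (4 / 5 * t) := by
  set σ := projStd x with hσ
  have hset : {v : E D | |inner ℝ x v| < t * σ} =
      (fun v => (inner ℝ x v : ℝ)) ⁻¹' Set.Ioo (-(t * σ)) (t * σ) := by
    ext v; simp [abs_lt]
  have hv : (σ ^ 2).toNNReal ≠ 0 := by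
    rw [Ne, Real.toNNReal_eq_zero, not_le]; positivity
  rw [hset, ← Measure.map_apply (by fun_prop) measurableSet_Ioo, map_inner_dirLaw,
    gaussianReal_apply _ hv]
  have hpdf : ∀ y, gaussianPDF 0 (σ ^ 2).toNNReal y ≤ ENNReal.ofReal (2 / 5 / σ) := by
    intro y
    rw [gaussianPDF_def]
    refine ENNReal.ofReal_le_ofReal ?_
    rw [gaussianPDFReal_def, Real.coe_toNNReal _ (sq_nonneg _)]
    have h1 : exp (-(y - 0) ^ 2 / (2 * σ ^ 2)) ≤ 1 := by
      rw [Real.exp_le_one_iff]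
      have : 0 ≤ (y - 0) ^ 2 / (2 * σ ^ 2) := by positivity
      rw [neg_div]; linarith
    have h2 : 5 / 2 * σ ≤ √(2 * π * σ ^ 2) := by
      refine Real.le_sqrt_of_sq_le ?_
      have : (25 / 4 : ℝ) ≤ 2 * π := by linarith [Real.pi_gt_d2]
      nlinarith [sq_nonneg σ]
    calc (√(2 * π * σ ^ 2))⁻¹ * exp (-(y - 0) ^ 2 / (2 * σ ^ 2))
        ≤ (√(2 * π * σ ^ 2))⁻¹ * 1 := by gcongr
      _ ≤ (5 / 2 * σ)⁻¹ * 1 := by gcongr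
      _ = 2 / 5 / σ := by field_simp
  calc ∫⁻ y in Set.Ioo (-(t * σ)) (t * σ), gaussianPDF 0 (σ ^ 2).toNNReal y
      ≤ ∫⁻ y in Set.Ioo (-(t * σ)) (t * σ), ENNReal.ofReal (2 / 5 / σ) :=
        lintegral_mono fun y => hpdf y
    _ = ENNReal.ofReal (2 / 5 / σ) * ENNReal.ofReal (t * σ - -(t * σ)) := by
        rw [setLIntegral_const, Real.volume_Ioo]
    _ = ENNReal.ofReal (4 / 5 * t) := by
        rw [← ENNReal.ofReal_mul (by positivity)]
        congr 1
        field_simp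
        ring

end Gaussian

/-! ### Chaining in a doubling set -/

section Chaining

open Real

variable {D : ℕ} {S : Set (E D)} {d : ℝ}

/-- Every ball of radius `r` of `S` is covered by at most `2 ^ d` balls of radius `r / 2`. -/
def Doubling (S : Set (E D)) (d : ℝ) : Prop :=
  ∀ (c : E D) (r : ℝ), 0 < r → ∃ T : Finset (E D), (T.card : ℝ) ≤ (2 : ℝ) ^ d ∧
    Metric.closedBall c r ∩ S ⊆ ⋃ t ∈ T, Metric.closedBall t (r / 2)

open scoped Classical in
/-- Successive refinements of the ball of center `z` and radius `r`, where `T c s` is the set of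
centers of a cover of the ball of center `c` and radius `s` by balls of half the radius. -/
def net (T : E D → ℝ → Finset (E D)) (z : E D) (r : ℝ) : ℕ → Finset (E D)
  | 0 => {z}
  | j + 1 => (net T z r j).biUnion fun t => T t (r / 2 ^ j)

lemma card_net_le {T : E D → ℝ → Finset (E D)} {z : E D} {r : ℝ} (hr : 0 < r)
    (hT : ∀ c s, 0 < s → ((T c s).card : ℝ) ≤ (2 : ℝ) ^ d) (j : ℕ) :
    ((net T z r j).card : ℝ) ≤ ((2 : ℝ) ^ d) ^ j := by
  classical
  induction j with
  | zero => simp [net]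
  | succ j ih =>
    calc ((net T z r (j + 1)).card : ℝ)
        ≤ ((∑ t ∈ net T z r j, (T t (r / 2 ^ j)).card : ℕ) : ℝ) := by
          exact Nat.cast_le.2 Finset.card_biUnion_le
      _ = ∑ t ∈ net T z r j, ((T t (r / 2 ^ j)).card : ℝ) := by push_cast; rfl
      _ ≤ ∑ t ∈ net T z r j, (2 : ℝ) ^ d := Finset.sum_le_sum fun t _ => hT _ _ (by positivity)
      _ = (net T z r j).card * (2 : ℝ) ^ d := by simp
      _ ≤ ((2 : ℝ) ^ d) ^ j * (2 : ℝ) ^ d := by gcongr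
      _ = ((2 : ℝ) ^ d) ^ (j + 1) := by ring

lemma exists_mem_net {T : E D → ℝ → Finset (E D)} {z : E D} {r : ℝ} (hr : 0 < r)
    (hT : ∀ c s, 0 < s → Metric.closedBall c s ∩ S ⊆ ⋃ t ∈ T c s, Metric.closedBall t (s / 2))
    {x : E D} (hx : x ∈ S) (hxz : dist x z ≤ r) (j : ℕ) :
    ∃ t ∈ net T z r j, dist x t ≤ r / 2 ^ j := by
  classical
  induction j with
  | zero => exact ⟨z, by simp [net], by simpa using hxz⟩
  | succ j ih =>
    obtain ⟨t, ht, hxt⟩ := ih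
    have := hT t (r / 2 ^ j) (by positivity) ⟨hxt, hx⟩
    simp only [Set.mem_iUnion, Metric.mem_closedBall, exists_prop] at this
    obtain ⟨t', ht', hx'⟩ := this
    refine ⟨t', ?_, ?_⟩
    · simp only [net, Finset.mem_biUnion]
      exact ⟨t, ht, ht'⟩
    · rw [pow_succ, ← div_div]; exact hx'

lemma sum_succ_div_two_pow_le (m : ℕ) :
    ∑ j ∈ Finset.range m, ((j : ℝ) + 1) / 2 ^ j ≤ 4 := by
  have h : ∑ j ∈ Finset.range m, ((j : ℝ) + 1) / 2 ^ j = 4 - (2 * m + 4) / 2 ^ m := by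
    induction m with
    | zero => norm_num
    | succ m ih =>
      rw [Finset.sum_range_succ, ih, pow_succ]
      push_cast
      field_simp
      ring
  rw [h]
  have : (0 : ℝ) ≤ (2 * m + 4) / 2 ^ m := by positivity
  linarith

lemma eighty_le_exp : (80 : ℝ) ≤ exp (9 / 2) := by
  have h1 : (2.71 : ℝ) ≤ exp 1 := by linarith [Real.exp_one_gt_d9]
  have h2 : (3 / 2 : ℝ) ≤ exp (1 / 2) := by linarith [Real.add_one_le_exp (1 / 2 : ℝ)]
  have h3 : exp (9 / 2) = exp 1 ^ 4 * exp (1 / 2) := by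
    rw [← Real.exp_nat_mul, ← Real.exp_add]; norm_num
  rw [h3]
  calc (80 : ℝ) ≤ 2.71 ^ 4 * (3 / 2) := by norm_num
    _ ≤ exp 1 ^ 4 * exp (1 / 2) := by gcongr

/-- There are at most `2 ^ (d (j + 1))` links between consecutive nets, and the Gaussian tail at the
level `3 √(d (j + 1))` beats this number. -/
lemma two_rpow_mul_exp_le {d : ℝ} (hd : 1 ≤ d) (j : ℕ) :
    ((2 : ℝ) ^ d) ^ (j + 1) * (2 * exp (-(3 * √(d * (j + 1))) ^ 2 / 2)) ≤
      2 * (1 / 40) ^ (j + 1) := by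
  have h1 : -(3 * √(d * (j + 1))) ^ 2 / 2 = ((j + 1 : ℕ) : ℝ) * (-(9 / 2) * d) := by
    rw [mul_pow, Real.sq_sqrt (by positivity)]
    push_cast
    ring
  have h2 : (2 : ℝ) ^ d * exp (-(9 / 2) * d) ≤ 1 / 40 := by
    rw [Real.exp_mul, ← Real.mul_rpow (by norm_num) (exp_pos _).le]
    have h3 : 2 * exp (-(9 / 2)) ≤ 1 / 40 := by
      rw [Real.exp_neg]
      have := eighty_le_exp
      rw [← div_eq_mul_inv, div_le_div_iff₀ (exp_pos _) (by norm_num)]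
      linarith
    calc (2 * exp (-(9 / 2))) ^ d ≤ (2 * exp (-(9 / 2))) ^ (1 : ℝ) :=
          Real.rpow_le_rpow_of_exponent_ge (by positivity) (by linarith) hd
      _ ≤ 1 / 40 := by rwa [Real.rpow_one]
  rw [h1, Real.exp_nat_mul]
  calc ((2 : ℝ) ^ d) ^ (j + 1) * (2 * exp (-(9 / 2) * d) ^ (j + 1))
      = 2 * ((2 : ℝ) ^ d * exp (-(9 / 2) * d)) ^ (j + 1) := by rw [mul_pow]; ring
    _ ≤ 2 * (1 / 40) ^ (j + 1) := by gcongr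

/-- With large probability, the random projection of a ball of radius `r` of a doubling set has
length of order `r √(d / D)`: the dimension of the space only enters through the scaling. -/
lemma dirLaw_projection_ball (hS : Doubling S d) (hd : 1 ≤ d) (z : E D) {r : ℝ} (hr : 0 < r) :
    dirLaw D {v | ∃ x ∈ S, dist x z ≤ r ∧ 18 * √d * r / √D < |inner ℝ (x - z) v|} ≤
      ENNReal.ofReal (3 / 50) := by
  classical
  have hS' : ∀ (c : E D) (s : ℝ), ∃ T : Finset (E D), 0 < s → (T.card : ℝ) ≤ (2 : ℝ) ^ d ∧
      Metric.closedBall c s ∩ S ⊆ ⋃ t ∈ T, Metric.closedBall t (s / 2) := by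
    intro c s
    by_cases hs : 0 < s
    · obtain ⟨T, hT⟩ := hS c s hs
      exact ⟨T, fun _ => hT⟩
    · exact ⟨∅, fun h => absurd h hs⟩
  choose T hT using hS'
  have hTc : ∀ c s, 0 < s → ((T c s).card : ℝ) ≤ (2 : ℝ) ^ d := fun c s hs => (hT c s hs).1
  -- Some link between a point of the `j`-th net and a point of its refinement projects to more
  -- than `lev j` times its standard deviation.
  set lev : ℕ → ℝ := fun j => 3 * √(d * (j + 1)) with hlev
  set bad : ℕ → Set (E D) := fun j => ⋃ t ∈ net T z r j, ⋃ t' ∈ T t (r / 2 ^ j),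
    {v | lev j * projStd (t' - t) < |inner ℝ (t' - t) v|} with hbad
  have hmeas : ∀ j, dirLaw D (bad j) ≤ ENNReal.ofReal (2 * (1 / 40) ^ (j + 1)) := by
    intro j
    have hpt : ∀ x : E D, dirLaw D {v | lev j * projStd x < |inner ℝ x v|} ≤
        ENNReal.ofReal (2 * exp (-(lev j) ^ 2 / 2)) :=
      fun x => dirLaw_abs_inner_gt x (by positivity)
    set p := ENNReal.ofReal (2 * exp (-(lev j) ^ 2 / 2)) with hp
    calc dirLaw D (bad j) ≤ ∑ t ∈ net T z r j, ∑ t' ∈ T t (r / 2 ^ j), p := by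
          refine (measure_biUnion_finset_le _ _).trans (Finset.sum_le_sum fun t _ => ?_)
          exact (measure_biUnion_finset_le _ _).trans (Finset.sum_le_sum fun t' _ => hpt _)
      _ ≤ ∑ t ∈ net T z r j, ENNReal.ofReal ((2 : ℝ) ^ d) * p := by
          refine Finset.sum_le_sum fun t _ => ?_
          rw [Finset.sum_const, nsmul_eq_mul]
          gcongr
          rw [← ENNReal.ofReal_natCast]
          exact ENNReal.ofReal_le_ofReal (hTc _ _ (by positivity))
      _ ≤ ENNReal.ofReal (((2 : ℝ) ^ d) ^ j) * (ENNReal.ofReal ((2 : ℝ) ^ d) * p) := by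
          rw [Finset.sum_const, nsmul_eq_mul]
          gcongr
          rw [← ENNReal.ofReal_natCast]
          exact ENNReal.ofReal_le_ofReal (card_net_le hr hTc j)
      _ = ENNReal.ofReal (((2 : ℝ) ^ d) ^ (j + 1) * (2 * exp (-(lev j) ^ 2 / 2))) := by
          rw [hp, ← ENNReal.ofReal_mul (by positivity), ← ENNReal.ofReal_mul (by positivity)]
          congr 1
          ring
      _ ≤ _ := ENNReal.ofReal_le_ofReal (two_rpow_mul_exp_le hd j)
  have hsub : {v | ∃ x ∈ S, dist x z ≤ r ∧ 18 * √d * r / √D < |inner ℝ (x - z) v|} ⊆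
      ⋃ j, bad j := by
    rintro v ⟨x, hxS, hxz, hx⟩
    by_contra hv
    have hgood : ∀ j, ∀ t ∈ net T z r j, ∀ t' ∈ T t (r / 2 ^ j),
        |inner ℝ (t' - t) v| ≤ lev j * projStd (t' - t) := by
      intro j t ht t' ht'
      by_contra! hlt
      refine hv (Set.mem_iUnion.2 ⟨j, ?_⟩)
      simp only [hbad, Set.mem_iUnion]
      exact ⟨t, ht, t', ht', hlt⟩
    -- Outside of the bad events, the projections of the links add up to a convergent series along
    -- a chain of points of the nets that tends to `x`.
    have hchain : ∀ m : ℕ, ∃ t ∈ net T z r m, dist x t ≤ r / 2 ^ m ∧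
        |inner ℝ (t - z) v| ≤
          ∑ j ∈ Finset.range m, 9 / 2 * √d * r / √D * (((j : ℝ) + 1) / 2 ^ j) := by
      intro m
      induction m with
      | zero => exact ⟨z, by simp [net], by simpa using hxz, by simp⟩
      | succ m ih =>
        obtain ⟨t, ht, hxt, hsum⟩ := ih
        have h1 := (hT t (r / 2 ^ m) (by positivity)).2 ⟨hxt, hxS⟩
        simp only [Set.mem_iUnion, Metric.mem_closedBall, exists_prop] at h1
        obtain ⟨t', ht', hxt'⟩ := h1
        refine ⟨t', ?_, ?_, ?_⟩
        · simp only [net, Finset.mem_biUnion]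
          exact ⟨t, ht, ht'⟩
        · rw [pow_succ, ← div_div]; exact hxt'
        · rw [Finset.sum_range_succ]
          have h2 : (inner ℝ (t' - z) v : ℝ) = inner ℝ (t' - t) v + inner ℝ (t - z) v := by
            rw [← inner_add_left]; congr 1; abel
          have h3 : ‖t' - t‖ ≤ 3 / 2 * (r / 2 ^ m) := by
            rw [← dist_eq_norm]
            have := dist_triangle t' x t
            rw [dist_comm t' x] at this
            linarith
          have h4 : √(d * (m + 1)) ≤ √d * (m + 1) := by
            rw [Real.sqrt_mul (by positivity)]
            gcongr
            rw [Real.sqrt_le_left (by positivity)]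
            nlinarith [Nat.cast_nonneg (α := ℝ) m]
          have h5 : lev m * projStd (t' - t) ≤
              9 / 2 * √d * r / √D * (((m : ℝ) + 1) / 2 ^ m) := by
            calc lev m * projStd (t' - t)
                ≤ (3 * (√d * (m + 1))) * ((3 / 2 * (r / 2 ^ m)) / √D) := by
                  simp only [hlev, projStd]; gcongr
              _ = _ := by ring
          rw [h2]
          have := hgood m t ht t' ht'
          have := abs_add_le (inner ℝ (t' - t) v : ℝ) (inner ℝ (t - z) v)
          linarith
    -- For a fixed direction the remainder of the chain tends to zero.
    have hbound : ∀ m : ℕ, |inner ℝ (x - z) v| ≤ 18 * √d * r / √D + r * ‖v‖ * (1 / 2) ^ m := by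
      intro m
      obtain ⟨t, -, hxt, hsum⟩ := hchain m
      rw [← Finset.mul_sum] at hsum
      have h2 : (inner ℝ (x - z) v : ℝ) = inner ℝ (x - t) v + inner ℝ (t - z) v := by
        rw [← inner_add_left]; congr 1; abel
      have h3 : |(inner ℝ (x - t) v : ℝ)| ≤ r / 2 ^ m * ‖v‖ := by
        refine (abs_real_inner_le_norm _ _).trans ?_
        rw [← dist_eq_norm]
        gcongr
      have h4 : 9 / 2 * √d * r / √D * ∑ j ∈ Finset.range m, (((j : ℝ) + 1) / 2 ^ j) ≤
          9 / 2 * √d * r / √D * 4 := by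
        gcongr
        exact sum_succ_div_two_pow_le m
      have h5 := abs_add_le (inner ℝ (x - t) v : ℝ) (inner ℝ (t - z) v)
      rw [h2]
      have h6 : r / 2 ^ m * ‖v‖ = r * ‖v‖ * (1 / 2) ^ m := by
        rw [one_div, inv_pow]; ring
      have h7 : 9 / 2 * √d * r / √D * 4 = 18 * √d * r / √D := by ring
      linarith
    have hlim : Filter.Tendsto (fun m : ℕ => 18 * √d * r / √D + r * ‖v‖ * (1 / 2) ^ m)
        Filter.atTop (nhds (18 * √d * r / √D + r * ‖v‖ * 0)) :=
      ((tendsto_pow_atTop_nhds_zero_of_lt_one (by norm_num) (by norm_num)).const_mul _).const_add _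
    have := ge_of_tendsto' hlim hbound
    rw [mul_zero, add_zero] at this
    exact absurd hx (not_lt.2 this)
  calc dirLaw D _ ≤ dirLaw D (⋃ j, bad j) := measure_mono hsub
    _ ≤ ∑' j, dirLaw D (bad j) := measure_iUnion_le _
    _ ≤ ∑' j, ENNReal.ofReal (2 * (1 / 40) ^ (j + 1)) := ENNReal.tsum_le_tsum hmeas
    _ = ENNReal.ofReal (∑' j : ℕ, 2 * (1 / 40 : ℝ) ^ (j + 1)) := by
        rw [ENNReal.ofReal_tsum_of_nonneg (fun j => by positivity)]
        simp only [pow_succ]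
        exact ((summable_geometric_of_lt_one (by norm_num) (by norm_num)).mul_right _).mul_left _
    _ ≤ ENNReal.ofReal (3 / 50) := by
        refine ENNReal.ofReal_le_ofReal ?_
        simp only [pow_succ]
        rw [tsum_mul_left, tsum_mul_right, tsum_geometric_of_lt_one (by norm_num) (by norm_num)]
        norm_num

end Chaining

/-! ### Separation of two small balls by a random split -/

section Separation

open Real

variable {D n : ℕ} {X : Fin n → E D} {J : Finset (Fin n)} {S : Set (E D)} {d : ℝ}

/-- The draws `(v, u)` for which the noisy split of the cell with sample points `J` separates the
sample points within distance `r` of `X a` from those within distance `r` of `X b`. -/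
def separating (X : Fin n → E D) (J : Finset (Fin n)) (r : ℝ) (a b : Fin n) : Set (E D × ℝ) :=
  {w | ((∀ i ∈ J, dist (X i) (X a) ≤ r →
        inner ℝ (X i) w.1 ≤ idxMedian X J w.1 + w.2 * (6 / √D * idxDiam X J)) ∧
      ∀ i ∈ J, dist (X i) (X b) ≤ r →
        ¬ inner ℝ (X i) w.1 ≤ idxMedian X J w.1 + w.2 * (6 / √D * idxDiam X J)) ∨
    ((∀ i ∈ J, dist (X i) (X b) ≤ r →
        inner ℝ (X i) w.1 ≤ idxMedian X J w.1 + w.2 * (6 / √D * idxDiam X J)) ∧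
      ∀ i ∈ J, dist (X i) (X a) ≤ r →
        ¬ inner ℝ (X i) w.1 ≤ idxMedian X J w.1 + w.2 * (6 / √D * idxDiam X J))}

lemma measurableSet_separating (r : ℝ) (a b : Fin n) :
    MeasurableSet (separating X J r a b) := by
  have h : ∀ i, MeasurableSet {w : E D × ℝ | (inner ℝ (X i) w.1 : ℝ) ≤
      idxMedian X J w.1 + w.2 * (6 / √D * idxDiam X J)} := by
    intro i
    refine measurableSet_le (measurable_const.inner measurable_fst) ?_
    exact (measurable_idxMedian (X := fun _ : E D × ℝ => X) measurable_const measurable_fst J).add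
      (measurable_snd.mul_const _)
  have hall : ∀ (c : Fin n) (P : Fin n → Set (E D × ℝ)), (∀ i, MeasurableSet (P i)) →
      MeasurableSet {w | ∀ i ∈ J, dist (X i) (X c) ≤ r → w ∈ P i} := by
    intro c P hP
    have : {w | ∀ i ∈ J, dist (X i) (X c) ≤ r → w ∈ P i} =
        ⋂ i ∈ J, ⋂ (_ : dist (X i) (X c) ≤ r), P i := by
      ext w; simp
    rw [this]
    exact Finset.measurableSet_biInter _ fun i _ => MeasurableSet.iInter fun _ => hP i
  exact ((hall a _ h).inter (hall b _ fun i => (h i).compl)).union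
    ((hall b _ h).inter (hall a _ fun i => (h i).compl))

/-- If more than half of the points of `J` project within `s` of `⟨z, v⟩`, so does the median. -/
lemma abs_idxMedian_sub_le (z v : E D) (s : ℝ)
    (h : 2 * (J.filter fun i => s < |inner ℝ (X i - z) v|).card < J.card) :
    |idxMedian X J v - inner ℝ z v| ≤ s := by
  have hmem : idxMedian X J v ∈ Set.Icc (inner ℝ z v - s) (inner ℝ z v + s) := by
    refine median_mem_Icc _ _ _ ?_
    rw [Multiset.card_map, Multiset.countP_map, ← Finset.filter_val]
    change J.card < 2 * (J.filter _).card
    have h1 := Finset.card_filter_add_card_filter_not (s := J)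
      (fun i => s < |inner ℝ (X i - z) v|)
    have h2 : (J.filter fun i => ¬ s < |inner ℝ (X i - z) v|) =
        J.filter fun i => inner ℝ z v - s ≤ inner ℝ (X i) v ∧
          inner ℝ (X i) v ≤ inner ℝ z v + s := by
      refine Finset.filter_congr fun i _ => ?_
      rw [not_lt, inner_sub_left, abs_le]
      constructor <;> rintro ⟨h1, h2⟩ <;> constructor <;> linarith
    rw [h2] at h1
    omega
  rw [abs_le]
  constructor <;> linarith [hmem.1, hmem.2]

/-- The median of the projections is close to the projection of any given point of `J`. Otherwise at
least half of the points of `J` project far from it; the expected proportion of such points is at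
most `1 / 25`, so that Markov applies. -/
lemma dirLaw_median_far {a : Fin n} (ha : a ∈ J) :
    dirLaw D {v | 5 * (idxDiam X J / √D) < |idxMedian X J v - inner ℝ (X a) v|} ≤
      ENNReal.ofReal (2 / 25) := by
  set s := 5 * (idxDiam X J / √D) with hs
  have hJ : 0 < J.card := Finset.card_pos.2 ⟨a, ha⟩
  -- the number of points that project far from `X a`
  set N : E D → ℝ≥0∞ := fun v => ∑ i ∈ J, {v : E D | s < |inner ℝ (X i - X a) v|}.indicator 1 v
    with hN
  have hms : ∀ i, MeasurableSet {v : E D | s < |inner ℝ (X i - X a) v|} := fun i =>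
    measurableSet_lt measurable_const (by fun_prop)
  have hNm : Measurable N := Finset.measurable_sum _ fun i _ => measurable_one.indicator (hms i)
  have hexp : 2 * exp (-(5 : ℝ) ^ 2 / 2) ≤ 1 / 25 := by
    have h1 : (29 / 4 : ℝ) ≤ exp (25 / 4) := by linarith [Real.add_one_le_exp (25 / 4 : ℝ)]
    have h2 : (50 : ℝ) ≤ exp (25 / 2) := by
      have : exp (25 / 2) = exp (25 / 4) ^ 2 := by rw [← Real.exp_nat_mul]; norm_num
      rw [this]
      nlinarith
    have h3 : -(5 : ℝ) ^ 2 / 2 = -(25 / 2) := by norm_num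
    rw [h3, Real.exp_neg, ← div_eq_mul_inv, div_le_div_iff₀ (exp_pos _) (by norm_num)]
    linarith
  have hint : ∫⁻ v, N v ∂dirLaw D ≤ J.card * ENNReal.ofReal (1 / 25) := by
    rw [hN, lintegral_finsetSum _ fun i _ => measurable_one.indicator (hms i), ← nsmul_eq_mul,
      ← Finset.sum_const]
    refine Finset.sum_le_sum fun i hi => ?_
    rw [lintegral_indicator_one (hms i)]
    refine (measure_mono ?_).trans ((dirLaw_abs_inner_gt (X i - X a) (s := 5)
      (by norm_num)).trans (ENNReal.ofReal_le_ofReal hexp))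
    intro v hv
    refine lt_of_le_of_lt ?_ (show s < |inner ℝ (X i - X a) v| from hv)
    have := dist_le_idxDiam (X := X) hi ha
    rw [dist_eq_norm] at this
    rw [hs, projStd]
    gcongr
  have hsub : {v | s < |idxMedian X J v - inner ℝ (X a) v|} ⊆ {v | (J.card : ℝ≥0∞) / 2 ≤ N v} := by
    intro v hv
    by_contra hlt
    have hlt' : N v < J.card / 2 := not_le.1 hlt
    have hNv : N v = ((J.filter fun i => s < |inner ℝ (X i - X a) v|).card : ℝ≥0∞) := by
      simp only [hN, Set.indicator_apply, Finset.card_filter]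
      push_cast
      rfl
    rw [hNv, ENNReal.lt_div_iff_mul_lt (by simp) (by simp)] at hlt'
    have : 2 * (J.filter fun i => s < |inner ℝ (X i - X a) v|).card < J.card := by
      rw [mul_comm]; exact_mod_cast hlt'
    exact absurd (abs_idxMedian_sub_le (X a) v s this) (not_le.2 hv)
  have hmarkov := mul_meas_ge_le_lintegral (μ := dirLaw D) hNm ((J.card : ℝ≥0∞) / 2)
  have h1 : (J.card : ℝ≥0∞) / 2 * dirLaw D {v | (J.card : ℝ≥0∞) / 2 ≤ N v} ≤
      (J.card : ℝ≥0∞) / 2 * ENNReal.ofReal (2 / 25) := by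
    refine (hmarkov.trans hint).trans (le_of_eq ?_)
    rw [show (2 / 25 : ℝ) = 2 * (1 / 25) by norm_num, ENNReal.ofReal_mul (by norm_num),
      ← mul_assoc, ENNReal.ofReal_ofNat, ENNReal.div_mul_cancel (by simp) (by simp)]
  refine (measure_mono hsub).trans ?_
  refine (ENNReal.mul_le_mul_iff_right ?_ ?_).1 h1
  · simp [hJ.ne']
  · exact ENNReal.div_ne_top (by simp) (by simp)

/-- The law of the noise variable `u`. -/
def noiseLaw : Measure ℝ := ProbabilityTheory.cond volume (Set.Icc (-1 : ℝ) 1)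

lemma noiseLaw_Ico {α β : ℝ} (h1 : -1 ≤ α) (h2 : β ≤ 1) :
    noiseLaw (Set.Ico α β) = ENNReal.ofReal ((β - α) / 2) := by
  have hsub : Set.Ico α β ⊆ Set.Icc (-1 : ℝ) 1 :=
    fun x hx => ⟨h1.trans hx.1, hx.2.le.trans h2⟩
  rw [noiseLaw, cond_apply measurableSet_Icc, Set.inter_eq_right.2 hsub, Real.volume_Icc,
    Real.volume_Ico, ENNReal.ofReal_div_of_pos (by norm_num), ENNReal.div_eq_inv_mul]
  norm_num

instance : IsProbabilityMeasure noiseLaw :=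
  cond_isProbabilityMeasure_of_finite (by simp) (by simp)

lemma drawLaw_eq : drawLaw D = (dirLaw D).prod noiseLaw := rfl

/-- For a direction in which the two balls project to short intervals, at some distance from each
other and not too far from the median, the noise separates them with probability at least
`1 / 192`. -/
lemma noiseLaw_separating {r : ℝ} {a b : Fin n} {v : E D} {g : ℝ}
    (hg : g = idxDiam X J / √D) (hgpos : 0 < g)
    (hmed : |idxMedian X J v - inner ℝ (X a) v| ≤ 5 * g)
    (hab : g / 8 ≤ |inner ℝ (X a - X b) v|)
    (ha : ∀ i, dist (X i) (X a) ≤ r → |inner ℝ (X i - X a) v| ≤ g / 32)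
    (hb : ∀ i, dist (X i) (X b) ≤ r → |inner ℝ (X i - X b) v| ≤ g / 32) :
    ENNReal.ofReal (1 / 192) ≤ noiseLaw (Prod.mk v ⁻¹' separating X J r a b) := by
  set m := idxMedian X J v with hm
  set p : ℝ := inner ℝ (X a) v with hp
  set q : ℝ := inner ℝ (X b) v with hq
  have hthr : ∀ u : ℝ, u * (6 / √D * idxDiam X J) = u * (6 * g) := by
    intro u; rw [hg]; ring
  rw [abs_le] at hmed
  simp only [inner_sub_left] at hab ha hb
  -- The two projected intervals have half-length `g / 32` and centers `p` and `q` at distance at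
  -- least `g / 8`. In units of the amplitude `6 g` of the noise, the thresholds between
  -- `p + g / 32` and `p + 3 g / 32` (or their reflections at `p`) have probability
  -- `(g / 16) / (6 g) / 2 = 1 / 192`, and the median is close enough to `p` for them to lie in the
  -- range of the noise.
  have key : ∀ α β : ℝ, α = (p + g / 32 - m) / (6 * g) ∧ β = (p + 3 * g / 32 - m) / (6 * g) ∨
      α = (p - 3 * g / 32 - m) / (6 * g) ∧ β = (p - g / 32 - m) / (6 * g) →
      Set.Ico α β ⊆ Prod.mk v ⁻¹' separating X J r a b →
      ENNReal.ofReal (1 / 192) ≤ noiseLaw (Prod.mk v ⁻¹' separating X J r a b) := by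
    intro α β hαβ hsub
    have h1 : (β - α) / 2 = 1 / 192 := by
      rcases hαβ with ⟨h1, h2⟩ | ⟨h1, h2⟩ <;> rw [h1, h2] <;> field_simp <;> ring
    have h2 : -1 ≤ α := by
      rcases hαβ with ⟨h1, -⟩ | ⟨h1, -⟩ <;> rw [h1, le_div_iff₀ (by positivity)] <;> linarith
    have h3 : β ≤ 1 := by
      rcases hαβ with ⟨-, h1⟩ | ⟨-, h1⟩ <;> rw [h1, div_le_iff₀ (by positivity)] <;> linarith
    rw [← h1, ← noiseLaw_Ico h2 h3]
    exact measure_mono hsub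
  rcases le_total p q with hpq | hpq
  · have hab' : g / 8 ≤ q - p := by
      rwa [abs_of_nonpos (by linarith), neg_sub] at hab
    refine key _ _ (Or.inl ⟨rfl, rfl⟩) ?_
    rintro u ⟨hu1, hu2⟩
    rw [div_le_iff₀ (by positivity)] at hu1
    rw [lt_div_iff₀ (by positivity)] at hu2
    refine Or.inl ⟨fun i _ hi => ?_, fun i _ hi => ?_⟩
    · have := (abs_le.1 (ha i hi)).2
      simp only [hthr]
      linarith
    · have := (abs_le.1 (hb i hi)).1
      simp only [hthr, not_le]
      linarith
  · have hab' : g / 8 ≤ p - q := by rwa [abs_of_nonneg (by linarith)] at hab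
    refine key _ _ (Or.inr ⟨rfl, rfl⟩) ?_
    rintro u ⟨hu1, hu2⟩
    rw [div_le_iff₀ (by positivity)] at hu1
    rw [lt_div_iff₀ (by positivity)] at hu2
    refine Or.inr ⟨fun i _ hi => ?_, fun i _ hi => ?_⟩
    · have := (abs_le.1 (hb i hi)).2
      simp only [hthr]
      linarith
    · have := (abs_le.1 (ha i hi)).1
      simp only [hthr, not_le]
      linarith

/-- Two balls of radius `Δ / (576 √d)` around sample points at distance at least `Δ / 4` are
separated by a noisy split with probability bounded below by an absolute constant. -/
lemma drawLaw_separating (hS : Doubling S d) (hd : 1 ≤ d) (hX : ∀ i, X i ∈ S) {a b : Fin n}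
    (ha : a ∈ J) (hpos : 0 < idxDiam X J)
    (hab : idxDiam X J / 4 ≤ dist (X a) (X b)) {r : ℝ} (hr : r = idxDiam X J / (576 * √d)) :
    ENNReal.ofReal (1 / 500) ≤ drawLaw D (separating X J r a b) := by
  have hdpos : 0 < √d := Real.sqrt_pos.2 (by linarith)
  have hrpos : 0 < r := by rw [hr]; positivity
  -- In dimension zero all points coincide; otherwise the divisions by `√D` are genuine.
  have hD : 0 < D := by
    rcases Nat.eq_zero_or_pos D with h | h
    · subst h
      have : dist (X a) (X b) = 0 := by
        rw [Subsingleton.elim (X a) (X b), dist_self]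
      linarith
    · exact h
  have hDpos : 0 < √(D : ℝ) := Real.sqrt_pos.2 (by exact_mod_cast hD)
  set g := idxDiam X J / √D with hg
  have hgpos : 0 < g := by rw [hg]; positivity
  have hwidth : 18 * √d * r / √D = g / 32 := by rw [hr, hg]; field_simp; norm_num
  set f : E D → ℝ≥0∞ := fun v => noiseLaw (Prod.mk v ⁻¹' separating X J r a b) with hf
  have hfm : Measurable f := measurable_measure_prodMk_left (measurableSet_separating r a b)
  set G : Set (E D) := {v | ENNReal.ofReal (1 / 192) ≤ f v} with hG
  have hGm : MeasurableSet G := measurableSet_le measurable_const hfm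
  have hsub : Gᶜ ⊆ ({v | 5 * g < |idxMedian X J v - inner ℝ (X a) v|} ∪
      {v | |inner ℝ (X a - X b) v| < 1 / 2 * projStd (X a - X b)}) ∪
      ({v | ∃ x ∈ S, dist x (X a) ≤ r ∧ 18 * √d * r / √D < |inner ℝ (x - X a) v|} ∪
      {v | ∃ x ∈ S, dist x (X b) ≤ r ∧ 18 * √d * r / √D < |inner ℝ (x - X b) v|}) := by
    intro v hv
    by_contra hc
    simp only [Set.mem_union, Set.mem_ofPred_eq, not_or, not_exists, not_and, not_lt] at hc
    obtain ⟨⟨h1, h2⟩, h3, h4⟩ := hc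
    refine hv (noiseLaw_separating hg hgpos h1 (le_trans ?_ h2) (fun i hi => ?_) fun i hi => ?_)
    · have : g / 8 = 1 / 2 * (idxDiam X J / 4 / √D) := by rw [hg]; field_simp; norm_num
      rw [this, projStd]
      rw [dist_eq_norm] at hab
      gcongr
    · rw [← hwidth]; exact h3 _ (hX i) hi
    · rw [← hwidth]; exact h4 _ (hX i) hi
  have hstd : 0 < projStd (X a - X b) := by
    rw [projStd, ← dist_eq_norm]
    have : 0 < dist (X a) (X b) := by linarith
    positivity
  -- The median is far with probability at most `2 / 25`, the projection of `X a - X b` is small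
  -- with probability at most `2 / 5`, and each ball has a long projection with probability at most
  -- `3 / 50`.
  have hGc : dirLaw D Gᶜ ≤ ENNReal.ofReal (3 / 5) := by
    refine (measure_mono hsub).trans ?_
    refine (measure_union_le _ _).trans ?_
    have h1 := add_le_add (measure_union_le (μ := dirLaw D) _ _ |>.trans
      (add_le_add (dirLaw_median_far (X := X) ha)
        (dirLaw_abs_inner_lt (X a - X b) hstd (t := 1 / 2))))
      (measure_union_le (μ := dirLaw D) _ _ |>.trans
      (add_le_add (dirLaw_projection_ball hS hd (X a) hrpos)
        (dirLaw_projection_ball hS hd (X b) hrpos)))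
    refine h1.trans ?_
    rw [← ENNReal.ofReal_add (by norm_num) (by norm_num),
      ← ENNReal.ofReal_add (by norm_num) (by norm_num),
      ← ENNReal.ofReal_add (by norm_num) (by norm_num)]
    exact ENNReal.ofReal_le_ofReal (by norm_num)
  have hGge : ENNReal.ofReal (2 / 5) ≤ dirLaw D G := by
    have h1 := measure_add_measure_compl (μ := dirLaw D) hGm
    rw [measure_univ] at h1
    have h2 : (1 : ℝ≥0∞) ≤ dirLaw D G + ENNReal.ofReal (3 / 5) := by
      rw [← h1]; gcongr
    have h3 : (1 : ℝ≥0∞) = ENNReal.ofReal (2 / 5) + ENNReal.ofReal (3 / 5) := by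
      rw [← ENNReal.ofReal_add (by norm_num) (by norm_num)]; norm_num
    rw [h3] at h2
    exact (ENNReal.add_le_add_iff_right ENNReal.ofReal_ne_top).1 h2
  rw [drawLaw_eq, Measure.prod_apply (measurableSet_separating r a b)]
  calc ENNReal.ofReal (1 / 500) ≤ ENNReal.ofReal (1 / 192) * ENNReal.ofReal (2 / 5) := by
        rw [← ENNReal.ofReal_mul (by norm_num)]
        exact ENNReal.ofReal_le_ofReal (by norm_num)
    _ ≤ ENNReal.ofReal (1 / 192) * dirLaw D G := by gcongr
    _ ≤ ∫⁻ v, f v ∂dirLaw D := mul_meas_ge_le_lintegral hfm _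

end Separation

/-! ### Depth of the trees returned by the core procedure -/

section Depth

open Real

variable {D n : ℕ} {X : Fin n → E D} {J : Finset (Fin n)} {S : Set (E D)} {d : ℝ}

lemma idxAvgDiam_le {L : List (IndexNode n)} {s : ℝ} (hs : 0 ≤ s)
    (h : ∀ a ∈ L, idxDiam X a.2 ≤ s) : idxAvgDiam X L ≤ s := by
  have h1 : (L.map fun a => (a.2.card : ℝ) / n * idxDiam X a.2 ^ 2).sum ≤
      s ^ 2 * (L.map fun a => (a.2.card : ℝ) / n).sum := by
    rw [← List.sum_map_mul_left]
    refine List.sum_le_sum fun a ha => ?_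
    rw [mul_comm (s ^ 2)]
    have := h a ha
    have := idxDiam_nonneg (X := X) a.2
    gcongr
  have h0 : 0 ≤ (L.map fun a => (a.2.card : ℝ) / n).sum :=
    List.sum_nonneg (by simp only [List.mem_map]; rintro _ ⟨a, -, rfl⟩; positivity)
  rw [idxAvgDiam, Real.sqrt_le_left hs]
  exact div_le_of_le_mul₀ h0 (sq_nonneg s) h1

/-- The noisy splits use the same hyperplane for all cells, so that each leaf lies on one side
of each of them. -/
lemma idxLeaves_one_side {a₀ : IndexNode n} {w : ℕ → E D × ℝ} {k : ℕ} {a : IndexNode n}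
    (ha : a ∈ idxLeaves X a₀ w k) : a.2 ⊆ a₀.2 ∧ ∀ i, 1 ≤ i → i ≤ k →
      Odd (a₀.1.length + i) →
      (∀ j ∈ a.2, inner ℝ (X j) (w i).1 ≤
        idxMedian X a₀.2 (w i).1 + (w i).2 * (6 / √D * idxDiam X a₀.2)) ∨
      ∀ j ∈ a.2, ¬ inner ℝ (X j) (w i).1 ≤
        idxMedian X a₀.2 (w i).1 + (w i).2 * (6 / √D * idxDiam X a₀.2) := by
  induction k generalizing a with
  | zero =>
    simp only [idxLeaves, List.mem_singleton] at ha
    subst ha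
    exact ⟨subset_rfl, fun i h1 h2 => by omega⟩
  | succ k ih =>
    simp only [idxLeaves, List.mem_flatMap] at ha
    obtain ⟨b, hb, hab⟩ := ha
    obtain ⟨hsub, hside⟩ := ih hb
    have hab2 : a.2 ⊆ b.2 := by
      simp only [idxChildren, List.mem_cons, List.not_mem_nil, or_false] at hab
      rcases hab with rfl | rfl <;> exact Finset.filter_subset _ _
    refine ⟨hab2.trans hsub, fun i h1 h2 hodd => ?_⟩
    -- The last split, made at iteration `k + 1`, has the same threshold in all leaves if the level
    -- is odd; the sides of the earlier splits are inherited.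
    rcases Nat.lt_or_ge k i with hik | hik
    · obtain rfl : i = k + 1 := by omega
      simp only [idxChildren, idxThreshold, hodd, if_true, List.mem_cons, List.not_mem_nil,
        or_false] at hab
      rcases hab with rfl | rfl
      · exact Or.inl fun j hj => (Finset.mem_filter.1 hj).2
      · exact Or.inr fun j hj => (Finset.mem_filter.1 hj).2
    · exact (hside i h1 hik hodd).imp (fun h j hj => h j (hab2 hj)) fun h j hj => h j (hab2 hj)

/-- If every pair of distant balls has been separated, the average data diameter has halved. -/
lemma idxDepth_le_of_separating {a₀ : IndexNode n} {w : ℕ → E D × ℝ} {k : ℕ} {r : ℝ}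
    {Z : Finset (Fin n)} (hZ : ∀ i ∈ a₀.2, ∃ a ∈ Z, dist (X i) (X a) ≤ r)
    (hr : r ≤ idxDiam X a₀.2 / 8)
    (hsep : ∀ a ∈ Z, ∀ b ∈ Z, idxDiam X a₀.2 / 4 ≤ dist (X a) (X b) →
      ∃ i, 1 ≤ i ∧ i ≤ k ∧ Odd (a₀.1.length + i) ∧ w i ∈ separating X a₀.2 r a b) :
    idxDepth X a₀ (idxDiam X a₀.2 / 2) w ≤ k := by
  have h0 := idxDiam_nonneg (X := X) a₀.2
  refine idxDepth_le_iff.2 ⟨k, le_rfl, idxAvgDiam_le (by linarith) fun a ha => ?_⟩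
  obtain ⟨hsub, hside⟩ := idxLeaves_one_side ha
  refine (idxDiam_le_iff (by linarith)).2 fun i hi j hj => ?_
  by_contra! hlt
  obtain ⟨b, hb, hib⟩ := hZ i (hsub hi)
  obtain ⟨c, hc, hjc⟩ := hZ j (hsub hj)
  have htri : dist (X i) (X j) ≤ dist (X i) (X b) + dist (X b) (X c) + dist (X c) (X j) :=
    dist_triangle4 _ _ _ _
  rw [dist_comm (X c)] at htri
  -- Two points of a leaf at distance more than half of the diameter are close to representatives at
  -- distance at least a quarter of it; a split separates these, but not the points of the leaf.
  obtain ⟨m, hm1, hmk, hodd, hw⟩ := hsep b hb c hc (by linarith)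
  rcases hside m hm1 hmk hodd with h | h <;> rcases hw with ⟨h1, h2⟩ | ⟨h1, h2⟩
  · exact h2 j (hsub hj) hjc (h j hj)
  · exact h2 i (hsub hi) hib (h i hi)
  · exact h i hi (h1 i (hsub hi) hib)
  · exact h j hj (h1 j (hsub hj) hjc)

/-- Representatives, among the sample points, of a cover by small balls. -/
lemma exists_representatives (hS : Doubling S d) (hX : ∀ i, X i ∈ S) (hpos : 0 < idxDiam X J)
    (m : ℕ) : ∃ Z ⊆ J, (Z.card : ℝ) ≤ ((2 : ℝ) ^ d) ^ m ∧
      ∀ i ∈ J, ∃ a ∈ Z, dist (X i) (X a) ≤ 2 * (idxDiam X J / 2 ^ m) := by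
  classical
  have hJ : J.Nonempty := by
    by_contra hne
    rw [Finset.not_nonempty_iff_eq_empty] at hne
    simp [hne, idxDiam] at hpos
  obtain ⟨o, ho⟩ := hJ
  have hS' : ∀ (c : E D) (s : ℝ), ∃ T : Finset (E D), 0 < s → (T.card : ℝ) ≤ (2 : ℝ) ^ d ∧
      Metric.closedBall c s ∩ S ⊆ ⋃ t ∈ T, Metric.closedBall t (s / 2) := by
    intro c s
    by_cases hs : 0 < s
    · obtain ⟨T, hT⟩ := hS c s hs
      exact ⟨T, fun _ => hT⟩
    · exact ⟨∅, fun h => absurd h hs⟩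
  choose T hT using hS'
  set N := net T (X o) (idxDiam X J) m with hN
  set rep : E D → Fin n := fun t =>
    if h : ∃ i ∈ J, dist (X i) t ≤ idxDiam X J / 2 ^ m then h.choose else o with hrep
  refine ⟨N.image rep, ?_, ?_, ?_⟩
  · intro i hi
    obtain ⟨t, -, rfl⟩ := Finset.mem_image.1 hi
    simp only [hrep]
    split_ifs with h
    · exact h.choose_spec.1
    · exact ho
  · calc ((N.image rep).card : ℝ) ≤ N.card := by exact_mod_cast Finset.card_image_le
      _ ≤ _ := card_net_le hpos (fun c s hs => (hT c s hs).1) m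
  · intro i hi
    obtain ⟨t, ht, hit⟩ := exists_mem_net hpos (fun c s hs => (hT c s hs).2) (hX i)
      (dist_le_idxDiam hi ho) m
    refine ⟨rep t, Finset.mem_image_of_mem _ ht, ?_⟩
    have h : ∃ i ∈ J, dist (X i) t ≤ idxDiam X J / 2 ^ m := ⟨i, hi, hit⟩
    have hr : dist (X (rep t)) t ≤ idxDiam X J / 2 ^ m := by
      simp only [hrep, h, dif_pos]
      exact h.choose_spec.2
    have := dist_triangle_right (X i) (X (rep t)) t
    linarith

lemma half_le_card_filter_odd (l k : ℕ) :
    k / 2 ≤ ((Finset.Icc 1 k).filter fun i => Odd (l + i)).card := by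
  rw [← Finset.card_range (k / 2)]
  refine Finset.card_le_card_of_injOn (fun j => if Odd (l + 1) then 2 * j + 1 else 2 * j + 2) ?_ ?_
  · intro j hj
    have hj' : j < k / 2 := by simpa using hj
    by_cases h : Odd (l + 1)
    · simp only [h, if_true, Finset.coe_filter, Set.mem_ofPred_eq, Finset.mem_Icc]
      refine ⟨by omega, ?_⟩
      rw [Nat.odd_iff] at h ⊢
      omega
    · simp only [h, if_false, Finset.coe_filter, Set.mem_ofPred_eq, Finset.mem_Icc]
      refine ⟨by omega, ?_⟩
      rw [Nat.odd_iff] at h ⊢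
      omega
  · intro i _ j _ hij
    by_cases h : Odd (l + 1) <;> simp only [h, if_true, if_false] at hij <;> omega

/-- The number of iterations after which all pairs of distant balls are separated is of order
`d log d`: there are `2 ^ O(d log d)` pairs. -/
lemma exists_scale {d : ℝ} (hd : 3 / 2 ≤ d) : ∃ m : ℕ, 1152 * √d ≤ 2 ^ m ∧
    (((2 : ℝ) ^ d) ^ m) ^ 2 * (499 / 500) ^ (⌊60000 * d * logb 2 d⌋₊ / 2) ≤ 1 / 2 := by
  set y := logb 2 d with hy
  have hdpos : 0 < d := by linarith
  have hy1 : 1 / 2 ≤ y := by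
    rw [hy, Real.le_logb_iff_rpow_le (by norm_num) hdpos, ← Real.sqrt_eq_rpow]
    exact (Real.sqrt_le_left (by norm_num)).2 (by norm_num) |>.trans hd
  have hdy : 3 / 4 ≤ d * y := by nlinarith
  set m := ⌈logb 2 (1152 * √d)⌉₊ with hm
  have hsq : 0 < √d := Real.sqrt_pos.2 hdpos
  have hlog : logb 2 (1152 * √d) ≤ 11 + y / 2 := by
    rw [Real.logb_mul (by norm_num) hsq.ne', Real.sqrt_eq_rpow, Real.logb_rpow_eq_mul_logb_of_pos
      hdpos]
    have : logb 2 1152 ≤ 11 := by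
      rw [Real.logb_le_iff_le_rpow (by norm_num) (by norm_num)]
      norm_num
    linarith
  have hlog0 : 0 ≤ logb 2 (1152 * √d) := by
    refine Real.logb_nonneg (by norm_num) ?_
    have : 1 ≤ √d := Real.one_le_sqrt.2 (by linarith)
    linarith
  have hm1 : (m : ℝ) ≤ 12 + y / 2 := by
    have := Nat.ceil_lt_add_one hlog0
    linarith
  refine ⟨m, ?_, ?_⟩
  · have := Nat.le_ceil (logb 2 (1152 * √d))
    rw [← hm, Real.logb_le_iff_le_rpow (by norm_num) (by positivity), Real.rpow_natCast] at this
    exact this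
  · set k := ⌊60000 * d * y⌋₊ with hk
    have hk1 : 60000 * d * y - 1 < k := Nat.sub_one_lt_floor _
    have hk2 : ((k : ℝ) - 1) / 2 ≤ ((k / 2 : ℕ) : ℝ) := by
      have : k ≤ 2 * (k / 2) + 1 := by omega
      have : (k : ℝ) ≤ 2 * ((k / 2 : ℕ) : ℝ) + 1 := by exact_mod_cast this
      linarith
    set N := k / 2 with hN
    have h1 : (499 / 500 : ℝ) ≤ (2 : ℝ) ^ (-(1 / 500) : ℝ) := by
      have h2 : (499 / 500 : ℝ) ≤ exp (-(1 / 500)) := by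
        linarith [Real.add_one_le_exp (-(1 / 500) : ℝ)]
      refine h2.trans ?_
      rw [Real.rpow_def_of_pos (by norm_num), Real.exp_le_exp]
      linarith [Real.log_two_lt_d9]
    calc (((2 : ℝ) ^ d) ^ m) ^ 2 * (499 / 500) ^ N
        ≤ (((2 : ℝ) ^ d) ^ m) ^ 2 * ((2 : ℝ) ^ (-(1 / 500) : ℝ)) ^ N := by gcongr
      _ = (2 : ℝ) ^ (d * m * 2 + -(1 / 500) * N) := by
          rw [← Real.rpow_natCast, ← Real.rpow_natCast, ← Real.rpow_natCast,
            ← Real.rpow_mul (by positivity), ← Real.rpow_mul (by positivity),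
            ← Real.rpow_mul (by positivity), ← Real.rpow_add (by norm_num)]
          push_cast
          ring_nf
      _ ≤ (2 : ℝ) ^ (-1 : ℝ) := by
          refine Real.rpow_le_rpow_of_exponent_le (by norm_num) ?_
          have : d * m ≤ d * (12 + y / 2) := by gcongr
          nlinarith
      _ = 1 / 2 := by rw [Real.rpow_neg_one]; norm_num

variable {δ : ℝ}

/-- A call of the core procedure on a cell with distinct sample points fails to return a tree of
depth `O(d log d)` with probability at most `2 ^ (-R)`, where `R` is the number of runs. -/
lemma drawsLaw_idxCoreDepth_gt (hS : Doubling S d) (hd : 3 / 2 ≤ d) (hX : ∀ i, X i ∈ S)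
    {a₀ : IndexNode n} (hpos : 0 < idxDiam X a₀.2) :
    drawsLaw D {ω | ((⌊60000 * d * logb 2 d⌋₊ : ℕ) : ℕ∞) < idxCoreDepth X δ ω a₀} ≤
      ENNReal.ofReal ((1 / 2) ^ numRuns n δ) := by
  classical
  set k := ⌊60000 * d * logb 2 d⌋₊ with hk
  obtain ⟨m, hm, hmk⟩ := exists_scale hd
  rw [← hk] at hmk
  obtain ⟨Z, hZJ, hZcard, hZ⟩ := exists_representatives hS hX hpos m
  set Δ := idxDiam X a₀.2 with hΔ
  have hsq : 1 ≤ √d := Real.one_le_sqrt.2 (by linarith)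
  set r := Δ / (576 * √d) with hr
  have hrad : 2 * (Δ / 2 ^ m) ≤ r := by
    have : 2 * (Δ / 2 ^ m) ≤ 2 * (Δ / (1152 * √d)) := by gcongr
    refine this.trans (le_of_eq ?_)
    rw [hr]; field_simp; norm_num
  have hr8 : r ≤ Δ / 8 := by
    rw [hr]
    gcongr
    linarith
  set P : Finset (Fin n × Fin n) :=
    (Z ×ˢ Z).filter fun q => Δ / 4 ≤ dist (X q.1) (X q.2) with hP
  set I := (Finset.Icc 1 k).filter fun i => Odd (a₀.1.length + i) with hI
  set R := numRuns n δ with hR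
  -- If the depth is larger than `k`, every run leaves some pair unseparated by all of its noisy
  -- splits. The function `φ` is the choice of one such pair for each run.
  set box : (Fin R → P) → Set (Draws D) := fun φ =>
    Set.pi (({a₀.1} ×ˢ (Finset.range R ×ˢ I) : Finset (List Bool × ℕ × ℕ)) : Set _)
      fun q => if h : q.2.1 < R then
        (separating X a₀.2 r (φ ⟨q.2.1, h⟩).1.1 (φ ⟨q.2.1, h⟩).1.2)ᶜ else Set.univ with hbox
  have hsub : {ω | (k : ℕ∞) < idxCoreDepth X δ ω a₀} ⊆ ⋃ φ, box φ := by
    intro ω hω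
    have hrun : ∀ j : Fin R, ∃ q : P, ∀ i ∈ I,
        ω (a₀.1, j, i) ∉ separating X a₀.2 r q.1.1 q.1.2 := by
      intro j
      have hj : (k : ℕ∞) < idxRunDepth X ω a₀ j :=
        lt_of_lt_of_le hω (iInf_le (fun j : Fin R => idxRunDepth X ω a₀ j) j)
      by_contra! hc
      refine absurd (idxDepth_le_of_separating (w := fun i => ω (a₀.1, j, i)) (k := k) (r := r)
        (Z := Z) (fun i hi => ?_) hr8 fun a ha b hb hab => ?_) (not_le.2 hj)
      · obtain ⟨a, ha, hia⟩ := hZ i hi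
        exact ⟨a, ha, hia.trans hrad⟩
      · obtain ⟨i, hi, hw⟩ := hc ⟨(a, b), Finset.mem_filter.2 ⟨Finset.mk_mem_product ha hb, hab⟩⟩
        simp only [hI, Finset.mem_filter, Finset.mem_Icc] at hi
        exact ⟨i, hi.1.1, hi.1.2, hi.2, hw⟩
    choose φ hφ using hrun
    refine Set.mem_iUnion.2 ⟨φ, ?_⟩
    rintro ⟨p, j, i⟩ hq
    simp only [Finset.coe_product, Finset.coe_singleton, Set.mem_prod, Set.mem_singleton_iff,
      Finset.mem_coe, Finset.mem_range] at hq
    obtain ⟨rfl, hj, hi⟩ := hq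
    simp only [hj, dif_pos]
    exact hφ ⟨j, hj⟩ i hi
  -- The draws are independent, and each of them fails to separate a given pair with probability at
  -- most `499 / 500`.
  have hboxle : ∀ φ, drawsLaw D (box φ) ≤ (ENNReal.ofReal (499 / 500) ^ I.card) ^ R := by
    intro φ
    rw [drawsLaw, hbox, Measure.infinitePi_pi]
    · calc _ ≤ ENNReal.ofReal (499 / 500) ^
            ({a₀.1} ×ˢ (Finset.range R ×ˢ I) : Finset (List Bool × ℕ × ℕ)).card := by
            refine Finset.prod_le_pow_card _ _ _ fun q hq => ?_
            simp only [Finset.mem_product, Finset.mem_range] at hq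
            simp only [hq.2.1, dif_pos]
            set e := φ ⟨q.2.1, hq.2.1⟩ with he
            have hPe := e.2
            simp only [hP, Finset.mem_filter, Finset.mem_product] at hPe
            have h1 := drawLaw_separating hS (by linarith) hX (hZJ hPe.1.1) hpos hPe.2 hr
            rw [prob_compl_eq_one_sub (measurableSet_separating _ _ _)]
            calc 1 - drawLaw D (separating X a₀.2 r e.1.1 e.1.2)
                ≤ 1 - ENNReal.ofReal (1 / 500) := by gcongr
              _ = ENNReal.ofReal (499 / 500) := by
                rw [← ENNReal.ofReal_one, ← ENNReal.ofReal_sub _ (by norm_num)]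
                norm_num
        _ = _ := by simp [← pow_mul, mul_comm]
    · intro q _
      split_ifs
      · exact (measurableSet_separating _ _ _).compl
      · exact MeasurableSet.univ
  have hPcard : (P.card : ℝ≥0∞) ≤ ENNReal.ofReal ((((2 : ℝ) ^ d) ^ m) ^ 2) := by
    rw [← ENNReal.ofReal_natCast]
    refine ENNReal.ofReal_le_ofReal ?_
    have h1 : P.card ≤ Z.card * Z.card := (Finset.card_filter_le _ _).trans
      (Finset.card_product _ _).le
    have h2 : (P.card : ℝ) ≤ Z.card * Z.card := by exact_mod_cast h1
    refine h2.trans ?_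
    rw [sq]
    gcongr
  calc drawsLaw D _ ≤ drawsLaw D (⋃ φ, box φ) := measure_mono hsub
    _ ≤ ∑ φ, drawsLaw D (box φ) := measure_iUnion_fintype_le _ _
    _ ≤ ∑ _φ : Fin R → P, (ENNReal.ofReal (499 / 500) ^ I.card) ^ R :=
        Finset.sum_le_sum fun φ _ => hboxle φ
    _ = ((P.card : ℝ≥0∞) * ENNReal.ofReal (499 / 500) ^ I.card) ^ R := by
        rw [Finset.sum_const, Finset.card_univ, nsmul_eq_mul]
        simp [mul_pow]
    _ ≤ (ENNReal.ofReal ((((2 : ℝ) ^ d) ^ m) ^ 2) * ENNReal.ofReal (499 / 500) ^ (k / 2)) ^ R := by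
        gcongr ?_ ^ R
        refine mul_le_mul' hPcard (pow_le_pow_right_of_le_one' ?_ (half_le_card_filter_odd _ _))
        rw [← ENNReal.ofReal_one]
        exact ENNReal.ofReal_le_ofReal (by norm_num)
    _ = ENNReal.ofReal (((((2 : ℝ) ^ d) ^ m) ^ 2 * (499 / 500) ^ (k / 2)) ^ R) := by
        rw [← ENNReal.ofReal_pow (by norm_num), ← ENNReal.ofReal_mul (by positivity),
          ENNReal.ofReal_pow (by positivity)]
    _ ≤ _ := ENNReal.ofReal_le_ofReal (by gcongr)

end Depth

/-! ### All calls of the core procedure -/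

section Calls

variable {D n : ℕ} {X : Fin n → E D} {δ : ℝ}

lemma idxLeaves_path {a₀ a : IndexNode n} {w : ℕ → E D × ℝ} {k : ℕ}
    (ha : a ∈ idxLeaves X a₀ w k) : ∃ s, a.1 = a₀.1 ++ s ∧ s.length = k := by
  induction k generalizing a with
  | zero =>
    simp only [idxLeaves, List.mem_singleton] at ha
    exact ⟨[], by simp [ha]⟩
  | succ k ih =>
    simp only [idxLeaves, List.mem_flatMap] at ha
    obtain ⟨b, hb, hab⟩ := ha
    obtain ⟨s, hs, hlen⟩ := ih hb
    simp only [idxChildren, List.mem_cons, List.not_mem_nil, or_false] at hab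
    rcases hab with rfl | rfl
    · exact ⟨s ++ [true], by simp [hs], by simp [hlen]⟩
    · exact ⟨s ++ [false], by simp [hs], by simp [hlen]⟩

lemma idxLeaves_pairwise_disjoint (a₀ : IndexNode n) (w : ℕ → E D × ℝ) (k : ℕ) :
    (idxLeaves X a₀ w k).Pairwise fun a b => Disjoint a.2 b.2 := by
  induction k with
  | zero => simp [idxLeaves]
  | succ k ih =>
    rw [idxLeaves, List.pairwise_flatMap]
    refine ⟨fun a _ => ?_, ih.imp fun {a b} hab x hx y hy => ?_⟩
    · simp only [idxChildren, List.pairwise_cons, List.mem_singleton, forall_eq,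
        List.not_mem_nil, false_imp_iff, implies_true, List.Pairwise.nil, and_true]
      exact Finset.disjoint_filter_filter_not _ _ _
    · refine hab.mono ?_ ?_
      · simp only [idxChildren, List.mem_cons, List.not_mem_nil, or_false] at hx
        rcases hx with rfl | rfl <;> exact Finset.filter_subset _ _
      · simp only [idxChildren, List.mem_cons, List.not_mem_nil, or_false] at hy
        rcases hy with rfl | rfl <;> exact Finset.filter_subset _ _

lemma idxPartition_pairwise_disjoint (ω : Draws D) (i : ℕ) :
    (idxPartition X δ ω i).Pairwise fun a b => Disjoint a.2 b.2 := by
  induction i with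
  | zero => simp [idxPartition]
  | succ i ih =>
    rw [idxPartition, List.pairwise_flatMap]
    refine ⟨fun a _ => idxLeaves_pairwise_disjoint _ _ _, ih.imp fun {a b} hab x hx y hy => ?_⟩
    exact hab.mono (idxLeaves_one_side hx).1 (idxLeaves_one_side hy).1

lemma idxCoreDepth_congr {ω ω' : Draws D} {a : IndexNode n}
    (h : ∀ j i, ω (a.1, j, i) = ω' (a.1, j, i)) :
    idxCoreDepth X δ ω a = idxCoreDepth X δ ω' a := by
  simp only [idxCoreDepth, idxRunDepth, h]

lemma idxCoreLeaves_congr {ω ω' : Draws D} {a : IndexNode n}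
    (h : ∀ j i, ω (a.1, j, i) = ω' (a.1, j, i)) :
    idxCoreLeaves X δ ω a = idxCoreLeaves X δ ω' a := by
  simp only [idxCoreLeaves, idxCoreRun, idxCoreDepth, idxRunDepth, h]

/-- Whether a node is ever reached does not depend on the draws attached to its own path. -/
lemma exists_mem_idxPartition_of_eq_off {ω ω' : Draws D} {p : List Bool}
    (h : ∀ q, q ≠ p → ∀ j i, ω (q, j, i) = ω' (q, j, i)) {i : ℕ} {a : IndexNode n}
    (ha : a ∈ idxPartition X δ ω i) (hap : a.1 <+: p) :
    ∃ i' ≤ i, a ∈ idxPartition X δ ω' i' := by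
  induction i generalizing a with
  | zero => exact ⟨0, le_rfl, ha⟩
  | succ i ih =>
    simp only [idxPartition, List.mem_flatMap] at ha
    obtain ⟨b, hb, hab⟩ := ha
    obtain ⟨s, hs, hlen⟩ := idxLeaves_path hab
    have hba : b.1 <+: a.1 := ⟨s, hs.symm⟩
    -- Leaves at the path `p` of a call at `p` come from a tree of depth zero: the node itself.
    by_cases hbp : b.1 = p
    · have hs0 : s = [] := by
        have h1 := hap.length_le
        rw [hs, ← hbp, List.length_append] at h1
        exact List.length_eq_zero_iff.1 (by omega)
      have hab' : a = b := by
        rw [hs0] at hlen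
        rw [idxCoreLeaves, ← hlen] at hab
        simpa [idxLeaves] using hab
      subst hab'
      obtain ⟨i', hi', h'⟩ := ih hb hap
      exact ⟨i', by omega, h'⟩
    · obtain ⟨i', hi', h'⟩ := ih hb (hba.trans hap)
      refine ⟨i' + 1, by omega, ?_⟩
      simp only [idxPartition, List.mem_flatMap]
      exact ⟨b, h', by rwa [← idxCoreLeaves_congr (h b.1 hbp)]⟩

/-- Events that depend on disjoint sets of draws are independent. -/
lemma drawsLaw_inter_eq_mul {A B : Set (Draws D)} (hA : MeasurableSet A) (hB : MeasurableSet B)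
    (T : Set (List Bool × ℕ × ℕ))
    (hAT : ∀ ω ω' : Draws D, (∀ q ∈ T, ω q = ω' q) → ω ∈ A → ω' ∈ A)
    (hBT : ∀ ω ω' : Draws D, (∀ q ∈ Tᶜ, ω q = ω' q) → ω ∈ B → ω' ∈ B) :
    drawsLaw D (A ∩ B) = drawsLaw D A * drawsLaw D B := by
  classical
  set m : List Bool × ℕ × ℕ → MeasurableSpace (Draws D) := fun q =>
    MeasurableSpace.comap (fun ω : Draws D => ω q) inferInstance with hm
  have hind : iIndep m (drawsLaw D) :=
    iIndepFun_infinitePi (P := fun _ => drawLaw D) (X := fun _ w => w) (fun _ => measurable_id)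
  have hmle : ∀ q, m q ≤ (inferInstance : MeasurableSpace (Draws D)) := fun q =>
    (measurable_pi_apply q).comap_le
  have key : ∀ (T : Set (List Bool × ℕ × ℕ)) (A : Set (Draws D)), MeasurableSet A →
      (∀ ω ω' : Draws D, (∀ q ∈ T, ω q = ω' q) → ω ∈ A → ω' ∈ A) →
      MeasurableSet[⨆ q ∈ T, m q] A := by
    intro T A hA hAT
    -- `A` is its own preimage under the map that forgets the draws outside of `T`.
    set g : Draws D → Draws D := fun ω q => if q ∈ T then ω q else 0 with hg
    have hgm : Measurable[⨆ q ∈ T, m q] g := by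
      refine @measurable_pi_lambda _ _ _ (⨆ q ∈ T, m q) _ _ fun q => ?_
      by_cases hq : q ∈ T
      · simp only [hg, hq, if_true]
        exact (comap_measurable (fun ω : Draws D => ω q)).mono (le_iSup₂_of_le q hq le_rfl) le_rfl
      · simp only [hg, hq, if_false]
        exact @measurable_const _ _ _ (⨆ q ∈ T, m q) _
    have : g ⁻¹' A = A := by
      ext ω
      constructor
      · exact hAT _ _ fun q hq => by simp [hg, hq]
      · exact hAT _ _ fun q hq => by simp [hg, hq]
    rw [← this]
    exact hgm hA
  exact (Indep_iff _ _ _).1 (indep_iSup_of_disjoint hmle hind disjoint_compl_right) A B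
    (key T A hA hAT) (key Tᶜ B hB hBT)

instance (D : ℕ) : IsProbabilityMeasure (drawsLaw D) := by
  unfold drawsLaw; infer_instance

/-- The number of nodes with distinct sample points in a round is at most `n`. -/
lemma card_nontrivial_idxPartition_le (ω : Draws D) (i : ℕ) :
    ((idxPartition X δ ω i).toFinset.filter fun a => 0 < idxDiam X a.2).card ≤ n := by
  set F := (idxPartition X δ ω i).toFinset.filter fun a => 0 < idxDiam X a.2 with hF
  have hne : ∀ a ∈ F, 1 ≤ a.2.card := by
    intro a ha
    rw [Nat.one_le_iff_ne_zero, Ne, Finset.card_eq_zero]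
    intro h0
    have := (Finset.mem_filter.1 ha).2
    simp [h0, idxDiam] at this
  calc F.card = ∑ a ∈ F, 1 := by simp
    _ ≤ ∑ a ∈ F, a.2.card := Finset.sum_le_sum hne
    _ = (F.biUnion Prod.snd).card := by
        refine (Finset.card_biUnion fun a ha b hb hab => ?_).symm
        have ha' := List.mem_toFinset.1 (Finset.mem_filter.1 ha).1
        have hb' := List.mem_toFinset.1 (Finset.mem_filter.1 hb).1
        have : Std.Symm fun a b : IndexNode n => Disjoint a.2 b.2 := ⟨fun _ _ h => h.symm⟩
        exact (idxPartition_pairwise_disjoint ω i).forall ha' hb' hab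
    _ ≤ n := (Finset.card_le_univ _).trans (by simp)

lemma idxCoreDepth_eq_zero (ω : Draws D) (hR : 0 < numRuns n δ) {a : IndexNode n}
    (h : ¬ 0 < idxDiam X a.2) : idxCoreDepth X δ ω a = 0 := by
  have h0 : idxDiam X a.2 = 0 := le_antisymm (not_lt.1 h) (idxDiam_nonneg _)
  have h1 : idxRunDepth X ω a 0 ≤ (0 : ℕ) := by
    refine idxDepth_le_iff.2 ⟨0, le_rfl, idxAvgDiam_le (by linarith) fun b hb => ?_⟩
    simp only [idxLeaves, List.mem_singleton] at hb
    rw [hb]; linarith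
  have h2 : idxCoreDepth X δ ω a ≤ idxRunDepth X ω a 0 :=
    iInf_le (fun j : Fin (numRuns n δ) => idxRunDepth X ω a j) ⟨0, hR⟩
  exact le_antisymm (by simpa using h2.trans h1) (zero_le)

/-- Union bound over the calls. The calls are adaptive, but whether a given node is reached is
independent of the draws used in the call at this node. -/
lemma drawsLaw_exists_call_gt {S : Set (E D)} {d : ℝ} (hS : Doubling S d) (hd : 3 / 2 ≤ d)
    (hX : ∀ i, X i ∈ S) (hR : 0 < numRuns n δ) :
    drawsLaw D {ω | ∃ i < n, ∃ a ∈ idxPartition X δ ω i,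
      ((⌊60000 * d * Real.logb 2 d⌋₊ : ℕ) : ℕ∞) < idxCoreDepth X δ ω a} ≤
      ENNReal.ofReal ((n : ℝ) ^ 2 * (1 / 2) ^ numRuns n δ) := by
  classical
  set k : ℕ∞ := ((⌊60000 * d * Real.logb 2 d⌋₊ : ℕ) : ℕ∞) with hk
  have hXm : Measurable fun _ : Draws D => X := measurable_const
  set reach : IndexNode n → ℕ → Set (Draws D) := fun a i => {ω | a ∈ idxPartition X δ ω i}
    with hreach
  set V : IndexNode n → Set (Draws D) := fun a => ⋃ i < n, reach a i with hV
  set bad : IndexNode n → Set (Draws D) := fun a => {ω | k < idxCoreDepth X δ ω a} with hbad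
  have hreachm : ∀ a i, MeasurableSet (reach a i) := fun a i =>
    (measurableFibers_idxPartition hXm measurable_id i).setOf_mem {L | a ∈ L}
  have hVm : ∀ a, MeasurableSet (V a) := fun a =>
    MeasurableSet.iUnion fun i => MeasurableSet.iUnion fun _ => hreachm a i
  have hbadm : ∀ a, MeasurableSet (bad a) := fun a =>
    (measurableFibers_idxCoreDepth hXm measurable_id a).setOf_mem {m | k < m}
  set Q : Set (IndexNode n) := {a | 0 < idxDiam X a.2} with hQ
  -- The event that `a` is reached depends on the draws off the path of `a` only, the depth of the
  -- call at `a` on those attached to this path.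
  have hcall : ∀ a ∈ Q, drawsLaw D (bad a ∩ V a) ≤
      ENNReal.ofReal ((1 / 2) ^ numRuns n δ) * drawsLaw D (V a) := by
    intro a ha
    rw [drawsLaw_inter_eq_mul (hbadm a) (hVm a) {q | q.1 = a.1}]
    · gcongr
      exact drawsLaw_idxCoreDepth_gt hS hd hX ha
    · intro ω ω' h hω
      have := idxCoreDepth_congr (X := X) (δ := δ) (a := a) fun j i => h (a.1, j, i) rfl
      simp only [hbad, Set.mem_ofPred_eq] at hω ⊢
      rwa [← this]
    · intro ω ω' h hω
      simp only [hV, hreach, Set.mem_iUnion, Set.mem_ofPred_eq, exists_prop] at hω ⊢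
      obtain ⟨i, hi, hai⟩ := hω
      obtain ⟨i', hi', h'⟩ := exists_mem_idxPartition_of_eq_off (ω' := ω') (p := a.1)
        (fun q hq j l => h (q, j, l) hq) hai List.prefix_rfl
      exact ⟨i', by omega, h'⟩
  -- The expected number of calls in a round, on cells with distinct sample points.
  have hround : ∀ i, ∑' a : Q, drawsLaw D (reach a i) ≤ n := by
    intro i
    calc ∑' a : Q, drawsLaw D (reach a i)
        = ∑' a : Q, ∫⁻ ω, (reach a i).indicator 1 ω ∂drawsLaw D := by
          refine tsum_congr fun a => ?_
          rw [lintegral_indicator_one (hreachm _ _)]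
      _ = ∫⁻ ω, ∑' a : Q, (reach a i).indicator 1 ω ∂drawsLaw D :=
          (lintegral_tsum fun a => (measurable_one.indicator (hreachm _ _)).aemeasurable).symm
      _ ≤ ∫⁻ _, n ∂drawsLaw D := by
          refine lintegral_mono fun ω => ?_
          have h1 : ∑' a : Q, (reach a i).indicator (1 : Draws D → ℝ≥0∞) ω =
              ∑' a : IndexNode n, Q.indicator
                (fun a => (reach a i).indicator (1 : Draws D → ℝ≥0∞) ω) a :=
            tsum_subtype Q fun a => (reach a i).indicator (1 : Draws D → ℝ≥0∞) ω
          rw [h1, tsum_eq_sum (s := (idxPartition X δ ω i).toFinset.filter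
            fun a => 0 < idxDiam X a.2)]
          · calc _ ≤ ∑ a ∈ (idxPartition X δ ω i).toFinset.filter
                  (fun a => 0 < idxDiam X a.2), (1 : ℝ≥0∞) := by
                  refine Finset.sum_le_sum fun a _ => ?_
                  refine (Set.indicator_le_self' (fun _ _ => zero_le) _).trans ?_
                  exact Set.indicator_le_self' (fun _ _ => zero_le) _
              _ ≤ n := by
                  rw [Finset.sum_const, nsmul_one]
                  exact_mod_cast card_nontrivial_idxPartition_le ω i
          · intro a ha
            simp only [Finset.mem_filter, List.mem_toFinset, not_and] at ha
            by_cases haQ : a ∈ Q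
            · rw [Set.indicator_of_mem haQ, Set.indicator_of_notMem]
              exact fun h => ha h haQ
            · exact Set.indicator_of_notMem haQ _
      _ = n := by simp
  have hsub : {ω | ∃ i < n, ∃ a ∈ idxPartition X δ ω i, k < idxCoreDepth X δ ω a} ⊆
      ⋃ a : Q, bad a ∩ V a := by
    rintro ω ⟨i, hi, a, ha, hka⟩
    have haQ : a ∈ Q := by
      by_contra hn
      rw [idxCoreDepth_eq_zero ω hR hn] at hka
      exact absurd hka (not_lt.2 (zero_le))
    refine Set.mem_iUnion.2 ⟨⟨a, haQ⟩, hka, ?_⟩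
    simp only [hV, Set.mem_iUnion]
    exact ⟨i, hi, ha⟩
  calc drawsLaw D _ ≤ drawsLaw D (⋃ a : Q, bad a ∩ V a) := measure_mono hsub
    _ ≤ ∑' a : Q, drawsLaw D (bad a ∩ V a) := measure_iUnion_le _
    _ ≤ ∑' a : Q, ENNReal.ofReal ((1 / 2) ^ numRuns n δ) *
          ∑ i ∈ Finset.range n, drawsLaw D (reach a i) := by
        refine ENNReal.tsum_le_tsum fun a => (hcall a a.2).trans ?_
        gcongr
        have : V a = ⋃ i ∈ Finset.range n, reach a i := by simp [hV]
        rw [this]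
        exact measure_biUnion_finset_le _ _
    _ = ENNReal.ofReal ((1 / 2) ^ numRuns n δ) *
          ∑ i ∈ Finset.range n, ∑' a : Q, drawsLaw D (reach a i) := by
        rw [ENNReal.tsum_mul_left, Summable.tsum_finsetSum fun _ _ => ENNReal.summable]
    _ ≤ ENNReal.ofReal ((1 / 2) ^ numRuns n δ) * ∑ i ∈ Finset.range n, (n : ℝ≥0∞) := by
        gcongr with i _
        exact hround i
    _ = ENNReal.ofReal ((n : ℝ) ^ 2 * (1 / 2) ^ numRuns n δ) := by
        rw [Finset.sum_const, Finset.card_range, nsmul_eq_mul, mul_comm, sq,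
          ENNReal.ofReal_mul (by positivity), ENNReal.ofReal_mul (by positivity),
          ENNReal.ofReal_natCast]

end Calls

/-! ### The shape of the partitions -/

section Tree

variable {D n : ℕ} {X : Fin n → E D} {δ : ℝ} {ω : Draws D} {𝒳 : Set (E D)}

lemma mem_children {A B : Node D} {v : E D} {t : ℝ} (h : B ∈ children A v t) :
    B = ⟨A.path ++ [true], {x ∈ A.cell | inner ℝ x v ≤ t}⟩ ∨
    B = ⟨A.path ++ [false], A.cell \ {x ∈ A.cell | inner ℝ x v ≤ t}⟩ := by
  simpa [children] using h

lemma cell_subset_of_mem_children {A B : Node D} {v : E D} {t : ℝ} (h : B ∈ children A v t) :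
    B.cell ⊆ A.cell := by
  rcases mem_children h with rfl | rfl
  · exact fun x hx => hx.1
  · exact Set.sdiff_subset

lemma cell_subset_of_mem_basicLeaves {A₀ A : Node D} {w : ℕ → E D × ℝ} {k : ℕ}
    (hA : A ∈ basicLeaves X A₀ w k) : A.cell ⊆ A₀.cell := by
  induction k generalizing A with
  | zero =>
    simp only [basicLeaves, List.mem_singleton] at hA
    rw [hA]
  | succ k ih =>
    simp only [basicLeaves, List.mem_flatMap] at hA
    obtain ⟨B, hB, hAB⟩ := hA
    exact (cell_subset_of_mem_children hAB).trans (ih hB)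

lemma level_of_mem_basicLeaves {A₀ A : Node D} {w : ℕ → E D × ℝ} {k : ℕ}
    (hA : A ∈ basicLeaves X A₀ w k) : A.level = A₀.level + k := by
  induction k generalizing A with
  | zero =>
    simp only [basicLeaves, List.mem_singleton] at hA
    rw [hA, add_zero]
  | succ k ih =>
    simp only [basicLeaves, List.mem_flatMap] at hA
    obtain ⟨B, hB, hAB⟩ := hA
    have h := ih hB
    rcases mem_children hAB with rfl | rfl <;>
    · simp only [Node.level, List.length_append, List.length_singleton] at h ⊢
      omega

lemma basicLeaves_pairwise_disjoint (A₀ : Node D) (w : ℕ → E D × ℝ) (k : ℕ) :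
    (basicLeaves X A₀ w k).Pairwise fun A B => Disjoint A.cell B.cell := by
  induction k with
  | zero => simp [basicLeaves]
  | succ k ih =>
    rw [basicLeaves, List.pairwise_flatMap]
    refine ⟨fun A _ => ?_, ih.imp fun {A B} hAB x hx y hy => ?_⟩
    · simp only [children, List.pairwise_cons, List.mem_singleton, forall_eq,
        List.not_mem_nil, false_imp_iff, implies_true, List.Pairwise.nil, and_true]
      exact Set.disjoint_sdiff_right
    · exact hAB.mono (cell_subset_of_mem_children hx) (cell_subset_of_mem_children hy)

lemma exists_mem_basicLeaves (A₀ : Node D) (w : ℕ → E D × ℝ) (k : ℕ) {x : E D}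
    (hx : x ∈ A₀.cell) : ∃ A ∈ basicLeaves X A₀ w k, x ∈ A.cell := by
  induction k with
  | zero => exact ⟨A₀, by simp [basicLeaves], hx⟩
  | succ k ih =>
    obtain ⟨A, hA, hxA⟩ := ih
    simp only [basicLeaves, List.mem_flatMap]
    set t := threshold X A₀ (k + 1) (w (k + 1)) A
    by_cases h : inner ℝ x (w (k + 1)).1 ≤ t
    · exact ⟨⟨A.path ++ [true], {x ∈ A.cell | inner ℝ x (w (k + 1)).1 ≤ t}⟩,
        ⟨A, hA, by simp [children, t]⟩, hxA, h⟩
    · exact ⟨⟨A.path ++ [false], A.cell \ {x ∈ A.cell | inner ℝ x (w (k + 1)).1 ≤ t}⟩,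
        ⟨A, hA, by simp [children, t]⟩, hxA, fun hc => h hc.2⟩

lemma partition_pairwise_disjoint (i : ℕ) :
    (partition X δ ω 𝒳 i).Pairwise fun A B => Disjoint A.cell B.cell := by
  induction i with
  | zero => simp [partition]
  | succ i ih =>
    rw [partition, List.pairwise_flatMap]
    refine ⟨fun A _ => basicLeaves_pairwise_disjoint _ _ _, ih.imp fun {A B} hAB x hx y hy => ?_⟩
    exact hAB.mono (cell_subset_of_mem_basicLeaves hx) (cell_subset_of_mem_basicLeaves hy)

lemma exists_mem_partition (i : ℕ) {x : E D} (hx : x ∈ 𝒳) :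
    ∃ A ∈ partition X δ ω 𝒳 i, x ∈ A.cell := by
  induction i with
  | zero => exact ⟨⟨[], 𝒳⟩, by simp [partition], hx⟩
  | succ i ih =>
    obtain ⟨A, hA, hxA⟩ := ih
    obtain ⟨B, hB, hxB⟩ := exists_mem_basicLeaves (X := X) A
      (fun i => ω (A.path, coreRun X δ ω A, i)) (coreDepth X δ ω A).toNat hxA
    refine ⟨B, ?_, hxB⟩
    simp only [partition, List.mem_flatMap]
    exact ⟨A, hA, hB⟩

lemma sum_map_flatMap {α β : Type*} (L : List α) (f : α → List β) (g : β → ℝ) :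
    ((L.flatMap f).map g).sum = (L.map fun a => ((f a).map g).sum).sum := by
  induction L with
  | nil => rfl
  | cons a L ih => simp [List.flatMap_cons, ih]

/-- Kraft's equality for the leaves of a binary tree. -/
lemma kraft_basicLeaves (A₀ : Node D) (w : ℕ → E D × ℝ) (k : ℕ) :
    ((basicLeaves X A₀ w k).map fun A => ((1 : ℝ) / 2) ^ A.level).sum = (1 / 2) ^ A₀.level := by
  induction k with
  | zero => simp [basicLeaves]
  | succ k ih =>
    rw [basicLeaves, sum_map_flatMap, ← ih]
    congr 2
    funext A
    simp only [children, List.map_cons, List.map_nil, List.sum_cons, List.sum_nil, Node.level,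
      List.length_append, List.length_singleton, pow_succ]
    ring

lemma kraft_partition (i : ℕ) :
    ((partition X δ ω 𝒳 i).map fun A => ((1 : ℝ) / 2) ^ A.level).sum = 1 := by
  induction i with
  | zero => simp [partition, Node.level]
  | succ i ih =>
    rw [partition, sum_map_flatMap]
    refine Eq.trans ?_ ih
    congr 2
    funext A
    exact kraft_basicLeaves _ _ _

lemma level_le_listLevel {L : List (Node D)} {A : Node D} (hA : A ∈ L) :
    A.level ≤ listLevel L := by
  induction L with
  | nil => simp at hA
  | cons B L ih =>
    simp only [listLevel, List.map_cons, List.foldr_cons]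
    rcases List.mem_cons.1 hA with rfl | h
    · exact le_max_left _ _
    · exact (ih h).trans (le_max_right _ _)

lemma listLevel_le {L : List (Node D)} {r : ℝ} (hr : 0 ≤ r) (h : ∀ A ∈ L, (A.level : ℝ) ≤ r) :
    (listLevel L : ℝ) ≤ r := by
  induction L with
  | nil => simpa [listLevel] using hr
  | cons B L ih =>
    simp only [listLevel, List.map_cons, List.foldr_cons]
    rw [Nat.cast_max]
    exact max_le (h B (by simp)) (ih fun A hA => h A (by simp [hA]))

/-- The tree being binary, the number of cells is bounded through their levels, by Kraft. -/
lemma length_partition_le (i : ℕ) :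
    ((partition X δ ω 𝒳 i).length : ℝ) ≤ 2 ^ listLevel (partition X δ ω 𝒳 i) := by
  set L := partition X δ ω 𝒳 i with hL
  have h1 : (L.map fun _ => ((1 : ℝ) / 2) ^ listLevel L).sum ≤
      (L.map fun A => ((1 : ℝ) / 2) ^ A.level).sum := by
    refine List.sum_le_sum fun A hA => ?_
    exact pow_le_pow_of_le_one (by norm_num) (by norm_num) (level_le_listLevel hA)
  rw [hL, kraft_partition, ← hL, List.map_const', List.sum_replicate, nsmul_eq_mul, one_div,
    inv_pow, ← div_eq_mul_inv, div_le_one (by positivity)] at h1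
  exact h1

/-! ### Decrease of the data diameters -/

/-- The numerator `∑ μ_n(A) Δ_n(A)²` of the squared average diameter. -/
def sumSqDiam (X : Fin n → E D) (L : List (Node D)) : ℝ :=
  (L.map fun A => empMass X A.cell * dataDiam X A.cell ^ 2).sum

/-- The total empirical mass of a list of cells. -/
def sumMass (X : Fin n → E D) (L : List (Node D)) : ℝ := (L.map fun A => empMass X A.cell).sum

lemma empMass_nonneg (A : Set (E D)) : 0 ≤ empMass X A := by unfold empMass; positivity

lemma dataDiam_nonneg (A : Set (E D)) : 0 ≤ dataDiam X A := Metric.diam_nonneg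

lemma dataDiam_mono {A B : Set (E D)} (h : A ⊆ B) : dataDiam X A ≤ dataDiam X B := by
  rw [dataDiam_eq_idxDiam, dataDiam_eq_idxDiam]
  exact idxDiam_mono fun i hi => mem_indicesIn.2 (h (mem_indicesIn.1 hi))

lemma sumSqDiam_nonneg (L : List (Node D)) : 0 ≤ sumSqDiam X L :=
  List.sum_nonneg (by
    simp only [List.mem_map]
    rintro _ ⟨A, -, rfl⟩
    exact mul_nonneg (empMass_nonneg _) (sq_nonneg _))

lemma avgDiam_eq (L : List (Node D)) :
    avgDiam X L = Real.sqrt (sumSqDiam X L / sumMass X L) := rfl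

lemma sumMass_children (A : Node D) (v : E D) (t : ℝ) :
    sumMass X (children A v t) = empMass X A.cell := by
  simp only [sumMass, children, List.map_cons, List.map_nil, List.sum_cons, List.sum_nil, empMass,
    add_zero]
  rw [← add_div]
  congr 1
  rw [← Nat.cast_add]
  congr 1
  rw [← Finset.card_union_of_disjoint]
  · congr 1
    ext i
    simp only [Finset.mem_union, mem_indicesIn, Set.mem_ofPred_eq, Set.mem_sdiff]
    tauto
  · rw [Finset.disjoint_left]
    intro i hi hi'
    simp only [mem_indicesIn, Set.mem_ofPred_eq, Set.mem_sdiff] at hi hi'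
    tauto

lemma sumMass_basicLeaves (A₀ : Node D) (w : ℕ → E D × ℝ) (k : ℕ) :
    sumMass X (basicLeaves X A₀ w k) = empMass X A₀.cell := by
  induction k with
  | zero => simp [basicLeaves, sumMass]
  | succ k ih =>
    rw [← ih, basicLeaves, sumMass, sum_map_flatMap, sumMass]
    congr 2
    funext A
    exact sumMass_children _ _ _

lemma sumMass_partition (hn : 1 ≤ n) (hX : ∀ i, X i ∈ 𝒳) (i : ℕ) :
    sumMass X (partition X δ ω 𝒳 i) = 1 := by
  induction i with
  | zero =>
    have : indicesIn X 𝒳 = Finset.univ := by ext i; simp [mem_indicesIn, hX]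
    have hn' : (n : ℝ) ≠ 0 := by positivity
    simp [partition, sumMass, empMass, this, hn']
  | succ i ih =>
    rw [← ih, partition, sumMass, sum_map_flatMap, sumMass]
    congr 2
    funext A
    exact sumMass_basicLeaves _ _ _

lemma avgDiam_partition_sq (hn : 1 ≤ n) (hX : ∀ i, X i ∈ 𝒳) (i : ℕ) :
    avgDiam X (partition X δ ω 𝒳 i) ^ 2 = sumSqDiam X (partition X δ ω 𝒳 i) := by
  rw [avgDiam_eq, sumMass_partition hn hX, div_one, Real.sq_sqrt (sumSqDiam_nonneg _)]

lemma avgDiam_nonneg (L : List (Node D)) : 0 ≤ avgDiam X L := Real.sqrt_nonneg _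

/-- The run that is kept attains the depth of the call. -/
lemma coreRun_spec (hR : 0 < numRuns n δ) (A : Node D) :
    coreRun X δ ω A < numRuns n δ ∧ runDepth X ω A (coreRun X δ ω A) = coreDepth X δ ω A := by
  have : Nonempty (Fin (numRuns n δ)) := ⟨⟨0, hR⟩⟩
  obtain ⟨j, hj⟩ := exists_eq_ciInf_of_finite
    (f := fun j : Fin (numRuns n δ) => runDepth X ω A j)
  exact Nat.sInf_mem (s := {j : ℕ | j < numRuns n δ ∧ runDepth X ω A j = coreDepth X δ ω A})
    ⟨j, j.2, hj⟩

lemma avgDiam_coreLeaves_le (hR : 0 < numRuns n δ) {A : Node D} {m : ℕ}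
    (hm : coreDepth X δ ω A = m) :
    avgDiam X (coreLeaves X δ ω A) ≤ dataDiam X A.cell / 2 := by
  have h1 := (coreRun_spec (X := X) (ω := ω) hR A).2
  rw [hm] at h1
  have h2 : ((fun i : ℕ => (i : ℕ∞)) '' {i | avgDiam X (basicLeaves X A
      (fun i => ω (A.path, coreRun X δ ω A, i)) i) ≤ dataDiam X A.cell / 2}).Nonempty := by
    by_contra hne
    rw [Set.not_nonempty_iff_eq_empty] at hne
    rw [runDepth, basicDepth, hne, sInf_empty] at h1
    exact ENat.top_ne_natCast m h1
  obtain ⟨i, hi, him⟩ := csInf_mem h2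
  have h3 : (i : ℕ∞) = m := him.trans h1
  have h4 : i = m := by exact_mod_cast h3
  rw [coreLeaves, hm, ENat.toNat_natCast, ← h4]
  exact hi

/-- A call of the core procedure halves the average data diameter, also on a cell without sample
points, where both sides vanish. -/
lemma sumSqDiam_coreLeaves_le (hR : 0 < numRuns n δ) {A : Node D} {m : ℕ}
    (hm : coreDepth X δ ω A = m) :
    sumSqDiam X (coreLeaves X δ ω A) ≤ empMass X A.cell * dataDiam X A.cell ^ 2 / 4 := by
  have hmass : sumMass X (coreLeaves X δ ω A) = empMass X A.cell := sumMass_basicLeaves _ _ _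
  rcases (empMass_nonneg (X := X) A.cell).eq_or_lt with h0 | h0
  · have hall : ∀ B ∈ coreLeaves X δ ω A, empMass X B.cell = 0 := by
      intro B hB
      refine le_antisymm ?_ (empMass_nonneg _)
      rw [h0, ← hmass]
      refine List.single_le_sum ?_ _ (List.mem_map_of_mem hB)
      simp only [List.mem_map]
      rintro _ ⟨C, -, rfl⟩
      exact empMass_nonneg _
    rw [← h0, sumSqDiam, List.map_congr_left (g := fun _ => (0 : ℝ))
      fun B hB => by rw [hall B hB, zero_mul]]
    simp
  · have h1 := avgDiam_coreLeaves_le hR hm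
    rw [avgDiam_eq, hmass, Real.sqrt_le_left (by linarith [dataDiam_nonneg (X := X) A.cell]),
      div_le_iff₀ h0] at h1
    linarith

lemma sumSqDiam_flatMap_le (hR : 0 < numRuns n δ) (L : List (Node D))
    (h : ∀ A ∈ L, ∃ m : ℕ, coreDepth X δ ω A = m) :
    sumSqDiam X (L.flatMap fun A => coreLeaves X δ ω A) ≤ sumSqDiam X L / 4 := by
  induction L with
  | nil => simp [sumSqDiam]
  | cons A L ih =>
    obtain ⟨m, hm⟩ := h A (by simp)
    have h1 := sumSqDiam_coreLeaves_le hR hm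
    have h2 := ih fun B hB => h B (by simp [hB])
    simp only [sumSqDiam, List.flatMap_cons, List.map_append, List.sum_append, List.map_cons,
      List.sum_cons] at h1 h2 ⊢
    linarith

/-- Each round divides the average data diameter by two. -/
lemma avgDiam_partition_sq_le (hn : 1 ≤ n) (hX : ∀ i, X i ∈ 𝒳) (hR : 0 < numRuns n δ) (I : ℕ)
    (h : ∀ i < I, ∀ A ∈ partition X δ ω 𝒳 i, ∃ m : ℕ, coreDepth X δ ω A = m) {i : ℕ}
    (hi : i ≤ I) :
    avgDiam X (partition X δ ω 𝒳 i) ^ 2 ≤ (1 / 4) ^ i * dataDiam X 𝒳 ^ 2 := by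
  rw [avgDiam_partition_sq hn hX]
  induction i with
  | zero =>
    have h1 := sumMass_partition (δ := δ) (ω := ω) hn hX 0
    simp only [sumMass, partition, List.map_cons, List.map_nil, List.sum_cons, List.sum_nil,
      add_zero] at h1
    simp [partition, sumSqDiam, h1]
  | succ i ih =>
    have h1 := sumSqDiam_flatMap_le hR _ (h i (by omega))
    have h2 := ih (by omega)
    rw [partition, pow_succ]
    linarith

lemma level_of_mem_coreLeaves {A B : Node D} {m : ℕ} (hm : coreDepth X δ ω A = m)
    (hB : B ∈ coreLeaves X δ ω A) : B.level = A.level + m := by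
  have := level_of_mem_basicLeaves hB
  rwa [hm, ENat.toNat_natCast] at this

lemma level_le_of_mem_partition {k : ℝ} (I : ℕ)
    (h : ∀ i < I, ∀ A ∈ partition X δ ω 𝒳 i, ∃ m : ℕ, coreDepth X δ ω A = m ∧ (m : ℝ) ≤ k)
    {i : ℕ} (hi : i ≤ I) {A : Node D} (hA : A ∈ partition X δ ω 𝒳 i) : (A.level : ℝ) ≤ k * i := by
  induction i generalizing A with
  | zero =>
    simp only [partition, List.mem_singleton] at hA
    simp [hA, Node.level]
  | succ i ih =>
    simp only [partition, List.mem_flatMap] at hA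
    obtain ⟨B, hB, hAB⟩ := hA
    obtain ⟨m, hm, hmk⟩ := h i (by omega) B hB
    rw [level_of_mem_coreLeaves hm hAB]
    have := ih (by omega) hB
    push_cast
    linarith

/-- A call on a cell with distinct sample points splits this cell. -/
lemma coreDepth_ne_zero (hR : 0 < numRuns n δ) {A : Node D} (hA : 0 < dataDiam X A.cell) :
    coreDepth X δ ω A ≠ 0 := by
  intro h0
  have h1 := avgDiam_coreLeaves_le hR (X := X) (ω := ω) (A := A) (m := 0) (by simpa using h0)
  have h2 : 0 < empMass X A.cell := by
    have hne : (indicesIn X A.cell).Nonempty := by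
      by_contra hne
      rw [Finset.not_nonempty_iff_eq_empty] at hne
      rw [dataDiam_eq_idxDiam, hne] at hA
      simp [idxDiam] at hA
    obtain ⟨i, hi⟩ := hne
    have : 0 < n := i.pos
    have := Finset.card_pos.2 ⟨i, hi⟩
    unfold empMass
    positivity
  have h3 : avgDiam X (coreLeaves X δ ω A) = dataDiam X A.cell := by
    rw [coreLeaves, h0]
    simp only [ENat.toNat_zero, basicLeaves, avgDiam, List.map_cons, List.map_nil, List.sum_cons,
      List.sum_nil, add_zero]
    rw [mul_div_cancel_left₀ _ h2.ne', Real.sqrt_sq hA.le]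
  linarith

/-- Every round splits the cells with distinct sample points, so that the level of such a cell is
at least the number of rounds. -/
lemma le_level_of_dataDiam_pos (hR : 0 < numRuns n δ) (I : ℕ)
    (h : ∀ i < I, ∀ A ∈ partition X δ ω 𝒳 i, ∃ m : ℕ, coreDepth X δ ω A = m) {i : ℕ} (hi : i ≤ I)
    {A : Node D} (hA : A ∈ partition X δ ω 𝒳 i) (hpos : 0 < dataDiam X A.cell) : i ≤ A.level := by
  induction i generalizing A with
  | zero => exact Nat.zero_le _
  | succ i ih =>
    simp only [partition, List.mem_flatMap] at hA
    obtain ⟨B, hB, hAB⟩ := hA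
    obtain ⟨m, hm⟩ := h i (by omega) B hB
    have hBpos := hpos.trans_le (dataDiam_mono (X := X) (cell_subset_of_mem_basicLeaves hAB))
    have h1 := ih (by omega) hB hBpos
    have h2 := coreDepth_ne_zero (ω := ω) hR hBpos
    rw [hm] at h2
    have : m ≠ 0 := by exact_mod_cast h2
    rw [level_of_mem_coreLeaves hm hAB]
    omega

lemma le_listLevel_of_avgDiam_pos (hR : 0 < numRuns n δ) (I : ℕ)
    (h : ∀ i < I, ∀ A ∈ partition X δ ω 𝒳 i, ∃ m : ℕ, coreDepth X δ ω A = m) {i : ℕ} (hi : i ≤ I)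
    (hpos : 0 < avgDiam X (partition X δ ω 𝒳 i)) : i ≤ listLevel (partition X δ ω 𝒳 i) := by
  by_cases hex : ∃ A ∈ partition X δ ω 𝒳 i, 0 < dataDiam X A.cell
  · obtain ⟨A, hA, hA'⟩ := hex
    exact (le_level_of_dataDiam_pos hR I h hi hA hA').trans (level_le_listLevel hA)
  · push Not at hex
    have : sumSqDiam X (partition X δ ω 𝒳 i) = 0 := by
      rw [sumSqDiam, List.map_congr_left (g := fun _ => (0 : ℝ)) fun B hB => by
        rw [le_antisymm (hex B hB) (dataDiam_nonneg _)]; simp]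
      simp
    rw [avgDiam_eq, this] at hpos
    simp at hpos

end Tree

/-! ### The stopping rule and the score of the returned partition -/

section Stopping

open Real

variable {D n : ℕ} {X : Fin n → E D} {δ : ℝ} {ω : Draws D} {𝒳 : Set (E D)}

/-- The assumption on `n` and `δ` makes `α(n)` at least `1`: through its second summand if
`δ ≤ 1 / 2`, and through the first one if `n ≥ 3`. -/
lemma one_le_alpha (hn : 1 ≤ n) (hδ : 0 < δ) (hδ1 : δ < 1) (h : 3 ≤ n ∨ δ ≤ 1 / 2) :
    1 ≤ alpha n δ := by
  have hn' : (1 : ℝ) ≤ n := by exact_mod_cast hn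
  have hlog1 : 0 ≤ logb 2 (1 / δ) := Real.logb_nonneg (by norm_num) (by
    rw [le_div_iff₀ hδ]; linarith)
  by_cases h12 : δ ≤ 1 / 2
  · have h1 : 1 ≤ logb 2 (1 / δ) := by
      rw [Real.le_logb_iff_rpow_le (by norm_num) (by positivity), Real.rpow_one, le_div_iff₀ hδ]
      linarith
    have h2 : 1 ≤ logb 2 (n / δ) := by
      rw [Real.le_logb_iff_rpow_le (by norm_num) (by positivity), Real.rpow_one, le_div_iff₀ hδ]
      linarith
    have h3 : 0 ≤ logb 2 (logb 2 (n / δ)) := Real.logb_nonneg (by norm_num) h2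
    unfold alpha
    have := mul_nonneg (sq_nonneg (logb 2 n)) h3
    linarith
  · have hn3 : (3 : ℝ) ≤ n := by exact_mod_cast h.resolve_right h12
    have hl3 : (3 / 2 : ℝ) ≤ logb 2 n := by
      rw [Real.le_logb_iff_rpow_le (by norm_num) (by positivity)]
      have : (2 : ℝ) ^ (3 / 2 : ℝ) ≤ 3 := by
        rw [show (3 / 2 : ℝ) = 3 * (1 / 2) by norm_num, Real.rpow_mul (by norm_num),
          ← Real.sqrt_eq_rpow, Real.sqrt_le_left (by norm_num)]
        norm_num
      exact this.trans hn3
    have hl : (3 / 2 : ℝ) ≤ logb 2 (n / δ) := by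
      refine hl3.trans (Real.logb_le_logb_of_le (by norm_num) (by positivity) ?_)
      rw [le_div_iff₀ hδ]
      nlinarith
    have hll : (1 / 2 : ℝ) ≤ logb 2 (logb 2 (n / δ)) := by
      rw [Real.le_logb_iff_rpow_le (by norm_num) (by linarith), ← Real.sqrt_eq_rpow]
      exact (Real.sqrt_le_left (by norm_num)).2 (by norm_num) |>.trans hl
    unfold alpha
    have : (9 / 4 : ℝ) ≤ logb 2 n ^ 2 := by nlinarith
    nlinarith

/-- As long as the stopping condition fails, the number of cells is controlled. -/
lemma two_pow_listLevel_lt_of_not_stopCond (hn : 1 ≤ n) (hα : 1 ≤ alpha n δ) {i : ℕ}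
    (h : ¬ StopCond X δ ω 𝒳 i) :
    0 < avgDiam X (partition X δ ω 𝒳 i) ∧ 0 < dataDiam X 𝒳 ∧
      (2 : ℝ) ^ listLevel (partition X δ ω 𝒳 i) <
        n * avgDiam X (partition X δ ω 𝒳 i) ^ 2 / (alpha n δ * dataDiam X 𝒳 ^ 2) := by
  rw [StopCond, not_le] at h
  -- If one of the diameters vanishes, the argument of the logarithm is `0`; as `logb 2 0 = 0` the
  -- stopping condition then holds.
  have h1 : avgDiam X (partition X δ ω 𝒳 i) ≠ 0 := by
    intro h0
    simp only [h0, ne_eq, OfNat.ofNat_ne_zero, not_false_eq_true, zero_pow, mul_zero, zero_div,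
      Real.logb_zero] at h
    exact absurd h (not_lt.2 (Nat.cast_nonneg _))
  have h2 : dataDiam X 𝒳 ≠ 0 := by
    intro h0
    simp only [h0, ne_eq, OfNat.ofNat_ne_zero, not_false_eq_true, zero_pow, mul_zero, div_zero,
      Real.logb_zero] at h
    exact absurd h (not_lt.2 (Nat.cast_nonneg _))
  have h1' := lt_of_le_of_ne (avgDiam_nonneg _) h1.symm
  have h2' := lt_of_le_of_ne (dataDiam_nonneg (X := X) 𝒳) h2.symm
  have hn' : (0 : ℝ) < n := by exact_mod_cast hn
  refine ⟨h1', h2', ?_⟩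
  rwa [Real.lt_logb_iff_rpow_lt (by norm_num) (by positivity), Real.rpow_natCast] at h

lemma two_pow_listLevel_lt (hn : 1 ≤ n) (hX : ∀ i, X i ∈ 𝒳) (hR : 0 < numRuns n δ)
    (hα : 1 ≤ alpha n δ) (I : ℕ)
    (hfin : ∀ i < I, ∀ A ∈ partition X δ ω 𝒳 i, ∃ m : ℕ, coreDepth X δ ω A = m) {i : ℕ}
    (hi : i ≤ I) (h : ¬ StopCond X δ ω 𝒳 i) :
    (2 : ℝ) ^ listLevel (partition X δ ω 𝒳 i) < n / alpha n δ * (1 / 4) ^ i := by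
  obtain ⟨-, h2, h3⟩ := two_pow_listLevel_lt_of_not_stopCond hn hα h
  refine h3.trans_le ?_
  have h4 := avgDiam_partition_sq_le hn hX hR I hfin hi
  rw [div_le_iff₀ (by positivity)]
  calc (n : ℝ) * avgDiam X (partition X δ ω 𝒳 i) ^ 2
      ≤ n * ((1 / 4) ^ i * dataDiam X 𝒳 ^ 2) := by gcongr
    _ = n / alpha n δ * (1 / 4) ^ i * (alpha n δ * dataDiam X 𝒳 ^ 2) := by
        field_simp

/-- If all calls of the first `n` rounds return a tree, the procedure stops. -/
lemma exists_stopsAt (hn : 1 ≤ n) (hX : ∀ i, X i ∈ 𝒳) (hR : 0 < numRuns n δ)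
    (hα : 1 ≤ alpha n δ)
    (hfin : ∀ i < n, ∀ A ∈ partition X δ ω 𝒳 i, ∃ m : ℕ, coreDepth X δ ω A = m) :
    ∃ I ≤ n, StopsAt X δ ω 𝒳 I := by
  -- If the condition still failed at round `n`, there would be a cell with distinct sample points,
  -- hence of level at least `n`, while `2 ^ level` is smaller than `n`.
  have hlast : StopCond X δ ω 𝒳 n := by
    by_contra h
    have h1 := (two_pow_listLevel_lt_of_not_stopCond hn hα h).1
    have h2 := le_listLevel_of_avgDiam_pos hR n hfin le_rfl h1
    have h3 := two_pow_listLevel_lt hn hX hR hα n hfin le_rfl h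
    have h4 : (n : ℝ) / alpha n δ * (1 / 4) ^ n ≤ n * 1 := by
      gcongr
      · exact div_le_self (by positivity) hα
      · exact pow_le_one₀ (by norm_num) (by norm_num)
    have h5 : ((2 ^ n : ℕ) : ℝ) ≤ 2 ^ listLevel (partition X δ ω 𝒳 n) := by
      push_cast
      exact pow_le_pow_right₀ (by norm_num) h2
    have h6 : ((2 ^ n : ℕ) : ℝ) < n := by linarith
    have h7 : 2 ^ n < n := by exact_mod_cast h6
    exact absurd h7 (not_lt.2 Nat.lt_two_pow_self.le)
  have hex : ∃ i, 1 ≤ i ∧ StopCond X δ ω 𝒳 i := ⟨n, hn, hlast⟩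
  classical
  refine ⟨Nat.find hex, Nat.find_min' hex ⟨hn, hlast⟩, (Nat.find_spec hex).1,
    (Nat.find_spec hex).2, fun j hj1 hj h => ?_⟩
  exact Nat.find_min hex hj ⟨hj1, h⟩

/-- The cells of the last two partitions have level at most `log n + k`. -/
lemma level_le_of_stopsAt (hn : 1 ≤ n) (hX : ∀ i, X i ∈ 𝒳) (hR : 0 < numRuns n δ)
    (hα : 1 ≤ alpha n δ) {I : ℕ} (hI : StopsAt X δ ω 𝒳 I) {k : ℝ} (hk0 : 0 ≤ k)
    (hk : ∀ i < I, ∀ A ∈ partition X δ ω 𝒳 i, ∃ m : ℕ, coreDepth X δ ω A = m ∧ (m : ℝ) ≤ k)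
    {A : Node D} (hA : A ∈ partition X δ ω 𝒳 (I - 1) ∨ A ∈ partition X δ ω 𝒳 I) :
    (A.level : ℝ) ≤ logb 2 n + k := by
  have hn' : (1 : ℝ) ≤ n := by exact_mod_cast hn
  have hlog : 0 ≤ logb 2 (n : ℝ) := Real.logb_nonneg (by norm_num) hn'
  have hfin : ∀ i < I, ∀ A ∈ partition X δ ω 𝒳 i, ∃ m : ℕ, coreDepth X δ ω A = m :=
    fun i hi A hA => (hk i hi A hA).imp fun m hm => hm.1
  have hprev : ∀ B ∈ partition X δ ω 𝒳 (I - 1), (B.level : ℝ) ≤ logb 2 n := by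
    intro B hB
    by_cases hI1 : I = 1
    · subst hI1
      simp only [Nat.sub_self, partition, List.mem_singleton] at hB
      simpa [hB, Node.level] using hlog
    · have h1 := hI.2.2 (I - 1) (by have := hI.1; omega) (by have := hI.1; omega)
      have h2 := two_pow_listLevel_lt hn hX hR hα I hfin (Nat.sub_le _ _) h1
      have h3 : (n : ℝ) / alpha n δ * (1 / 4) ^ (I - 1) ≤ n * 1 := by
        gcongr
        · exact div_le_self (by positivity) hα
        · exact pow_le_one₀ (by norm_num) (by norm_num)
      have h4 : (2 : ℝ) ^ B.level ≤ 2 ^ listLevel (partition X δ ω 𝒳 (I - 1)) :=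
        pow_le_pow_right₀ (by norm_num) (level_le_listLevel hB)
      rw [Real.le_logb_iff_rpow_le (by norm_num) (by positivity), Real.rpow_natCast]
      linarith
  rcases hA with hA | hA
  · linarith [hprev A hA]
  · obtain ⟨J, rfl⟩ : ∃ J, I = J + 1 := ⟨I - 1, by have := hI.1; omega⟩
    simp only [partition, List.mem_flatMap] at hA
    obtain ⟨B, hB, hAB⟩ := hA
    obtain ⟨m, hm, hmk⟩ := hk J (by omega) B hB
    rw [level_of_mem_coreLeaves hm hAB]
    have := hprev B hB
    push_cast
    linarith

/-- The score of the returned partition. Let `4 ^ (-T) = (α(n) / n) ^ (2 / (2 + k))`. If the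
procedure stops at round `I ≤ T`, the last partition is small enough; otherwise its predecessor has
a small average diameter. -/
lemma score_le (hn : 1 ≤ n) (hX : ∀ i, X i ∈ 𝒳) (hR : 0 < numRuns n δ)
    (hα : 1 ≤ alpha n δ) (hαn : alpha n δ ≤ n) {I : ℕ} (hI : StopsAt X δ ω 𝒳 I) {k : ℝ}
    (hk0 : 0 < k)
    (hk : ∀ i < I, ∀ A ∈ partition X δ ω 𝒳 i, ∃ m : ℕ, coreDepth X δ ω A = m ∧ (m : ℝ) ≤ k)
    {L : List (Node D)} (hL : IsReturned X δ ω 𝒳 I L) :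
    score X δ L ≤ 4 * (1 + dataDiam X 𝒳 ^ 2) * (alpha n δ / n) ^ (2 / (2 + k)) := by
  have hn' : (1 : ℝ) ≤ n := by exact_mod_cast hn
  have hfin : ∀ i < I, ∀ A ∈ partition X δ ω 𝒳 i, ∃ m : ℕ, coreDepth X δ ω A = m :=
    fun i hi A hA => (hk i hi A hA).imp fun m hm => hm.1
  set Δ := dataDiam X 𝒳 with hΔ
  have hΔ0 : 0 ≤ Δ := dataDiam_nonneg _
  set x := alpha n δ / n with hx
  have hx0 : 0 < x := by positivity
  have hx1 : x ≤ 1 := (div_le_one (by positivity)).2 hαn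
  have hα0 : alpha n δ ≠ 0 := by positivity
  have hsc : ∀ i, score X δ (partition X δ ω 𝒳 i) ≤
      x * 2 ^ listLevel (partition X δ ω 𝒳 i) + avgDiam X (partition X δ ω 𝒳 i) ^ 2 := by
    intro i
    rw [score]
    gcongr
    exact length_partition_le i
  -- The stopping condition fails at the round before the last one, which bounds the number of
  -- cells; if the procedure stops at the first round, that partition has a single cell.
  have hprev : score X δ (partition X δ ω 𝒳 (I - 1)) ≤ (1 + Δ ^ 2) * (1 / 4) ^ (I - 1) := by
    refine (hsc _).trans ?_
    have h1 := avgDiam_partition_sq_le hn hX hR I hfin (Nat.sub_le I 1)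
    have h2 : x * 2 ^ listLevel (partition X δ ω 𝒳 (I - 1)) ≤ (1 / 4) ^ (I - 1) := by
      by_cases hI1 : I = 1
      · subst hI1
        simpa [partition, listLevel, Node.level] using hx1
      · have h3 := two_pow_listLevel_lt hn hX hR hα I hfin (Nat.sub_le _ _)
          (hI.2.2 (I - 1) (by have := hI.1; omega) (by have := hI.1; omega))
        calc x * 2 ^ listLevel (partition X δ ω 𝒳 (I - 1))
            ≤ x * (n / alpha n δ * (1 / 4) ^ (I - 1)) := by gcongr
          _ = (1 / 4) ^ (I - 1) := by rw [hx]; field_simp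
    linarith
  -- At the last round the stopping condition bounds the average diameter by the number of cells.
  have hlast : score X δ (partition X δ ω 𝒳 I) ≤ (1 + Δ ^ 2) * (x * (2 : ℝ) ^ (k * I)) := by
    refine (hsc _).trans ?_
    have hlev : ((2 : ℝ) ^ listLevel (partition X δ ω 𝒳 I)) ≤ (2 : ℝ) ^ (k * I) := by
      rw [← Real.rpow_natCast]
      refine Real.rpow_le_rpow_of_exponent_le (by norm_num) ?_
      exact listLevel_le (by positivity) fun A hA => level_le_of_mem_partition I hk le_rfl hA
    have hdiam : avgDiam X (partition X δ ω 𝒳 I) ^ 2 ≤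
        Δ ^ 2 * (x * 2 ^ listLevel (partition X δ ω 𝒳 I)) := by
      by_cases h0 : avgDiam X (partition X δ ω 𝒳 I) = 0
      · rw [h0, zero_pow (by norm_num)]; positivity
      have h0' := lt_of_le_of_ne (avgDiam_nonneg _) (Ne.symm h0)
      have h1 := avgDiam_partition_sq_le hn hX hR I hfin le_rfl
      have hΔpos : 0 < Δ := by
        refine lt_of_le_of_ne hΔ0 fun h => ?_
        rw [← hΔ, ← h] at h1
        have : 0 < avgDiam X (partition X δ ω 𝒳 I) ^ 2 := by positivity
        linarith
      have h2 := hI.2.1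
      rw [StopCond, Real.logb_le_iff_le_rpow (by norm_num) (by positivity), Real.rpow_natCast,
        div_le_iff₀ (by positivity)] at h2
      rw [hx]
      calc avgDiam X (partition X δ ω 𝒳 I) ^ 2
          = (n * avgDiam X (partition X δ ω 𝒳 I) ^ 2) / n := by field_simp
        _ ≤ (2 ^ listLevel (partition X δ ω 𝒳 I) * (alpha n δ * Δ ^ 2)) / n := by gcongr
        _ = _ := by ring
    calc x * 2 ^ listLevel (partition X δ ω 𝒳 I) + avgDiam X (partition X δ ω 𝒳 I) ^ 2
        ≤ (1 + Δ ^ 2) * (x * 2 ^ listLevel (partition X δ ω 𝒳 I)) := by linarith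
      _ ≤ _ := by gcongr
  -- the number of rounds at which the two terms of the score balance
  set T : ℝ := -logb 2 x / (2 + k) with hT
  have hxpow : ∀ s : ℝ, x ^ s = (2 : ℝ) ^ (logb 2 x * s) := by
    intro s
    rw [Real.rpow_mul (by norm_num), Real.rpow_logb (by norm_num) (by norm_num) hx0]
  have hε : x ^ (2 / (2 + k)) = (2 : ℝ) ^ (-2 * T) := by
    rw [hxpow, hT]; congr 1; field_simp
  have hε2 : x ^ (2 / (2 + k)) = x * (2 : ℝ) ^ (k * T) := by
    nth_rewrite 2 [← Real.rpow_one x]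
    rw [hxpow, hxpow, ← Real.rpow_add (by norm_num)]
    congr 1
    rw [hT]; field_simp; ring
  have hε0 : 0 < x ^ (2 / (2 + k)) := Real.rpow_pos_of_pos hx0 _
  rcases le_or_gt (I : ℝ) T with hIT | hIT
  · refine hL.2.2.trans (hlast.trans ?_)
    calc (1 + Δ ^ 2) * (x * (2 : ℝ) ^ (k * I)) ≤ (1 + Δ ^ 2) * (x * (2 : ℝ) ^ (k * T)) := by
          gcongr
          norm_num
      _ = (1 + Δ ^ 2) * x ^ (2 / (2 + k)) := by rw [hε2]
      _ ≤ _ := by nlinarith [mul_nonneg (by positivity : 0 ≤ 1 + Δ ^ 2) hε0.le]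
  · refine hL.2.1.trans (hprev.trans ?_)
    have h1 : ((1 : ℝ) / 4) ^ (I - 1) ≤ 4 * x ^ (2 / (2 + k)) := by
      have h2 : ((1 : ℝ) / 4) ^ (I - 1) = (2 : ℝ) ^ (2 + -2 * (I : ℝ)) := by
        have : ((1 : ℝ) / 4) = (2 : ℝ) ^ (-2 : ℝ) := by
          rw [Real.rpow_neg (by norm_num)]; norm_num
        rw [this, ← Real.rpow_natCast, ← Real.rpow_mul (by norm_num), Nat.cast_sub hI.1]
        congr 1
        push_cast
        ring
      have h3 : (4 : ℝ) = (2 : ℝ) ^ (2 : ℝ) := by norm_num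
      rw [h2, hε, h3, ← Real.rpow_add (by norm_num)]
      exact Real.rpow_le_rpow_of_exponent_le (by norm_num) (by linarith)
    calc (1 + Δ ^ 2) * (1 / 4) ^ (I - 1) ≤ (1 + Δ ^ 2) * (4 * x ^ (2 / (2 + k))) := by gcongr
      _ = _ := by ring

end Stopping

/-! ### Mass of regions determined by few sample points -/

section Chernoff

open Real

variable {Z : Type*} [MeasurableSpace Z] (ν : Measure Z) [IsProbabilityMeasure ν]

open scoped Classical in
lemma integral_exp_neg_indicator_le {U : Set Z} (hU : MeasurableSet U) :
    ∫ z, exp (-(if z ∈ U then 1 else 0)) ∂ν ≤ exp (-(ν.real U / 2)) := by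
  -- The expectation is `1 - (1 - exp (-1)) p`, where `p` is the probability of `U`.
  have h1 : (fun z => exp (-(if z ∈ U then (1 : ℝ) else 0))) =
      fun z => 1 - (1 - exp (-1)) * U.indicator (fun _ => (1 : ℝ)) z := by
    funext z
    by_cases hz : z ∈ U <;> simp [hz]
  have hint : Integrable (U.indicator fun _ => (1 : ℝ)) ν := (integrable_const 1).indicator hU
  rw [h1, integral_sub (integrable_const _) (hint.const_mul _), integral_const_mul,
    integral_indicator_const _ hU]
  have h2 : exp (-1 : ℝ) ≤ 1 / 2 := by
    rw [Real.exp_neg, ← one_div]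
    exact one_div_le_one_div_of_le (by norm_num) (by linarith [Real.exp_one_gt_d9])
  have h3 := Real.add_one_le_exp (-(ν.real U / 2))
  have h4 : 0 ≤ ν.real U := measureReal_nonneg
  simp only [integral_const, probReal_univ, smul_eq_mul, mul_one]
  nlinarith

open scoped Classical in
/-- Chernoff bound: half of the expected number of points in `U` exceeds the number of points in `U`
by `ℓ` with probability at most `exp (-ℓ)`. -/
lemma pi_count_add_le {ι : Type*} [Fintype ι] {U : Set Z} (hU : MeasurableSet U) (ℓ : ℝ) :
    (Measure.pi fun _ : ι => ν) {b | (∑ i, if b i ∈ U then (1 : ℝ) else 0) + ℓ ≤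
      Fintype.card ι * ν.real U / 2} ≤ ENNReal.ofReal (exp (-ℓ)) := by
  set P := Measure.pi fun _ : ι => ν with hP
  set p := ν.real U with hp
  set m : ℝ := ((Fintype.card ι : ℕ) : ℝ) with hm
  set F : (ι → Z) → ℝ := fun b => ∏ i, exp (-(if b i ∈ U then (1 : ℝ) else 0)) with hF
  have hF0 : ∀ b, 0 ≤ F b := fun b => Finset.prod_nonneg fun i _ => (exp_pos _).le
  have hFm : Measurable F := by
    refine Finset.measurable_prod _ fun i _ => Real.measurable_exp.comp ?_
    refine Measurable.neg (Measurable.ite ?_ measurable_const measurable_const)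
    exact measurable_pi_apply i hU
  have hFi : Integrable F P := by
    refine Integrable.of_bound hFm.aestronglyMeasurable 1 (Filter.Eventually.of_forall fun b => ?_)
    rw [Real.norm_of_nonneg (hF0 b)]
    refine Finset.prod_le_one (fun i _ => (exp_pos _).le) fun i _ => ?_
    rw [Real.exp_le_one_iff]
    split_ifs <;> norm_num
  have hint : ∫ b, F b ∂P ≤ exp (-(m * p / 2)) := by
    rw [hF, hP, integral_fintype_prod_eq_pow (f := fun z => exp (-(if z ∈ U then (1 : ℝ) else 0)))]
    calc _ ≤ exp (-(p / 2)) ^ Fintype.card ι :=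
          pow_le_pow_left₀ (integral_nonneg fun _ => (exp_pos _).le)
            (integral_exp_neg_indicator_le ν hU) _
      _ = _ := by rw [← Real.exp_nat_mul]; congr 1; ring
  -- Markov for the exponential of minus the number of points in `U`
  have hmarkov := mul_meas_ge_le_integral_of_nonneg (μ := P) (Filter.Eventually.of_forall hF0) hFi
    (exp (ℓ - m * p / 2))
  have hset : {b | (∑ i, if b i ∈ U then (1 : ℝ) else 0) + ℓ ≤ m * p / 2} =
      {b | exp (ℓ - m * p / 2) ≤ F b} := by
    ext b
    simp only [Set.mem_ofPred_eq, hF, ← Real.exp_sum, Real.exp_le_exp, Finset.sum_neg_distrib]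
    constructor <;> intro h <;> linarith
  rw [hset, ← ENNReal.ofReal_toReal (measure_ne_top P _)]
  refine ENNReal.ofReal_le_ofReal ?_
  have h1 : exp (ℓ - m * p / 2) * (P {b | exp (ℓ - m * p / 2) ≤ F b}).toReal ≤
      exp (ℓ - m * p / 2) * exp (-ℓ) := by
    refine hmarkov.trans (hint.trans (le_of_eq ?_))
    rw [← Real.exp_add]; congr 1; ring
  exact le_of_mul_le_mul_left h1 (exp_pos _)

open scoped Classical in
/-- A random set determined by the sample points with index in `K` only is independent of the
others, so that a Chernoff bound applies to the latter. -/
lemma pi_count_add_le_of_dependsOn {n : ℕ} (K : Finset (Fin n)) (U : (Fin n → Z) → Set Z)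
    (hU : MeasurableSet {q : (Fin n → Z) × Z | q.2 ∈ U q.1})
    (hK : ∀ S S' : Fin n → Z, (∀ i ∈ K, S i = S' i) → U S = U S') (ℓ : ℝ) :
    (Measure.pi fun _ : Fin n => ν) {S | (∑ i, if S i ∈ U S then (1 : ℝ) else 0) + ℓ ≤
      ((n : ℝ) - K.card) * ν.real (U S) / 2} ≤ ENNReal.ofReal (exp (-ℓ)) := by
  set T : Set (Fin n → Z) := {S | (∑ i : {i // ¬ i ∈ K}, if S i ∈ U S then (1 : ℝ) else 0) + ℓ ≤
      ((n : ℝ) - K.card) * ν.real (U S) / 2} with hT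
  have hsub : {S | (∑ i, if S i ∈ U S then (1 : ℝ) else 0) + ℓ ≤
      ((n : ℝ) - K.card) * ν.real (U S) / 2} ⊆ T := by
    intro S hS
    refine le_trans (add_le_add_left ?_ ℓ) hS
    rw [← Finset.sum_subtype (Finset.univ.filter fun i => ¬ i ∈ K) (by simp)
      fun i => if S i ∈ U S then (1 : ℝ) else 0]
    exact Finset.sum_le_sum_of_subset_of_nonneg (Finset.filter_subset _ _)
      fun i _ _ => by split_ifs <;> norm_num
  have hslice : ∀ S, MeasurableSet (U S) := fun S => measurable_prodMk_left hU
  have hTm : MeasurableSet T := by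
    refine measurableSet_le ?_ ?_
    · refine Measurable.add_const (Finset.measurable_sum _ fun i _ => ?_) ℓ
      refine Measurable.ite ?_ measurable_const measurable_const
      exact (measurable_id.prodMk (measurable_pi_apply (i : Fin n))) hU
    · exact ((measurable_measure_prodMk_left hU).ennreal_toReal.const_mul _).div_const 2
  refine (measure_mono hsub).trans ?_
  -- Fix the coordinates `a` with index in `K`. The set `U` is then fixed as well.
  have hmp := (measurePreserving_piEquivPiSubtypeProd (fun _ : Fin n => ν) (fun i => i ∈ K)).symm
  rw [← hmp.measure_preimage hTm.nullMeasurableSet, Measure.prod_apply (hmp.measurable hTm)]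
  refine (lintegral_mono (g := fun _ => ENNReal.ofReal (exp (-ℓ))) fun a => ?_).trans (by simp)
  rcases Set.eq_empty_or_nonempty (Prod.mk a ⁻¹'
    ((MeasurableEquiv.piEquivPiSubtypeProd (fun _ : Fin n => Z) (fun i => i ∈ K)).symm ⁻¹' T))
    with h0 | ⟨b₀, -⟩
  · rw [h0]; simp
  set e := (MeasurableEquiv.piEquivPiSubtypeProd (fun _ : Fin n => Z) (fun i => i ∈ K)).symm with he
  set V := U (e (a, b₀)) with hV
  have hconst : ∀ b, U (e (a, b)) = V := by
    intro b
    refine hK _ _ fun i hi => ?_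
    simp [he, MeasurableEquiv.piEquivPiSubtypeProd, Equiv.piEquivPiSubtypeProd, hi]
  have hb : ∀ b (i : {i // ¬ i ∈ K}), e (a, b) i = b i := by
    intro b i
    have := i.2
    simp [he, MeasurableEquiv.piEquivPiSubtypeProd, Equiv.piEquivPiSubtypeProd, this]
  have hcard : ((n : ℝ) - K.card) = Fintype.card {i // ¬ i ∈ K} := by
    rw [Fintype.card_subtype_compl, Fintype.card_fin, Fintype.card_coe, Nat.cast_sub]
    exact (Finset.card_le_univ K).trans (by simp)
  refine le_trans (le_of_eq ?_) (pi_count_add_le (ι := {i // ¬ i ∈ K}) ν (hslice (e (a, b₀))) ℓ)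
  congr 1
  ext b
  simp only [Set.mem_preimage, hT, Set.mem_ofPred_eq, hb]
  rw [hconst b, hcard]

end Chernoff

/-! ### Regions given by sample points -/

section Regions

variable {D n L : ℕ} {ι : Type*}

/-- The open half-space with normal `v κ` and boundary through the sample point `X j`, on the side
given by the boolean; `none` encodes the absence of constraint. -/
def halfSpace (X : Fin n → E D) (v : ι → E D) : Option (ι × Bool × Fin n) → Set (E D)
  | none => Set.univ
  | some (κ, true, j) => {x | inner ℝ x (v κ) < inner ℝ (X j) (v κ)}
  | some (κ, false, j) => {x | inner ℝ (X j) (v κ) < inner ℝ x (v κ)}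

/-- The complement of the closed ball with center `X i` whose boundary contains `X j`. -/
def outside (X : Fin n → E D) : Option (Fin n × Fin n) → Set (E D)
  | none => Set.univ
  | some (i, j) => {x | dist (X j) (X i) < dist x (X i)}

/-- The polyhedron cut out by a family of half-spaces with sample points on their boundaries. -/
def polytope (X : Fin n → E D) (v : ι → E D) (c : Fin L → Option (ι × Bool × Fin n)) :
    Set (E D) := ⋂ s, halfSpace X v (c s)

/-- A polyhedron, possibly deprived of a ball. For given directions it is determined by at most
`L + 2` sample points. -/
def region (X : Fin n → E D) (v : ι → E D)
    (c : (Fin L → Option (ι × Bool × Fin n)) × Option (Fin n × Fin n)) : Set (E D) :=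
  polytope X v c.1 ∩ outside X c.2

/-- The index of the sample point that determines a half-space. -/
def halfSpacePoints : Option (ι × Bool × Fin n) → Finset (Fin n)
  | none => ∅
  | some (_, _, j) => {j}

/-- The indices of the sample points that determine a ball. -/
def outsidePoints : Option (Fin n × Fin n) → Finset (Fin n)
  | none => ∅
  | some (i, j) => {i, j}

/-- The indices of the sample points that determine a region. -/
def regionPoints (c : (Fin L → Option (ι × Bool × Fin n)) × Option (Fin n × Fin n)) :
    Finset (Fin n) :=
  (Finset.univ.biUnion fun s => halfSpacePoints (c.1 s)) ∪ outsidePoints c.2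

lemma card_regionPoints_le (c : (Fin L → Option (ι × Bool × Fin n)) × Option (Fin n × Fin n)) :
    (regionPoints c).card ≤ L + 2 := by
  refine (Finset.card_union_le _ _).trans (add_le_add ?_ ?_)
  · refine Finset.card_biUnion_le.trans ?_
    calc _ ≤ ∑ _s : Fin L, 1 := Finset.sum_le_sum fun s _ => by
          rcases c.1 s with _ | ⟨κ, b, j⟩ <;> simp [halfSpacePoints]
      _ = L := by simp
  · rcases c.2 with _ | ⟨i, j⟩
    · simp [outsidePoints]
    · exact Finset.card_le_two

lemma region_congr {X X' : Fin n → E D} {v : ι → E D}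
    {c : (Fin L → Option (ι × Bool × Fin n)) × Option (Fin n × Fin n)}
    (h : ∀ i ∈ regionPoints c, X i = X' i) : region X v c = region X' v c := by
  have h1 : ∀ s, halfSpace X v (c.1 s) = halfSpace X' v (c.1 s) := by
    intro s
    have hs : ∀ i ∈ halfSpacePoints (c.1 s), X i = X' i := fun i hi =>
      h i (Finset.mem_union_left _ (Finset.mem_biUnion.2 ⟨s, Finset.mem_univ _, hi⟩))
    rcases hc : c.1 s with _ | ⟨κ, b, j⟩
    · rfl
    · have := hs j (by simp [hc, halfSpacePoints])
      cases b <;> simp [halfSpace, this]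
  have h2 : outside X c.2 = outside X' c.2 := by
    have hs : ∀ i ∈ outsidePoints c.2, X i = X' i := fun i hi => h i (Finset.mem_union_right _ hi)
    rcases hc : c.2 with _ | ⟨i, j⟩
    · rfl
    · have h3 := hs i (by simp [hc, outsidePoints])
      have h4 := hs j (by simp [hc, outsidePoints])
      simp [outside, h3, h4]
  simp only [region, polytope, h1, h2]

variable {Ω : Type*} [MeasurableSpace Ω]

lemma measurableSet_polytope {X : Ω → Fin n → E D} {v : Ω → ι → E D} {x : Ω → E D}
    (hX : Measurable X) (hv : Measurable v) (hx : Measurable x)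
    (c : Fin L → Option (ι × Bool × Fin n)) :
    MeasurableSet {a | x a ∈ polytope (X a) (v a) c} := by
  have : {a | x a ∈ polytope (X a) (v a) c} = ⋂ s, {a | x a ∈ halfSpace (X a) (v a) (c s)} := by
    ext a; simp [polytope]
  rw [this]
  refine MeasurableSet.iInter fun s => ?_
  rcases c s with _ | ⟨κ, b, j⟩
  · simp [halfSpace]
  · have hvκ : Measurable fun a => v a κ := (measurable_pi_apply κ).comp hv
    have hXj : Measurable fun a => X a j := (measurable_pi_apply j).comp hX
    cases b
    · exact measurableSet_lt (hXj.inner (𝕜 := ℝ) hvκ) (hx.inner (𝕜 := ℝ) hvκ)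
    · exact measurableSet_lt (hx.inner (𝕜 := ℝ) hvκ) (hXj.inner (𝕜 := ℝ) hvκ)

lemma measurableSet_region {X : Ω → Fin n → E D} {v : Ω → ι → E D} {x : Ω → E D}
    (hX : Measurable X) (hv : Measurable v) (hx : Measurable x)
    (c : (Fin L → Option (ι × Bool × Fin n)) × Option (Fin n × Fin n)) :
    MeasurableSet {a | x a ∈ region (X a) (v a) c} := by
  refine (measurableSet_polytope hX hv hx c.1).inter ?_
  rcases c.2 with _ | ⟨i, j⟩
  · exact MeasurableSet.univ
  · have hXi : Measurable fun a => X a i := (measurable_pi_apply i).comp hX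
    have hXj : Measurable fun a => X a j := (measurable_pi_apply j).comp hX
    exact measurableSet_lt (hXj.dist hXi) (hx.dist hXi)

lemma card_indicesIn_eq_sum (X : Fin n → E D) (A : Set (E D)) [DecidablePred (· ∈ A)] :
    ((indicesIn X A).card : ℝ) = ∑ i, if X i ∈ A then (1 : ℝ) else 0 := by
  rw [Finset.sum_boole]
  congr 2
  ext i
  simp [mem_indicesIn]

/-- With high probability no region contains much more mass than sample points. -/
lemma pi_region_mass {D' : ℕ} (ρ : Measure (E D × E D')) [IsProbabilityMeasure ρ] (v : ι → E D)
    (c : (Fin L → Option (ι × Bool × Fin n)) × Option (Fin n × Fin n)) (ℓ : ℝ) :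
    (Measure.pi fun _ : Fin n => ρ) {S |
      ((indicesIn (fun i => (S i).1) (region (fun i => (S i).1) v c)).card : ℝ) + ℓ ≤
        ((n : ℝ) - (L + 2)) * ρ.real (Prod.fst ⁻¹' region (fun i => (S i).1) v c) / 2} ≤
      ENNReal.ofReal (Real.exp (-ℓ)) := by
  classical
  refine (measure_mono ?_).trans (pi_count_add_le_of_dependsOn ρ (regionPoints c)
    (fun S => Prod.fst ⁻¹' region (fun i => (S i).1) v c) ?_ ?_ ℓ)
  · intro S hS
    simp only [Set.mem_ofPred_eq, card_indicesIn_eq_sum, Set.mem_preimage] at hS ⊢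
    refine hS.trans ?_
    gcongr
    exact_mod_cast card_regionPoints_le c
  · refine measurableSet_region (X := fun q : (Fin n → E D × E D') × E D × E D' =>
      fun i => (q.1 i).1) ?_ measurable_const measurable_snd.fst c
    exact measurable_pi_lambda _ fun i => ((measurable_pi_apply i).comp measurable_fst).fst
  · intro S S' h
    rw [region_congr (X' := fun i => (S' i).1) fun i hi => by rw [h i hi]]

end Regions

/-! ### Concentration of sums of centered vectors -/

section Pinelis

open Real

lemma exp_sub_self_le {x : ℝ} (hx : 0 ≤ x) : exp x - x ≤ exp (x ^ 2) := by
  rcases le_or_gt x 1 with h1 | h1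
  · have h2 := (abs_le.1 (Real.abs_exp_sub_one_sub_id_le (x := x) (abs_le.2 ⟨by linarith, h1⟩))).2
    linarith [Real.add_one_le_exp (x ^ 2)]
  · have : exp x ≤ exp (x ^ 2) := Real.exp_le_exp.2 (by nlinarith)
    linarith

/-- `cosh` is a convex function of the square of its argument. -/
lemma cosh_le_of_sq_eq {x u v t : ℝ} (ht0 : 0 ≤ t) (ht1 : t ≤ 1)
    (h : x ^ 2 = t * u ^ 2 + (1 - t) * v ^ 2) : cosh x ≤ t * cosh u + (1 - t) * cosh v := by
  refine hasSum_le (fun k => ?_) (Real.hasSum_cosh x)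
    (((Real.hasSum_cosh u).mul_left t).add ((Real.hasSum_cosh v).mul_left (1 - t)))
  have h1 : (x ^ 2) ^ k ≤ t * (u ^ 2) ^ k + (1 - t) * (v ^ 2) ^ k := by
    have := (convexOn_pow k).2 (x := u ^ 2) (y := v ^ 2) (sq_nonneg u) (sq_nonneg v) ht0
      (by linarith : 0 ≤ 1 - t) (by ring)
    simpa [h] using this
  rw [pow_mul, pow_mul, pow_mul]
  have h2 : (0 : ℝ) < (2 * k).factorial := by positivity
  calc (x ^ 2) ^ k / (2 * k).factorial
      ≤ (t * (u ^ 2) ^ k + (1 - t) * (v ^ 2) ^ k) / (2 * k).factorial := by gcongr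
    _ = _ := by ring

lemma norm_sum_le_mul_card {V Z : Type*} [SeminormedAddCommGroup V] {ξ : Z → V} {M : ℝ} {n : ℕ}
    (hξM : ∀ z, ‖ξ z‖ ≤ M) (J : Finset (Fin n)) (S : Fin n → Z) :
    ‖∑ j ∈ J, ξ (S j)‖ ≤ J.card * M := by
  refine (norm_sum_le _ _).trans ?_
  calc _ ≤ ∑ _j ∈ J, M := Finset.sum_le_sum fun j _ => hξM _
    _ = J.card * M := by simp

lemma measurable_sum_comp {V Z : Type*} [AddCommMonoid V] [MeasurableSpace V] [MeasurableAdd₂ V]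
    [MeasurableSpace Z] {ξ : Z → V} {n : ℕ} (hξ : Measurable ξ) (J : Finset (Fin n)) :
    Measurable fun S : Fin n → Z => ∑ j ∈ J, ξ (S j) :=
  Finset.measurable_sum _ fun j _ => hξ.comp (measurable_pi_apply j)

variable {E' : Type*} [NormedAddCommGroup E'] [InnerProductSpace ℝ E']

/-- The gradient of `a ↦ cosh (s ‖a‖)`. -/
def coshGrad (s : ℝ) (a : E') : E' := (s * sinh (s * ‖a‖) / ‖a‖) • a

/-- Upper bound by an affine function of the increment `y`, which gives Pinelis' inequality by
integration. -/
lemma cosh_norm_add_le {s : ℝ} (hs : 0 ≤ s) (a y : E') :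
    cosh (s * ‖a + y‖) ≤ cosh (s * ‖a‖) * exp (s ^ 2 * ‖y‖ ^ 2) + inner ℝ (coshGrad s a) y := by
  rcases eq_or_ne a 0 with rfl | ha
  · simp only [zero_add, norm_zero, mul_zero, cosh_zero, one_mul, coshGrad, smul_zero,
      inner_zero_left, add_zero]
    refine (Real.cosh_le_exp_half_sq _).trans (Real.exp_le_exp.2 ?_)
    rw [mul_pow]
    have : 0 ≤ s ^ 2 * ‖y‖ ^ 2 := by positivity
    linarith
  rcases eq_or_ne y 0 with rfl | hy
  · simp
  have hr : 0 < ‖a‖ := norm_pos_iff.2 ha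
  have hm : 0 < ‖y‖ := norm_pos_iff.2 hy
  set r := ‖a‖ with hrdef
  set m := ‖y‖ with hmdef
  set c : ℝ := inner ℝ a y / (r * m) with hc
  have hip : (inner ℝ a y : ℝ) = c * (r * m) := by rw [hc]; field_simp
  have hc1 : |c| ≤ 1 := by
    rw [hc, abs_div, abs_of_pos (mul_pos hr hm), div_le_one (by positivity)]
    exact abs_real_inner_le_norm a y
  rw [abs_le] at hc1
  -- By the law of cosines `‖a + y‖ ^ 2` is a convex combination of `(r + m) ^ 2` and
  -- `(r - m) ^ 2`.
  have hnorm : (s * ‖a + y‖) ^ 2 =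
      (1 + c) / 2 * (s * r + s * m) ^ 2 + (1 - (1 + c) / 2) * (s * r - s * m) ^ 2 := by
    rw [mul_pow, norm_add_sq_real, hip]; ring
  have h1 := cosh_le_of_sq_eq (by linarith) (by linarith) hnorm
  rw [Real.cosh_add, Real.cosh_sub] at h1
  have hsm : 0 ≤ s * m := by positivity
  have hsr : 0 ≤ s * r := by positivity
  have h2 : s * m ≤ sinh (s * m) := Real.self_le_sinh_iff.2 hsm
  have h3 : c * sinh (s * r) ≤ cosh (s * r) := by
    have h4 : 0 ≤ sinh (s * r) := Real.sinh_nonneg_iff.2 hsr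
    have h5 := Real.sinh_lt_cosh (x := s * r)
    nlinarith
  have h4 : c * sinh (s * r) * (sinh (s * m) - s * m) ≤
      cosh (s * r) * (sinh (s * m) - s * m) :=
    mul_le_mul_of_nonneg_right h3 (by linarith)
  have h5 := exp_sub_self_le hsm
  rw [← Real.cosh_add_sinh] at h5
  have h6 : cosh (s * r) * (cosh (s * m) + sinh (s * m) - s * m) ≤
      cosh (s * r) * exp (s ^ 2 * m ^ 2) := by
    rw [← mul_pow]
    exact mul_le_mul_of_nonneg_left h5 (Real.cosh_pos _).le
  have h7 : (inner ℝ (coshGrad s a) y : ℝ) = c * sinh (s * r) * (s * m) := by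
    rw [coshGrad, ← hrdef, real_inner_smul_left, hip]
    field_simp
  rw [h7]
  linarith

lemma norm_coshGrad_le {s : ℝ} (hs : 0 ≤ s) (a : E') : ‖coshGrad s a‖ ≤ s * sinh (s * ‖a‖) := by
  have h0 : 0 ≤ sinh (s * ‖a‖) := Real.sinh_nonneg_iff.2 (by positivity)
  rcases eq_or_ne a 0 with rfl | ha
  · simp [coshGrad]
  · have : ‖a‖ ≠ 0 := norm_ne_zero_iff.2 ha
    rw [coshGrad, norm_smul, Real.norm_of_nonneg (by positivity), div_mul_cancel₀ _ this]

variable [MeasurableSpace E'] [BorelSpace E'] [SecondCountableTopology E']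
  {𝒜 ℬ : Type*} [MeasurableSpace 𝒜] [MeasurableSpace ℬ] {ρ : Measure (𝒜 × ℬ)}
  [IsProbabilityMeasure ρ] {ξ : 𝒜 × ℬ → E'} {M : ℝ}

lemma measurable_coshGrad (s : ℝ) : Measurable (coshGrad s : E' → E') := by
  unfold coshGrad
  refine Measurable.smul ?_ measurable_id
  have : Measurable (sinh : ℝ → ℝ) := Real.continuous_sinh.measurable
  exact ((this.comp (measurable_norm.const_mul s)).const_mul s).div measurable_norm

variable [CompleteSpace E']

/-- If `ξ` is centered given the first coordinate, the increment in one variable integrates to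
zero on every event that depends on the first coordinates only. -/
lemma setIntegral_inner_coshGrad_eq_zero {n : ℕ} (hξ : Measurable ξ) (hξM : ∀ z, ‖ξ z‖ ≤ M)
    (hξ0 : ∀ T : Set 𝒜, MeasurableSet T → ∫ z in Prod.fst ⁻¹' T, ξ z ∂ρ = 0) (s : ℝ) (hs : 0 ≤ s)
    {B : Set (Fin n → 𝒜)} (hB : MeasurableSet B) (J : Finset (Fin n)) {i : Fin n} (hi : i ∉ J) :
    ∫ S in {S : Fin n → 𝒜 × ℬ | (fun j => (S j).1) ∈ B},
      inner ℝ (coshGrad s (∑ j ∈ J, ξ (S j))) (ξ (S i)) ∂(Measure.pi fun _ => ρ) = 0 := by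
  -- Integrate with respect to the coordinate `i` first, the other coordinates being fixed.
  obtain ⟨m, rfl⟩ : ∃ m, n = m + 1 := ⟨n - 1, by have := i.pos; omega⟩
  have hfst : Measurable fun S : Fin (m + 1) → 𝒜 × ℬ => fun j => (S j).1 :=
    measurable_pi_lambda _ fun j => (measurable_pi_apply j).fst
  set G : Set (Fin (m + 1) → 𝒜 × ℬ) := {S | (fun j => (S j).1) ∈ B} with hG
  have hGm : MeasurableSet G := hfst hB
  set F : (Fin (m + 1) → 𝒜 × ℬ) → ℝ :=
    fun S => inner ℝ (coshGrad s (∑ j ∈ J, ξ (S j))) (ξ (S i)) with hF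
  have hFm : Measurable F := ((measurable_coshGrad s).comp (measurable_sum_comp hξ J)).inner
    (hξ.comp (measurable_pi_apply i))
  have hM0 : 0 ≤ M := by
    have : Nonempty (𝒜 × ℬ) := ρ.nonempty_of_neZero
    exact (norm_nonneg _).trans (hξM (Classical.arbitrary _))
  have hFb : ∀ S, ‖F S‖ ≤ s * sinh (s * (J.card * M)) * M := by
    intro S
    refine (norm_inner_le_norm _ _).trans ?_
    have h1 := norm_coshGrad_le hs (∑ j ∈ J, ξ (S j))
    have h2 : sinh (s * ‖∑ j ∈ J, ξ (S j)‖) ≤ sinh (s * (J.card * M)) :=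
      Real.sinh_le_sinh.2 (mul_le_mul_of_nonneg_left (norm_sum_le_mul_card hξM J S) hs)
    have h3 : 0 ≤ sinh (s * (J.card * M)) := Real.sinh_nonneg_iff.2 (by positivity)
    calc _ ≤ (s * sinh (s * (J.card * M))) * M := by
          refine mul_le_mul (h1.trans ?_) (hξM _) (norm_nonneg _) (by positivity)
          exact mul_le_mul_of_nonneg_left h2 hs
      _ = _ := rfl
  have hInt : Integrable (G.indicator F) (Measure.pi fun _ : Fin (m + 1) => ρ) :=
    (Integrable.of_bound hFm.aestronglyMeasurable _ (Filter.Eventually.of_forall hFb)).indicator hGm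
  rw [← integral_indicator hGm]
  have hmp := (measurePreserving_piFinSuccAbove (fun _ : Fin (m + 1) => ρ) i).symm
  rw [← hmp.integral_comp', integral_prod_symm]
  · refine (integral_congr_ae (g := fun _ => (0 : ℝ))
      (Filter.Eventually.of_forall fun R => ?_)).trans (by simp)
    obtain ⟨z₀⟩ : Nonempty (𝒜 × ℬ) := ρ.nonempty_of_neZero
    set T : Set 𝒜 := {x | i.insertNth x (fun j => (R j).1) ∈ B} with hT
    have hTm : MeasurableSet T := by
      have : Measurable fun x : 𝒜 => (i.insertNth x (fun j => (R j).1) : Fin (m + 1) → 𝒜) := by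
        refine measurable_pi_lambda _ fun j => ?_
        refine Fin.succAboveCases i ?_ (fun l => ?_) j
        · simpa using measurable_id'
        · simp
      exact this hB
    set a : E' := coshGrad s (∑ j ∈ J, ξ ((i.insertNth z₀ R : Fin (m + 1) → 𝒜 × ℬ) j)) with ha
    have hcongr : ∀ z : 𝒜 × ℬ, G.indicator F (i.insertNth z R) =
        (Prod.fst ⁻¹' T).indicator (fun z => inner ℝ a (ξ z)) z := by
      intro z
      have h1 : (fun j => ((i.insertNth z R : Fin (m + 1) → 𝒜 × ℬ) j).1) =
          i.insertNth z.1 (fun j => (R j).1) := by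
        funext j
        refine Fin.succAboveCases i ?_ (fun l => ?_) j <;> simp
      have h2 : F (i.insertNth z R) = inner ℝ a (ξ z) := by
        simp only [hF, ha, Fin.insertNth_apply_same]
        congr 2
        refine Finset.sum_congr rfl fun j hj => ?_
        obtain ⟨l, rfl⟩ := Fin.exists_succAbove_eq (x := j) (y := i) (fun h => hi (h ▸ hj))
        rw [Fin.insertNth_apply_succAbove, Fin.insertNth_apply_succAbove]
      have hmem : (i.insertNth z R : Fin (m + 1) → 𝒜 × ℬ) ∈ G ↔ z ∈ Prod.fst ⁻¹' T := by
        change (fun j => ((i.insertNth z R : Fin (m + 1) → 𝒜 × ℬ) j).1) ∈ B ↔ _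
        rw [h1]; rfl
      by_cases hz : z ∈ Prod.fst ⁻¹' T
      · rw [Set.indicator_of_mem (hmem.2 hz), Set.indicator_of_mem hz, h2]
      · rw [Set.indicator_of_notMem (fun h => hz (hmem.1 h)), Set.indicator_of_notMem hz]
    change ∫ z, G.indicator F (i.insertNth z R) ∂ρ = 0
    simp only [hcongr]
    rw [integral_indicator (measurable_fst hTm), integral_inner, hξ0 T hTm, inner_zero_right]
    exact (Integrable.of_bound hξ.aestronglyMeasurable M
      (Filter.Eventually.of_forall hξM)).integrableOn
  · exact hmp.integrable_comp_of_integrable hInt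

/-- Exponential moment of the norm of a sum of centered vectors, on an event that depends on the
first coordinates only. -/
lemma setIntegral_cosh_norm_sum_le {n : ℕ} (hξ : Measurable ξ) (hξM : ∀ z, ‖ξ z‖ ≤ M)
    (hξ0 : ∀ T : Set 𝒜, MeasurableSet T → ∫ z in Prod.fst ⁻¹' T, ξ z ∂ρ = 0) (s : ℝ) (hs : 0 ≤ s)
    {B : Set (Fin n → 𝒜)} (hB : MeasurableSet B) (J : Finset (Fin n)) :
    ∫ S in {S : Fin n → 𝒜 × ℬ | (fun j => (S j).1) ∈ B}, cosh (s * ‖∑ j ∈ J, ξ (S j)‖)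
      ∂(Measure.pi fun _ => ρ) ≤ exp (s ^ 2 * M ^ 2 * J.card) *
        (Measure.pi fun _ : Fin n => ρ).real {S | (fun j => (S j).1) ∈ B} := by
  classical
  set P := Measure.pi fun _ : Fin n => ρ with hP
  set G : Set (Fin n → 𝒜 × ℬ) := {S | (fun j => (S j).1) ∈ B} with hG
  have hcint : ∀ J : Finset (Fin n), Integrable (fun S => cosh (s * ‖∑ j ∈ J, ξ (S j)‖))
      (P.restrict G) := by
    intro J
    refine Integrable.of_bound (Real.continuous_cosh.measurable.comp
      ((measurable_sum_comp hξ J).norm.const_mul s)).aestronglyMeasurable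
      (cosh (s * (J.card * M))) (Filter.Eventually.of_forall fun S => ?_)
    rw [Real.norm_of_nonneg (Real.cosh_pos _).le, Real.cosh_le_cosh]
    have h := norm_sum_le_mul_card hξM J S
    rw [abs_of_nonneg (by positivity)]
    exact (mul_le_mul_of_nonneg_left h hs).trans (le_abs_self _)
  induction J using Finset.induction_on with
  | empty => simp
  | insert i J hi ih =>
    have hzero := setIntegral_inner_coshGrad_eq_zero (ρ := ρ) hξ hξM hξ0 s hs hB J hi
    have hgint : Integrable (fun S : Fin n → 𝒜 × ℬ =>
        (inner ℝ (coshGrad s (∑ j ∈ J, ξ (S j))) (ξ (S i)) : ℝ)) (P.restrict G) := by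
      refine Integrable.of_bound (((measurable_coshGrad s).comp (measurable_sum_comp hξ J)).inner
        (hξ.comp (measurable_pi_apply i))).aestronglyMeasurable
        (s * sinh (s * (J.card * M)) * M) (Filter.Eventually.of_forall fun S => ?_)
      refine (norm_inner_le_norm _ _).trans ?_
      have h0 : 0 ≤ (J.card : ℝ) * M := (norm_nonneg _).trans (norm_sum_le_mul_card hξM J S)
      have h3 : 0 ≤ sinh (s * (J.card * M)) := Real.sinh_nonneg_iff.2 (by positivity)
      refine mul_le_mul ((norm_coshGrad_le hs _).trans ?_) (hξM _) (norm_nonneg _) (by positivity)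
      exact mul_le_mul_of_nonneg_left (Real.sinh_le_sinh.2
        (mul_le_mul_of_nonneg_left (norm_sum_le_mul_card hξM J S) hs)) hs
    calc ∫ S in G, cosh (s * ‖∑ j ∈ insert i J, ξ (S j)‖) ∂P
        ≤ ∫ S in G, (exp (s ^ 2 * M ^ 2) * cosh (s * ‖∑ j ∈ J, ξ (S j)‖) +
            inner ℝ (coshGrad s (∑ j ∈ J, ξ (S j))) (ξ (S i))) ∂P := by
          refine integral_mono (hcint _) (((hcint J).const_mul _).add hgint) fun S => ?_
          dsimp only
          rw [Finset.sum_insert hi, add_comm (ξ (S i))]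
          refine (cosh_norm_add_le hs _ _).trans ?_
          rw [mul_comm]
          gcongr
          exact hξM _
      _ = exp (s ^ 2 * M ^ 2) * ∫ S in G, cosh (s * ‖∑ j ∈ J, ξ (S j)‖) ∂P := by
          rw [integral_add ((hcint J).const_mul _) hgint, hzero, add_zero, integral_const_mul]
      _ ≤ exp (s ^ 2 * M ^ 2) * (exp (s ^ 2 * M ^ 2 * J.card) * P.real G) := by gcongr
      _ = exp (s ^ 2 * M ^ 2 * (insert i J).card) * P.real G := by
          rw [Finset.card_insert_of_notMem hi, ← mul_assoc, ← Real.exp_add]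
          congr 2
          push_cast
          ring

/-- Deviation of the sum over a random set of indices that depends on the first coordinates
only. -/
lemma pi_norm_sum_gt_le {n : ℕ} (hξ : Measurable ξ) (hξM : ∀ z, ‖ξ z‖ ≤ M)
    (hξ0 : ∀ T : Set 𝒜, MeasurableSet T → ∫ z in Prod.fst ⁻¹' T, ξ z ∂ρ = 0)
    (J : (Fin n → 𝒜) → Finset (Fin n)) (hJ : MeasurableFibers J) {ℓ : ℝ} (hℓ : 0 ≤ ℓ) :
    (Measure.pi fun _ : Fin n => ρ) {S | 4 * M ^ 2 * ℓ * (J fun i => (S i).1).card <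
      ‖∑ j ∈ J fun i => (S i).1, ξ (S j)‖ ^ 2} ≤ ENNReal.ofReal (2 * exp (-ℓ)) := by
  classical
  set P := Measure.pi fun _ : Fin n => ρ with hP
  have hM0 : 0 ≤ M := by
    have : Nonempty (𝒜 × ℬ) := ρ.nonempty_of_neZero
    exact (norm_nonneg _).trans (hξM (Classical.arbitrary _))
  set G : Finset (Fin n) → Set (Fin n → 𝒜 × ℬ) := fun K => {S | J (fun i => (S i).1) = K} with hG
  have hfst : Measurable fun S : Fin n → 𝒜 × ℬ => fun j => (S j).1 :=
    measurable_pi_lambda _ fun j => (measurable_pi_apply j).fst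
  have hGm : ∀ K, MeasurableSet (G K) := fun K => hfst (hJ K)
  set dev : Finset (Fin n) → Set (Fin n → 𝒜 × ℬ) :=
    fun K => {S | 4 * M ^ 2 * ℓ * K.card < ‖∑ j ∈ K, ξ (S j)‖ ^ 2} with hdev
  have key : ∀ K, P (G K ∩ dev K) ≤ ENNReal.ofReal (2 * exp (-ℓ)) * P (G K) := by
    intro K
    -- If `M * K.card = 0` the sum vanishes, and the choice of `s` below would not make sense.
    by_cases hdeg : M * K.card = 0
    · have : dev K = ∅ := by
        ext S
        simp only [hdev, Set.mem_ofPred_eq, Set.mem_empty_iff_false, iff_false, not_lt]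
        have h1 := norm_sum_le_mul_card hξM K S
        rw [mul_comm, hdeg] at h1
        have h2 : ‖∑ j ∈ K, ξ (S j)‖ = 0 := le_antisymm h1 (norm_nonneg _)
        rw [h2, zero_pow (by norm_num)]
        positivity
      rw [this]; simp
    have hMpos : 0 < M := lt_of_le_of_ne hM0 fun h => hdeg (by rw [← h, zero_mul])
    have hKpos : (0 : ℝ) < K.card := lt_of_le_of_ne (Nat.cast_nonneg _)
      fun h => hdeg (by rw [← h, mul_zero])
    -- the value of `s` that optimizes the bound from Markov
    set s := √(ℓ / K.card) / M with hs
    have hs0 : 0 ≤ s := by positivity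
    have hs2 : s ^ 2 * M ^ 2 * K.card = ℓ := by
      rw [hs, div_pow, Real.sq_sqrt (by positivity)]
      field_simp
    have hE := setIntegral_cosh_norm_sum_le (ρ := ρ) hξ hξM hξ0 s hs0 (hJ K) K
    rw [hs2] at hE
    have hcosh : ∀ S ∈ dev K, exp (2 * ℓ) / 2 ≤ cosh (s * ‖∑ j ∈ K, ξ (S j)‖) := by
      intro S hS
      have h1 : 2 * ℓ ≤ s * ‖∑ j ∈ K, ξ (S j)‖ := by
        refine le_of_sq_le_sq ?_ (by positivity)
        calc (2 * ℓ) ^ 2 = s ^ 2 * (4 * M ^ 2 * ℓ * K.card) := by rw [← hs2]; ring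
          _ ≤ s ^ 2 * ‖∑ j ∈ K, ξ (S j)‖ ^ 2 := by
              have : 4 * M ^ 2 * ℓ * K.card < ‖∑ j ∈ K, ξ (S j)‖ ^ 2 := hS
              gcongr
          _ = _ := by ring
      have h2 := Real.exp_le_exp.2 h1
      rw [Real.cosh_eq]
      have := exp_pos (-(s * ‖∑ j ∈ K, ξ (S j)‖))
      linarith
    have hcm : Measurable fun S : Fin n → 𝒜 × ℬ => cosh (s * ‖∑ j ∈ K, ξ (S j)‖) :=
      Real.continuous_cosh.measurable.comp ((measurable_sum_comp hξ K).norm.const_mul s)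
    have hci : Integrable (fun S : Fin n → 𝒜 × ℬ => cosh (s * ‖∑ j ∈ K, ξ (S j)‖))
        (P.restrict (G K)) := by
      refine Integrable.of_bound hcm.aestronglyMeasurable
        (cosh (s * (K.card * M))) (Filter.Eventually.of_forall fun S => ?_)
      rw [Real.norm_of_nonneg (Real.cosh_pos _).le, Real.cosh_le_cosh]
      have h := norm_sum_le_mul_card hξM K S
      rw [abs_of_nonneg (by positivity)]
      exact (mul_le_mul_of_nonneg_left h hs0).trans (le_abs_self _)
    have hmarkov := mul_meas_ge_le_integral_of_nonneg (μ := P.restrict (G K))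
      (Filter.Eventually.of_forall fun S => (Real.cosh_pos (s * ‖∑ j ∈ K, ξ (S j)‖)).le) hci
      (exp (2 * ℓ) / 2)
    have h1 : (P.restrict (G K)).real {S | exp (2 * ℓ) / 2 ≤ cosh (s * ‖∑ j ∈ K, ξ (S j)‖)} ≤
        2 * exp (-ℓ) * P.real (G K) := by
      have h2 := hmarkov.trans hE
      have h3 : exp (2 * ℓ) / 2 * (2 * exp (-ℓ) * P.real (G K)) = exp ℓ * P.real (G K) := by
        have : exp (2 * ℓ) * exp (-ℓ) = exp ℓ := by rw [← Real.exp_add]; congr 1; ring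
        rw [← this]; ring
      refine le_of_mul_le_mul_left (h2.trans ?_) (by positivity : 0 < exp (2 * ℓ) / 2)
      exact h3.ge
    calc P (G K ∩ dev K)
        ≤ (P.restrict (G K)) {S | exp (2 * ℓ) / 2 ≤ cosh (s * ‖∑ j ∈ K, ξ (S j)‖)} := by
          rw [Measure.restrict_apply (measurableSet_le measurable_const hcm)]
          exact measure_mono fun S hS => ⟨hcosh S hS.2, hS.1⟩
      _ ≤ ENNReal.ofReal (2 * exp (-ℓ)) * P (G K) := by
          rw [← ENNReal.ofReal_toReal (measure_ne_top (P.restrict (G K)) _),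
            ← ENNReal.ofReal_toReal (measure_ne_top P (G K)),
            ← ENNReal.ofReal_mul (by positivity)]
          exact ENNReal.ofReal_le_ofReal h1
  have hsub : {S : Fin n → 𝒜 × ℬ | 4 * M ^ 2 * ℓ * (J fun i => (S i).1).card <
      ‖∑ j ∈ J fun i => (S i).1, ξ (S j)‖ ^ 2} ⊆ ⋃ K, G K ∩ dev K := by
    intro S hS
    exact Set.mem_iUnion.2 ⟨J fun i => (S i).1, rfl, hS⟩
  have hsum : ∑ K, P (G K) = 1 := by
    rw [← tsum_fintype (L := .unconditional _), ← measure_iUnion _ hGm]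
    · have : ⋃ K, G K = Set.univ := Set.eq_univ_of_forall fun S => Set.mem_iUnion.2 ⟨_, rfl⟩
      rw [this, measure_univ]
    · intro K K' hKK'
      exact Set.disjoint_left.2 fun S h h' => hKK' (Eq.trans (Eq.symm h) h')
  calc P _ ≤ ∑ K, P (G K ∩ dev K) := (measure_mono hsub).trans (measure_iUnion_fintype_le _ _)
    _ ≤ ∑ K, ENNReal.ofReal (2 * exp (-ℓ)) * P (G K) := Finset.sum_le_sum fun K _ => key K
    _ = _ := by rw [← Finset.mul_sum, hsum, mul_one]

end Pinelis

/-! ### Cells as traces of polyhedra -/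

section Cells

variable {D n : ℕ} {X : Fin n → E D} {δ : ℝ} {ω : Draws D} {𝒳 : Set (E D)}

/-- The closed half-space `xᵀ v ≤ t` or its complement. -/
def splitSide (v : E D) (b : Bool) (t : ℝ) : Set (E D) :=
  if b then {x | inner ℝ x v ≤ t} else {x | t < inner ℝ x v}

lemma exists_splitSides_of_mem_basicLeaves {A₀ A : Node D} {w : ℕ → E D × ℝ} {k : ℕ}
    (hA : A ∈ basicLeaves X A₀ w k) : ∃ cs : List (ℕ × Bool × ℝ), cs.length = k ∧
      (∀ s ∈ cs, s.1 ≤ k) ∧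
      A.cell = {x ∈ A₀.cell | ∀ s ∈ cs, x ∈ splitSide (w s.1).1 s.2.1 s.2.2} := by
  induction k generalizing A with
  | zero =>
    simp only [basicLeaves, List.mem_singleton] at hA
    exact ⟨[], rfl, by simp, by simp [hA]⟩
  | succ k ih =>
    simp only [basicLeaves, List.mem_flatMap] at hA
    obtain ⟨B, hB, hAB⟩ := hA
    obtain ⟨cs, hlen, hle, hcell⟩ := ih hB
    set t := threshold X A₀ (k + 1) (w (k + 1)) B with ht
    obtain ⟨b, hb⟩ : ∃ b, A.cell = B.cell ∩ splitSide (w (k + 1)).1 b t := by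
      rcases mem_children hAB with rfl | rfl
      · exact ⟨true, by ext x; simp [splitSide]⟩
      · exact ⟨false, by ext x; simp +contextual [splitSide]⟩
    refine ⟨(k + 1, b, t) :: cs, by simp [hlen], ?_, ?_⟩
    · rintro s hs
      rcases List.mem_cons.1 hs with rfl | hs
      · exact le_rfl
      · exact (hle s hs).trans (Nat.le_succ k)
    · rw [hb, hcell]
      ext x
      simp only [Set.mem_inter_iff, Set.mem_ofPred_eq, List.mem_cons, forall_eq_or_imp]
      tauto

/-- A cell is the part of `𝒳` on the prescribed sides of the splits on the path from the root. -/
lemma exists_splitSides_of_mem_partition (hR : 0 < numRuns n δ) {i : ℕ} {A : Node D}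
    (hA : A ∈ partition X δ ω 𝒳 i) : ∃ cs : List ((List Bool × ℕ × ℕ) × Bool × ℝ),
      cs.length = A.level ∧
      (∀ s ∈ cs, s.1.1.length ≤ A.level ∧ s.1.2.1 < numRuns n δ ∧ s.1.2.2 ≤ A.level) ∧
      A.cell = {x ∈ 𝒳 | ∀ s ∈ cs, x ∈ splitSide (ω s.1).1 s.2.1 s.2.2} := by
  induction i generalizing A with
  | zero =>
    simp only [partition, List.mem_singleton] at hA
    exact ⟨[], by simp [hA, Node.level], by simp, by simp [hA]⟩
  | succ i ih =>
    simp only [partition, List.mem_flatMap] at hA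
    obtain ⟨B, hB, hAB⟩ := hA
    obtain ⟨cs, hlen, hle, hcell⟩ := ih hB
    obtain ⟨cs', hlen', hle', hcell'⟩ := exists_splitSides_of_mem_basicLeaves hAB
    have hlev := level_of_mem_basicLeaves hAB
    refine ⟨cs ++ cs'.map fun s => ((B.path, coreRun X δ ω B, s.1), s.2), ?_, ?_, ?_⟩
    · simp [hlen, hlen', hlev]
    · intro s hs
      rcases List.mem_append.1 hs with hs | hs
      · obtain ⟨h1, h2, h3⟩ := hle s hs
        exact ⟨by omega, h2, by omega⟩
      · obtain ⟨s', hs', rfl⟩ := List.mem_map.1 hs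
        have h1 := hle' s' hs'
        refine ⟨?_, (coreRun_spec hR B).1, ?_⟩
        · change B.level ≤ A.level
          omega
        · change s'.1 ≤ A.level
          omega
    · rw [hcell', hcell]
      ext x
      simp only [Set.mem_ofPred_eq, List.mem_append, List.mem_map]
      constructor
      · rintro ⟨⟨h1, h2⟩, h3⟩
        refine ⟨h1, ?_⟩
        rintro s (hs | ⟨s', hs', rfl⟩)
        · exact h2 s hs
        · exact h3 s' hs'
      · rintro ⟨h1, h2⟩
        exact ⟨⟨h1, fun s hs => h2 s (Or.inl hs)⟩, fun s hs => h2 _ (Or.inr ⟨s, hs, rfl⟩)⟩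

/-- A half-space may be enlarged until it has a sample point on its boundary without catching a
new sample point. -/
lemma exists_halfSpace {ι : Type*} (v : ι → E D) (κ : ι) (b : Bool) (t : ℝ) :
    ∃ o : Option (ι × Bool × Fin n), splitSide (v κ) b t ⊆ halfSpace X v o ∧
      ∀ i, X i ∈ halfSpace X v o → X i ∈ splitSide (v κ) b t := by
  classical
  rcases b with _ | _
  · by_cases h : ∃ i, inner ℝ (X i) (v κ) ≤ t
    · obtain ⟨j, hj, hmax⟩ := Finset.exists_max_image
        (Finset.univ.filter fun i => inner ℝ (X i) (v κ) ≤ t) (fun i => inner ℝ (X i) (v κ))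
        (h.imp fun i hi => by simpa using hi)
      simp only [Finset.mem_filter, Finset.mem_univ, true_and] at hj hmax
      refine ⟨some (κ, false, j), fun x hx => ?_, fun i hi => ?_⟩
      · simp only [splitSide, Bool.false_eq_true, if_false, Set.mem_ofPred_eq, halfSpace] at hx ⊢
        linarith
      · simp only [splitSide, Bool.false_eq_true, if_false, Set.mem_ofPred_eq, halfSpace] at hi ⊢
        by_contra hc
        linarith [hmax i (not_lt.1 hc)]
    · push Not at h
      exact ⟨none, Set.subset_univ _, fun i _ => by simpa [splitSide] using h i⟩
  · by_cases h : ∃ i, t < inner ℝ (X i) (v κ)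
    · obtain ⟨j, hj, hmin⟩ := Finset.exists_min_image
        (Finset.univ.filter fun i => t < inner ℝ (X i) (v κ)) (fun i => inner ℝ (X i) (v κ))
        (h.imp fun i hi => by simpa using hi)
      simp only [Finset.mem_filter, Finset.mem_univ, true_and] at hj hmin
      refine ⟨some (κ, true, j), fun x hx => ?_, fun i hi => ?_⟩
      · simp only [splitSide, if_true, Set.mem_ofPred_eq, halfSpace] at hx ⊢
        linarith
      · simp only [splitSide, if_true, Set.mem_ofPred_eq, halfSpace] at hi ⊢
        by_contra hc
        linarith [hmin i (not_le.1 hc)]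
    · push Not at h
      exact ⟨none, Set.subset_univ _, fun i _ => by simpa [splitSide] using h i⟩

/-- Indices of the directions that can be used by splits on the path to a cell of level at most
`L`: node at which the core procedure was called, run, iteration. -/
abbrev DirIdx (L R : ℕ) := (Σ l : Fin (L + 1), List.Vector Bool l) × Fin R × Fin (L + 1)

/-- The direction with a given index. -/
def drawnDirs (L R : ℕ) (ω : Draws D) (κ : DirIdx L R) : E D :=
  (ω (κ.1.2.toList, κ.2.1, κ.2.2)).1

lemma measurable_drawnDirs (L R : ℕ) : Measurable (drawnDirs L R : Draws D → DirIdx L R → E D) :=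
  measurable_pi_lambda _ fun _ => (measurable_pi_apply _).fst

lemma card_dirIdx_le (L R : ℕ) : Fintype.card (DirIdx L R) ≤ 2 ^ (L + 1) * (R * (L + 1)) := by
  rw [Fintype.card_prod, Fintype.card_prod, Fintype.card_fin, Fintype.card_fin, Fintype.card_sigma]
  refine Nat.mul_le_mul_right _ ?_
  simp only [card_vector, Fintype.card_bool]
  rw [Fin.sum_univ_eq_sum_range (fun l => 2 ^ l), Nat.geomSum_eq le_rfl]
  simp

/-- A cell is contained in a polyhedron with sample points on its faces and with the same sample
points. -/
lemma exists_polytope (hR : 0 < numRuns n δ) (hX : ∀ i, X i ∈ 𝒳) {i L : ℕ} {A : Node D}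
    (hA : A ∈ partition X δ ω 𝒳 i) (hL : A.level ≤ L) :
    ∃ c : Fin L → Option (DirIdx L (numRuns n δ) × Bool × Fin n),
      A.cell ⊆ polytope X (drawnDirs L _ ω) c ∧
      indicesIn X (polytope X (drawnDirs L _ ω) c) = indicesIn X A.cell := by
  obtain ⟨cs, hlen, hle, hcell⟩ := exists_splitSides_of_mem_partition hR hA
  have hκ : ∀ s ∈ cs, ∃ κ : DirIdx L (numRuns n δ), drawnDirs L _ ω κ = (ω s.1).1 := by
    rintro ⟨⟨p, j, i⟩, b, t⟩ hs
    obtain ⟨h1, h2, h3⟩ := hle _ hs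
    dsimp only at h1 h2 h3
    exact ⟨(⟨⟨p.length, by omega⟩, ⟨p, rfl⟩⟩, ⟨j, h2⟩, ⟨i, by omega⟩), rfl⟩
  have hc : ∀ s : Fin L, ∃ o : Option (DirIdx L (numRuns n δ) × Bool × Fin n),
      (∀ h : (s : ℕ) < cs.length,
        splitSide (ω cs[s].1).1 cs[s].2.1 cs[s].2.2 ⊆ halfSpace X (drawnDirs L _ ω) o ∧
        ∀ i, X i ∈ halfSpace X (drawnDirs L _ ω) o →
          X i ∈ splitSide (ω cs[s].1).1 cs[s].2.1 cs[s].2.2) ∧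
      (¬ (s : ℕ) < cs.length → o = none) := by
    intro s
    by_cases h : (s : ℕ) < cs.length
    · obtain ⟨κ, hκ'⟩ := hκ cs[s] (List.getElem_mem h)
      obtain ⟨o, ho⟩ := exists_halfSpace (X := X) (drawnDirs L (numRuns n δ) ω) κ cs[s].2.1
        cs[s].2.2
      rw [hκ'] at ho
      exact ⟨o, fun _ => ho, fun h' => absurd h h'⟩
    · exact ⟨none, fun h' => absurd h' h, fun _ => rfl⟩
  choose c hc1 hc2 using hc
  have hsub : A.cell ⊆ polytope X (drawnDirs L _ ω) c := by
    rw [hcell]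
    rintro x ⟨-, hx⟩
    refine Set.mem_iInter.2 fun s => ?_
    by_cases h : (s : ℕ) < cs.length
    · exact (hc1 s h).1 (hx _ (List.getElem_mem h))
    · rw [hc2 s h]
      exact Set.mem_univ _
  refine ⟨c, hsub, ?_⟩
  ext i
  rw [mem_indicesIn, mem_indicesIn]
  refine ⟨fun hi => ?_, fun hi => hsub hi⟩
  rw [hcell]
  refine ⟨hX i, fun s hs => ?_⟩
  obtain ⟨r, hr, rfl⟩ := List.getElem_of_mem hs
  exact (hc1 ⟨r, by omega⟩ hr).2 i (Set.mem_iInter.1 hi _)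

/-- A farthest sample point of `A` from one of its sample points determines a ball that contains
the sample points of `A`. -/
lemma exists_outside (A : Set (E D)) {i : Fin n} (hi : X i ∈ A) :
    ∃ j, (∀ l, X l ∈ A → X l ∉ outside X (some (i, j))) ∧
      ∀ x, x ∉ outside X (some (i, j)) → dist x (X i) ≤ dataDiam X A := by
  obtain ⟨j, hj, hmax⟩ := Finset.exists_max_image (indicesIn X A) (fun l => dist (X l) (X i))
    ⟨i, mem_indicesIn.2 hi⟩
  refine ⟨j, fun l hl => ?_, fun x hx => ?_⟩
  · simp only [outside, Set.mem_ofPred_eq, not_lt]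
    exact hmax l (mem_indicesIn.2 hl)
  · simp only [outside, Set.mem_ofPred_eq, not_lt] at hx
    rw [dataDiam_eq_idxDiam]
    exact hx.trans (dist_le_idxDiam hj (mem_indicesIn.2 hi))

end Cells

/-! ### The regression function and the excess risk -/

section Regression

variable {D D' : ℕ} {ρ : Measure (E D × E D')} {f : E D → E D'}

lemma sqDist_le {h g g' : E D → E D'} (hhf : ∀ᵐ z ∂ρ, h z.1 = f z.1)
    (hgg : ∀ᵐ z ∂ρ, g' z.1 = g z.1)
    (hi : Integrable (fun z : E D × E D' => ‖h z.1 - g z.1‖ ^ 2) ρ) :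
    sqDist ρ g' f ≤ ENNReal.ofReal (∫ z, ‖h z.1 - g z.1‖ ^ 2 ∂ρ) := by
  rw [ofReal_integral_eq_lintegral_ofReal hi (Filter.Eventually.of_forall fun z => sq_nonneg _)]
  refine (lintegral_map_le _ _).trans (lintegral_mono_ae ?_)
  filter_upwards [hhf, hgg] with z h1 h2
  rw [h1, h2]

variable [IsProbabilityMeasure ρ]

/-- A regression function of a bounded response has an everywhere bounded measurable version, for
which the response is centered given the first coordinate, also in the form of an orthogonality
relation. -/
lemma exists_measurable_version {cY : E D'} {r : ℝ} (hr : 0 ≤ r)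
    (hY : ∀ᵐ z ∂ρ, z.2 ∈ Metric.closedBall cY r) (hf : IsRegressionFunction ρ f) :
    ∃ h : E D → E D', Measurable h ∧ (∀ x, h x ∈ Metric.closedBall cY r) ∧
      (∀ᵐ z ∂ρ, h z.1 = f z.1) ∧
      (∀ T, MeasurableSet T → ∫ z in Prod.fst ⁻¹' T, (z.2 - h z.1) ∂ρ = 0) ∧
      ∀ φ : E D → E D', Measurable φ → ∀ B, (∀ x, ‖φ x‖ ≤ B) →
        ∫ z, inner ℝ (φ z.1) (z.2 - h z.1) ∂ρ = 0 := by
  set m : MeasurableSpace (E D × E D') :=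
    MeasurableSpace.comap (Prod.fst : E D × E D' → E D) inferInstance with hm
  have hle : m ≤ Prod.instMeasurableSpace := measurable_fst.comap_le
  have hint : Integrable (Prod.snd : E D × E D' → E D') ρ := by
    refine Integrable.of_bound measurable_snd.aestronglyMeasurable (‖cY‖ + r) ?_
    filter_upwards [hY] with z hz
    have h1 := norm_le_norm_add_norm_sub' z.2 cY
    rw [← dist_eq_norm] at h1
    exact h1.trans (by have := Metric.mem_closedBall.1 hz; linarith)
  obtain ⟨h₀, hh₀, hcomp⟩ := (stronglyMeasurable_condExp (μ := ρ) (m := m)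
    (f := (Prod.snd : E D × E D' → E D'))).measurable.exists_eq_measurable_comp
  classical
  set h : E D → E D' := fun x => if h₀ x ∈ Metric.closedBall cY r then h₀ x else cY with hh
  have hball : MeasurableSet {x | h₀ x ∈ Metric.closedBall cY r} :=
    hh₀ Metric.isClosed_closedBall.measurableSet
  have hhm : Measurable h := Measurable.ite hball hh₀ measurable_const
  have hcond : ρ[Prod.snd | m] =ᵐ[ρ] fun z => h z.1 := by
    filter_upwards [Convex.condExp_mem hle hint Metric.isClosed_closedBall
      (convex_closedBall cY r) hY] with z hz
    rw [hcomp] at hz ⊢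
    simp only [hh, Function.comp_apply] at hz ⊢
    rw [if_pos hz]
  have hhb : ∀ x, h x ∈ Metric.closedBall cY r := by
    intro x
    by_cases hx : h₀ x ∈ Metric.closedBall cY r
    · simp only [hh, if_pos hx]; exact hx
    · simp only [hh, if_neg hx]; exact Metric.mem_closedBall_self hr
  have hhint : Integrable (fun z : E D × E D' => h z.1) ρ := by
    refine Integrable.of_bound (hhm.comp measurable_fst).aestronglyMeasurable (‖cY‖ + r)
      (Filter.Eventually.of_forall fun z => ?_)
    have h1 := norm_le_norm_add_norm_sub' (h z.1) cY
    rw [← dist_eq_norm] at h1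
    exact h1.trans (by have := Metric.mem_closedBall.1 (hhb z.1); linarith)
  refine ⟨h, hhm, hhb, ?_, fun T hT => ?_, fun φ hφ B hB => ?_⟩
  · filter_upwards [hcond, hf] with z h1 h2
    rw [← h1, ← h2]
  · rw [integral_sub hint.integrableOn hhint.integrableOn, sub_eq_zero]
    have h1 : MeasurableSet[m] (Prod.fst ⁻¹' T : Set (E D × E D')) := ⟨T, hT, rfl⟩
    rw [← setIntegral_condExp hle hint h1]
    exact setIntegral_congr_ae (hle _ h1) (hcond.mono fun z hz _ => hz)
  · have hφm : StronglyMeasurable[m] fun z : E D × E D' => φ z.1 :=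
      (hφ.comp (comap_measurable _)).stronglyMeasurable
    have hφm' : AEStronglyMeasurable[Prod.instMeasurableSpace] (fun z => φ z.1) ρ :=
      (hφm.mono hle).aestronglyMeasurable
    have hb : ∀ᵐ z ∂ρ, ‖φ z.1‖ ≤ B := Filter.Eventually.of_forall fun z => hB z.1
    have hi : ∀ g : E D × E D' → E D', Integrable g ρ →
        Integrable (fun z => inner ℝ (φ z.1) (g z)) ρ := fun g hg => by
      refine (hg.norm.const_mul B).mono' (hφm'.inner hg.aestronglyMeasurable) ?_
      filter_upwards with z
      exact (norm_inner_le_norm _ _).trans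
        (mul_le_mul_of_nonneg_right (hB z.1) (norm_nonneg _))
    have hpull := condExp_bilin_of_stronglyMeasurable_left (innerSL ℝ) hφm
      (hi _ hint) hint
    simp only [inner_sub_right]
    rw [integral_sub (hi _ hint) (hi _ hhint), sub_eq_zero, ← integral_condExp hle]
    refine integral_congr_ae ?_
    filter_upwards [hpull, hcond] with z h1 h2
    have h3 : ρ[fun z : E D × E D' => (inner ℝ (φ z.1) z.2 : ℝ) | m] z =
        inner ℝ (φ z.1) (ρ[Prod.snd | m] z) := h1
    rw [h3, h2]

/-- The excess risk is the squared distance to the regression function. -/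
lemma risk_sub_risk_eq {cY : E D'} {r : ℝ} (hY : ∀ᵐ z ∂ρ, z.2 ∈ Metric.closedBall cY r)
    {h : E D → E D'} (hh : Measurable h) (hhb : ∀ x, h x ∈ Metric.closedBall cY r)
    (hhf : ∀ᵐ z ∂ρ, h z.1 = f z.1)
    (hort : ∀ φ : E D → E D', Measurable φ → ∀ B, (∀ x, ‖φ x‖ ≤ B) →
      ∫ z, inner ℝ (φ z.1) (z.2 - h z.1) ∂ρ = 0)
    {g g' : E D → E D'} (hg : Measurable g) (hgb : ∀ x, g x ∈ Metric.closedBall cY r)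
    (hgg : ∀ᵐ z ∂ρ, g' z.1 = g z.1) :
    risk ρ g' - risk ρ f = ∫ z, ‖h z.1 - g z.1‖ ^ 2 ∂ρ := by
  have h1 : risk ρ g' = ∫ z, ‖z.2 - g z.1‖ ^ 2 ∂ρ :=
    integral_congr_ae (hgg.mono fun z hz => by dsimp only; rw [hz])
  have h2 : risk ρ f = ∫ z, ‖z.2 - h z.1‖ ^ 2 ∂ρ :=
    integral_congr_ae (hhf.mono fun z hz => by dsimp only; rw [hz])
  have hdist : ∀ {a b : E D'}, a ∈ Metric.closedBall cY r → b ∈ Metric.closedBall cY r →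
      ‖a - b‖ ≤ 2 * r := fun {a b} ha hb => by
    rw [← dist_eq_norm]
    have := dist_triangle_right a b cY
    rw [Metric.mem_closedBall] at ha hb
    linarith
  have hb : ∀ x, ‖h x - g x‖ ≤ 2 * r := fun x => hdist (hhb x) (hgb x)
  have hm1 : Measurable fun z : E D × E D' => z.2 - h z.1 :=
    measurable_snd.sub (hh.comp measurable_fst)
  have hm2 : Measurable fun z : E D × E D' => h z.1 - g z.1 :=
    (hh.sub hg).comp measurable_fst
  have hi1 : Integrable (fun z : E D × E D' => ‖z.2 - h z.1‖ ^ 2) ρ := by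
    refine Integrable.of_bound (hm1.norm.pow_const 2).aestronglyMeasurable ((2 * r) ^ 2) ?_
    filter_upwards [hY] with z hz
    rw [norm_pow, norm_norm]
    exact pow_le_pow_left₀ (norm_nonneg _) (hdist hz (hhb _)) 2
  have hi2 : Integrable (fun z : E D × E D' => ‖h z.1 - g z.1‖ ^ 2) ρ := by
    refine Integrable.of_bound (hm2.norm.pow_const 2).aestronglyMeasurable ((2 * r) ^ 2)
      (Filter.Eventually.of_forall fun z => ?_)
    rw [norm_pow, norm_norm]
    exact pow_le_pow_left₀ (norm_nonneg _) (hb _) 2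
  have hi3 : Integrable (fun z : E D × E D' => inner ℝ (h z.1 - g z.1) (z.2 - h z.1)) ρ := by
    refine Integrable.of_bound (hm2.inner hm1).aestronglyMeasurable ((2 * r) * (2 * r)) ?_
    filter_upwards [hY] with z hz
    exact (norm_inner_le_norm _ _).trans (mul_le_mul (hb _) (hdist hz (hhb _)) (norm_nonneg _)
      ((norm_nonneg _).trans (hb z.1)))
  have hsplit : ∀ z : E D × E D', ‖z.2 - g z.1‖ ^ 2 = ‖z.2 - h z.1‖ ^ 2 +
      2 * inner ℝ (h z.1 - g z.1) (z.2 - h z.1) + ‖h z.1 - g z.1‖ ^ 2 := by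
    intro z
    rw [← sub_add_sub_cancel z.2 (h z.1) (g z.1), norm_add_sq_real,
      real_inner_comm]
  rw [h1, h2]
  simp only [hsplit]
  rw [integral_add (f := fun z : E D × E D' => ‖z.2 - h z.1‖ ^ 2 +
      2 * inner ℝ (h z.1 - g z.1) (z.2 - h z.1)) (hi1.add (hi3.const_mul 2)) hi2,
    integral_add hi1 (hi3.const_mul 2),
    integral_const_mul, hort (fun x => h x - g x) (hh.sub hg) (2 * r) hb]
  ring

end Regression

/-! ### Measurability of the cells and of the regressor -/

section Regressor

variable {D D' n : ℕ} {X : Fin n → E D} {δ : ℝ} {ω : Draws D} {𝒳 : Set (E D)}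

/-- Intersection of the cell of a node with a set. -/
def Node.restrict (S : Set (E D)) (A : Node D) : Node D := ⟨A.path, S ∩ A.cell⟩

lemma indicesIn_inter (hX : ∀ i, X i ∈ 𝒳) (A : Set (E D)) :
    indicesIn X (𝒳 ∩ A) = indicesIn X A := by
  ext i
  simp [mem_indicesIn, hX i]

lemma toIndex_restrict (hX : ∀ i, X i ∈ 𝒳) (A : Node D) :
    (A.restrict 𝒳).toIndex X = A.toIndex X := by
  simp only [Node.toIndex, Node.restrict, indicesIn_inter hX]

lemma basicLeaves_restrict (hX : ∀ i, X i ∈ 𝒳) (A₀ : Node D) (w : ℕ → E D × ℝ) (k : ℕ) :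
    basicLeaves X (A₀.restrict 𝒳) w k = (basicLeaves X A₀ w k).map (Node.restrict 𝒳) := by
  induction k with
  | zero => rfl
  | succ k ih =>
    simp only [basicLeaves, ih, List.map_flatMap, List.flatMap_map]
    congr 1
    funext A
    rw [threshold_eq_idxThreshold, threshold_eq_idxThreshold, toIndex_restrict hX,
      toIndex_restrict hX]
    simp only [children, Node.restrict, List.map_cons, List.map_nil]
    congr 2
    · congr 1
      exact Set.ext fun x => and_assoc
    · congr 2
      ext x
      simp only [Set.mem_sdiff, Set.mem_inter_iff, Set.mem_ofPred_eq]
      tauto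

lemma coreLeaves_restrict (hX : ∀ i, X i ∈ 𝒳) (A : Node D) :
    coreLeaves X δ ω (A.restrict 𝒳) = (coreLeaves X δ ω A).map (Node.restrict 𝒳) := by
  have h1 : coreRun X δ ω (A.restrict 𝒳) = coreRun X δ ω A := by
    simp only [coreRun, runDepth_eq, coreDepth_eq, toIndex_restrict hX]
  rw [coreLeaves, basicLeaves_restrict hX, h1, coreDepth_eq, toIndex_restrict hX, ← coreDepth_eq]
  rfl

/-- The cells are the traces on `𝒳` of the cells of a partition of the whole space. -/
lemma partition_eq_map_restrict (hX : ∀ i, X i ∈ 𝒳) (i : ℕ) :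
    partition X δ ω 𝒳 i = (partition X δ ω Set.univ i).map (Node.restrict 𝒳) := by
  induction i with
  | zero => simp [partition, Node.restrict]
  | succ i ih =>
    simp only [partition, ih, List.map_flatMap, List.flatMap_map, coreLeaves_restrict hX]

lemma measurableSet_of_mem_basicLeaves {A₀ A : Node D} {w : ℕ → E D × ℝ} {k : ℕ}
    (h₀ : MeasurableSet A₀.cell) (hA : A ∈ basicLeaves X A₀ w k) : MeasurableSet A.cell := by
  induction k generalizing A with
  | zero =>
    simp only [basicLeaves, List.mem_singleton] at hA
    rwa [hA]
  | succ k ih =>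
    simp only [basicLeaves, List.mem_flatMap] at hA
    obtain ⟨B, hB, hAB⟩ := hA
    have hm : MeasurableSet {x ∈ B.cell |
        inner ℝ x (w (k + 1)).1 ≤ threshold X A₀ (k + 1) (w (k + 1)) B} :=
      MeasurableSet.inter (ih hB) (s₂ := {x : E D |
        inner ℝ x (w (k + 1)).1 ≤ threshold X A₀ (k + 1) (w (k + 1)) B})
        (measurableSet_le (measurable_id'.inner measurable_const) measurable_const)
    rcases mem_children hAB with rfl | rfl
    · exact hm
    · exact (ih hB).diff hm

lemma measurableSet_of_mem_partition {i : ℕ} {A : Node D}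
    (hA : A ∈ partition X δ ω Set.univ i) : MeasurableSet A.cell := by
  induction i generalizing A with
  | zero =>
    simp only [partition, List.mem_singleton] at hA
    rw [hA]
    exact MeasurableSet.univ
  | succ i ih =>
    simp only [partition, List.mem_flatMap] at hA
    obtain ⟨B, hB, hAB⟩ := hA
    exact measurableSet_of_mem_basicLeaves (ih hB) hAB

lemma cellOf_eq {L : List (Node D)} (hL : L.Pairwise fun A B => Disjoint A.cell B.cell)
    {A : Node D} (hA : A ∈ L) {x : E D} (hx : x ∈ A.cell) : cellOf L x = A.cell := by
  induction L with
  | nil => simp at hA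
  | cons C L ih =>
    rw [List.pairwise_cons] at hL
    have hsplit : cellOf (C :: L) x = {z | x ∈ C.cell ∧ z ∈ C.cell} ∪ cellOf L x := by
      ext z
      simp [cellOf]
    rw [hsplit]
    rcases List.mem_cons.1 hA with rfl | hA'
    · have : cellOf L x = ∅ := by
        ext z
        simp only [cellOf, Set.mem_ofPred_eq, Set.mem_empty_iff_false, iff_false]
        rintro ⟨B, hB, hxB, -⟩
        exact Set.disjoint_left.1 (hL.1 B hB) hx hxB
      rw [this, Set.union_empty]
      ext z
      simp [hx]
    · have : {z | x ∈ C.cell ∧ z ∈ C.cell} = ∅ := by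
        ext z
        simp only [Set.mem_ofPred_eq, Set.mem_empty_iff_false, iff_false]
        rintro ⟨hxC, -⟩
        exact Set.disjoint_left.1 (hL.1 A hA') hxC hx
      rw [this, Set.empty_union, ih hL.2 hA']

variable {Y : Fin n → E D'} {y₀ : E D'}

/-- The value of the regressor on a cell. -/
def cellMean (X : Fin n → E D) (Y : Fin n → E D') (y₀ : E D') (A : Set (E D)) : E D' :=
  if (indicesIn X A).card = 0 then y₀
  else ((indicesIn X A).card : ℝ)⁻¹ • ∑ i ∈ indicesIn X A, Y i

lemma regressor_eq_cellMean {i : ℕ} {A : Node D} (hA : A ∈ partition X δ ω 𝒳 i) {x : E D}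
    (hx : x ∈ A.cell) : regressor X Y y₀ (partition X δ ω 𝒳 i) x = cellMean X Y y₀ A.cell := by
  simp only [regressor, cellMean, cellOf_eq (partition_pairwise_disjoint i) hA hx]

lemma measurable_regressor (i : ℕ) :
    Measurable (regressor X Y y₀ (partition X δ ω Set.univ i)) := by
  intro s _
  have : regressor X Y y₀ (partition X δ ω Set.univ i) ⁻¹' s =
      ⋃ A ∈ {A | A ∈ partition X δ ω Set.univ i ∧ cellMean X Y y₀ A.cell ∈ s}, A.cell := by
    ext x
    simp only [Set.mem_preimage, Set.mem_iUnion, Set.mem_ofPred_eq, exists_prop]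
    constructor
    · intro hx
      obtain ⟨A, hA, hxA⟩ := exists_mem_partition (X := X) (δ := δ) (ω := ω) i (Set.mem_univ x)
      exact ⟨A, ⟨hA, by rwa [regressor_eq_cellMean hA hxA] at hx⟩, hxA⟩
    · rintro ⟨A, ⟨hA, hs⟩, hxA⟩
      rwa [regressor_eq_cellMean hA hxA]
  rw [this]
  refine MeasurableSet.biUnion ?_ fun A hA => measurableSet_of_mem_partition hA.1
  exact ((List.finite_toSet (partition X δ ω Set.univ i)).subset fun A hA => hA.1).countable

/-- On `𝒳` the regressor of a partition of `𝒳` is that of a partition of the whole space. -/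
lemma regressor_eq_univ (hX : ∀ i, X i ∈ 𝒳) (i : ℕ) {x : E D} (hx : x ∈ 𝒳) :
    regressor X Y y₀ (partition X δ ω 𝒳 i) x =
      regressor X Y y₀ (partition X δ ω Set.univ i) x := by
  obtain ⟨A, hA, hxA⟩ := exists_mem_partition (X := X) (δ := δ) (ω := ω) i (Set.mem_univ x)
  have hA' : A.restrict 𝒳 ∈ partition X δ ω 𝒳 i := by
    rw [partition_eq_map_restrict hX]
    exact List.mem_map_of_mem hA
  rw [regressor_eq_cellMean hA hxA, regressor_eq_cellMean hA' ⟨hx, hxA⟩]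
  simp only [cellMean, Node.restrict, indicesIn_inter hX]

lemma cellMean_mem_closedBall {cY : E D'} {r : ℝ} (hY : ∀ i, Y i ∈ Metric.closedBall cY r)
    (hy₀ : y₀ ∈ Metric.closedBall cY r) (A : Set (E D)) :
    cellMean X Y y₀ A ∈ Metric.closedBall cY r := by
  unfold cellMean
  split_ifs with h
  · exact hy₀
  · rw [Finset.smul_sum]
    refine (convex_closedBall cY r).sum_mem (fun i _ => by positivity) ?_ fun i _ => hY i
    rw [Finset.sum_const, nsmul_eq_mul, mul_inv_cancel₀ (by exact_mod_cast h)]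

end Regressor

/-! ### Risk bound for a sample without large deviations -/

section RiskBound

lemma setIntegral_le_of_cover {Z : Type*} [MeasurableSpace Z] {μ : Measure Z} [IsFiniteMeasure μ]
    {F : Z → ℝ} (hF : Integrable F μ) {A P U : Set Z} (hA : MeasurableSet A) (hP : MeasurableSet P)
    (hU : MeasurableSet U) (hAP : A ⊆ P) {b₁ b₂ : ℝ} (hb₁ : 0 ≤ b₁) (hb₂ : 0 ≤ b₂)
    (h : ∀ᵐ z ∂μ, z ∈ A → F z ≤ b₁ ∨ (z ∈ U ∧ F z ≤ b₂)) :
    ∫ z in A, F z ∂μ ≤ b₁ * μ.real P + b₂ * μ.real U := by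
  have hi : ∀ (S : Set Z) (b : ℝ), MeasurableSet S → Integrable (S.indicator fun _ => b) μ :=
    fun S b hS => (integrable_const b).indicator hS
  calc ∫ z in A, F z ∂μ = ∫ z, A.indicator F z ∂μ := (integral_indicator hA).symm
    _ ≤ ∫ z, (P.indicator (fun _ => b₁) z + U.indicator (fun _ => b₂) z) ∂μ := by
        refine integral_mono_ae (hF.indicator hA) ((hi P b₁ hP).add (hi U b₂ hU)) ?_
        filter_upwards [h] with z hz
        have h1 : 0 ≤ P.indicator (fun _ => b₁) z := Set.indicator_nonneg (fun _ _ => hb₁) z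
        have h2 : 0 ≤ U.indicator (fun _ => b₂) z := Set.indicator_nonneg (fun _ _ => hb₂) z
        by_cases hzA : z ∈ A
        · rw [Set.indicator_of_mem hzA]
          rcases hz hzA with h3 | ⟨hzU, h3⟩
          · rw [Set.indicator_of_mem (hAP hzA)]
            linarith
          · rw [Set.indicator_of_mem hzU]
            linarith
        · rw [Set.indicator_of_notMem hzA]
          linarith
    _ = b₁ * μ.real P + b₂ * μ.real U := by
        rw [integral_add (hi P b₁ hP) (hi U b₂ hU), integral_indicator_const _ hP,
          integral_indicator_const _ hU, smul_eq_mul, smul_eq_mul, mul_comm, mul_comm b₂]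

lemma integral_le_sum_setIntegral {Z α : Type*} [MeasurableSpace Z] {μ : Measure Z} {F : Z → ℝ}
    (hF0 : ∀ z, 0 ≤ F z) (hF : Integrable F μ) (L : List α) (s : α → Set Z)
    (hL : ∀ z, ∃ a ∈ L, z ∈ s a) : ∫ z, F z ∂μ ≤ (L.map fun a => ∫ z in s a, F z ∂μ).sum := by
  have key : ∫ z in ⋃ a ∈ {a | a ∈ L}, s a, F z ∂μ ≤ (L.map fun a => ∫ z in s a, F z ∂μ).sum := by
    clear hL
    induction L with
    | nil => simp
    | cons a L ih =>
      have h1 : ⋃ b ∈ {b | b ∈ a :: L}, s b = s a ∪ ⋃ b ∈ {b | b ∈ L}, s b := by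
        ext z; simp
      rw [h1, List.map_cons, List.sum_cons]
      calc ∫ z in s a ∪ ⋃ b ∈ {b | b ∈ L}, s b, F z ∂μ
          ≤ ∫ z, F z ∂(μ.restrict (s a) + μ.restrict (⋃ b ∈ {b | b ∈ L}, s b)) :=
            integral_mono_measure (Measure.restrict_union_le _ _)
              (Filter.Eventually.of_forall hF0) (hF.restrict.add_measure hF.restrict)
        _ = ∫ z in s a, F z ∂μ + ∫ z in ⋃ b ∈ {b | b ∈ L}, s b, F z ∂μ :=
            integral_add_measure hF.restrict hF.restrict
        _ ≤ _ := by linarith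
  have : ⋃ a ∈ {a | a ∈ L}, s a = Set.univ := Set.eq_univ_of_forall fun z => by
    obtain ⟨a, ha, hz⟩ := hL z
    exact Set.mem_biUnion (show a ∈ {a | a ∈ L} from ha) hz
  rwa [this, setIntegral_univ] at key

variable {D D' n Lv : ℕ} {S : Fin n → E D × E D'} {δ : ℝ} {ω : Draws D} {𝒳 : Set (E D)}
  {ρ : Measure (E D × E D')} {f h : E D → E D'} {y₀ cY : E D'}
  {ΔY lam ℓ : ℝ}

/-- No region cut out in the directions `v` has much more mass than sample points. -/
def MassControlled {ι : Type*} (ρ : Measure (E D × E D')) (S : Fin n → E D × E D') (v : ι → E D)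
    (Lv : ℕ) (ℓ : ℝ) : Prop :=
  ∀ c : (Fin Lv → Option (ι × Bool × Fin n)) × Option (Fin n × Fin n),
    ((n : ℝ) - (Lv + 2)) * ρ.real (Prod.fst ⁻¹' region (fun i => (S i).1) v c) / 2 <
      ((indicesIn (fun i => (S i).1) (region (fun i => (S i).1) v c)).card : ℝ) + ℓ

/-- For no polyhedron cut out in the directions `v` the deviation of the sum of the responses from
its conditional expectation is large. -/
def NoiseControlled {ι : Type*} (h : E D → E D') (S : Fin n → E D × E D') (v : ι → E D) (Lv : ℕ)
    (M ℓ : ℝ) : Prop :=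
  ∀ c : Fin Lv → Option (ι × Bool × Fin n),
    ‖∑ j ∈ indicesIn (fun i => (S i).1) (polytope (fun i => (S i).1) v c),
      ((S j).2 - h (S j).1)‖ ^ 2 ≤
      4 * M ^ 2 * ℓ * (indicesIn (fun i => (S i).1) (polytope (fun i => (S i).1) v c)).card

/-- Squared error of the regressor at a point of a cell whose distance to the sample points of the
cell is controlled. -/
lemma norm_sub_cellMean_sq_le (hhS : ∀ i, h (S i).1 = f (S i).1) (hX : ∀ i, (S i).1 ∈ 𝒳)
    (hlam : 0 ≤ lam) (hLip : ∀ x ∈ 𝒳, ∀ x' ∈ 𝒳, ‖f x - f x'‖ ≤ lam * ‖x - x'‖)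
    {A : Set (E D)} (hA : 0 < (indicesIn (fun i => (S i).1) A).card)
    (hdev : ‖∑ j ∈ indicesIn (fun i => (S i).1) A, ((S j).2 - h (S j).1)‖ ^ 2 ≤
      4 * ΔY ^ 2 * ℓ * (indicesIn (fun i => (S i).1) A).card)
    {x : E D} (hx : x ∈ 𝒳) (hxf : h x = f x) {i : Fin n} (hi : (S i).1 ∈ A)
    (hxi : dist x (S i).1 ≤ dataDiam (fun i => (S i).1) A) :
    ‖h x - cellMean (fun i => (S i).1) (fun i => (S i).2) y₀ A‖ ^ 2 ≤
      8 * ΔY ^ 2 * ℓ / (indicesIn (fun i => (S i).1) A).card +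
        8 * lam ^ 2 * dataDiam (fun i => (S i).1) A ^ 2 := by
  set X : Fin n → E D := fun i => (S i).1 with hXdef
  set J := indicesIn X A with hJ
  set N : ℝ := (J.card : ℝ) with hN
  have hN0 : 0 < N := Nat.cast_pos.2 hA
  set Δ := dataDiam X A with hΔ
  -- decomposition into a bias and a noise term
  have hmean : h x - cellMean X (fun i => (S i).2) y₀ A =
      N⁻¹ • ∑ j ∈ J, (h x - h (S j).1) - N⁻¹ • ∑ j ∈ J, ((S j).2 - h (S j).1) := by
    rw [cellMean, if_neg hA.ne', ← smul_sub, ← Finset.sum_sub_distrib]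
    have : ∀ j ∈ J, h x - h (S j).1 - ((S j).2 - h (S j).1) = h x - (S j).2 := fun j _ => by abel
    rw [Finset.sum_congr rfl this, Finset.sum_sub_distrib, Finset.sum_const, smul_sub,
      ← Nat.cast_smul_eq_nsmul ℝ, smul_smul, inv_mul_cancel₀ hN0.ne', one_smul]
  have hbias : ‖N⁻¹ • ∑ j ∈ J, (h x - h (S j).1)‖ ≤ 2 * lam * Δ := by
    rw [norm_smul, Real.norm_of_nonneg (by positivity), inv_mul_le_iff₀ hN0]
    refine (norm_sum_le _ _).trans ?_
    calc ∑ j ∈ J, ‖h x - h (S j).1‖ ≤ ∑ _j ∈ J, 2 * lam * Δ := by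
          refine Finset.sum_le_sum fun j hj => ?_
          rw [hxf, hhS]
          refine (hLip x hx _ (hX j)).trans ?_
          have h1 : dist (S i).1 (S j).1 ≤ Δ := by
            rw [hΔ, dataDiam_eq_idxDiam]
            exact dist_le_idxDiam (X := X) (mem_indicesIn.2 hi) hj
          have h2 := dist_triangle x (S i).1 (S j).1
          rw [← dist_eq_norm]
          calc lam * dist x (S j).1 ≤ lam * (2 * Δ) := by gcongr; linarith
            _ = 2 * lam * Δ := by ring
      _ = N * (2 * lam * Δ) := by rw [Finset.sum_const, nsmul_eq_mul]
  have hnoise : ‖N⁻¹ • ∑ j ∈ J, ((S j).2 - h (S j).1)‖ ^ 2 ≤ 4 * ΔY ^ 2 * ℓ / N := by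
    rw [norm_smul, Real.norm_of_nonneg (by positivity), mul_pow]
    calc N⁻¹ ^ 2 * ‖∑ j ∈ J, ((S j).2 - h (S j).1)‖ ^ 2 ≤ N⁻¹ ^ 2 * (4 * ΔY ^ 2 * ℓ * N) := by
          gcongr
      _ = _ := by field_simp
  have hbias2 := pow_le_pow_left₀ (norm_nonneg _) hbias 2
  rw [hmean]
  set a := N⁻¹ • ∑ j ∈ J, (h x - h (S j).1)
  set b := N⁻¹ • ∑ j ∈ J, ((S j).2 - h (S j).1)
  have h3 : ‖a - b‖ ^ 2 ≤ 2 * ‖a‖ ^ 2 + 2 * ‖b‖ ^ 2 := by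
    have h4 := pow_le_pow_left₀ (norm_nonneg _) (norm_sub_le a b) 2
    nlinarith [sq_nonneg (‖a‖ - ‖b‖)]
  calc ‖a - b‖ ^ 2 ≤ 2 * (2 * lam * Δ) ^ 2 + 2 * (4 * ΔY ^ 2 * ℓ / N) := by linarith
    _ = _ := by ring

lemma regressor_mem_closedBall {X : Fin n → E D} {Y : Fin n → E D'}
    (hY : ∀ i, Y i ∈ Metric.closedBall cY (ΔY / 2)) (hy₀ : y₀ ∈ Metric.closedBall cY (ΔY / 2))
    (i : ℕ) (x : E D) :
    regressor X Y y₀ (partition X δ ω Set.univ i) x ∈ Metric.closedBall cY (ΔY / 2) := by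
  obtain ⟨B, hB, hxB⟩ := exists_mem_partition (X := X) (δ := δ) (ω := ω) i (Set.mem_univ x)
  rw [regressor_eq_cellMean hB hxB]
  exact cellMean_mem_closedBall hY hy₀ _

lemma norm_sub_sq_le_of_mem_closedBall {a b : E D'} (ha : a ∈ Metric.closedBall cY (ΔY / 2))
    (hb : b ∈ Metric.closedBall cY (ΔY / 2)) : ‖a - b‖ ^ 2 ≤ ΔY ^ 2 := by
  refine pow_le_pow_left₀ (norm_nonneg _) ?_ 2
  rw [← dist_eq_norm]
  rw [Metric.mem_closedBall] at ha hb
  linarith [dist_triangle_right a b cY]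

lemma integrable_norm_sub_sq [IsFiniteMeasure ρ] {h g : E D → E D'} (hh : Measurable h)
    (hhb : ∀ x, h x ∈ Metric.closedBall cY (ΔY / 2)) (hg : Measurable g)
    (hgb : ∀ x, g x ∈ Metric.closedBall cY (ΔY / 2)) :
    Integrable (fun z : E D × E D' => ‖h z.1 - g z.1‖ ^ 2) ρ := by
  refine Integrable.of_bound
    (((hh.sub hg).comp measurable_fst).norm.pow_const 2).aestronglyMeasurable (ΔY ^ 2)
    (Filter.Eventually.of_forall fun z => ?_)
  rw [norm_pow, norm_norm]
  exact norm_sub_sq_le_of_mem_closedBall (hhb _) (hgb _)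

variable [IsProbabilityMeasure ρ]

/-- The contribution of a cell to the excess risk. Points of the cell that are far from its sample
points lie in a region without sample points, the mass of which is small. -/
lemma setIntegral_cell_le (hR : 0 < numRuns n δ) (hh : Measurable h)
    (hhb : ∀ x, h x ∈ Metric.closedBall cY (ΔY / 2))
    (hhf : ∀ᵐ z ∂ρ, h z.1 = f z.1) (h𝒳 : ∀ᵐ z ∂ρ, z.1 ∈ 𝒳)
    (hlam : 0 ≤ lam) (hLip : ∀ x ∈ 𝒳, ∀ x' ∈ 𝒳, ‖f x - f x'‖ ≤ lam * ‖x - x'‖)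
    (hy₀ : y₀ ∈ Metric.closedBall cY (ΔY / 2))
    (hX : ∀ i, (S i).1 ∈ 𝒳) (hY : ∀ i, (S i).2 ∈ Metric.closedBall cY (ΔY / 2))
    (hhS : ∀ i, h (S i).1 = f (S i).1) (hn : 2 * (Lv + 2) ≤ n) (hℓ : 0 < ℓ)
    (hmass : MassControlled ρ S (drawnDirs Lv (numRuns n δ) ω) Lv ℓ)
    (hdev : NoiseControlled h S (drawnDirs Lv (numRuns n δ) ω) Lv ΔY ℓ)
    {i : ℕ} {A : Node D} (hA : A ∈ partition (fun i => (S i).1) δ ω Set.univ i)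
    (hL : A.level ≤ Lv) :
    ∫ z in Prod.fst ⁻¹' A.cell, ‖h z.1 - regressor (fun i => (S i).1) (fun i => (S i).2) y₀
        (partition (fun i => (S i).1) δ ω Set.univ i) z.1‖ ^ 2 ∂ρ ≤
      68 * ΔY ^ 2 * ℓ / n + 64 * lam ^ 2 *
        (empMass (fun i => (S i).1) A.cell * dataDiam (fun i => (S i).1) A.cell ^ 2) := by
  set X : Fin n → E D := fun i => (S i).1 with hXdef
  set g := regressor X (fun i => (S i).2) y₀ (partition X δ ω Set.univ i) with hg
  have hgm : Measurable g := measurable_regressor i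
  have hgb : ∀ x, g x ∈ Metric.closedBall cY (ΔY / 2) := regressor_mem_closedBall hY hy₀ i
  have hdiff : ∀ x, ‖h x - g x‖ ^ 2 ≤ ΔY ^ 2 := fun x =>
    norm_sub_sq_le_of_mem_closedBall (hhb x) (hgb x)
  have hint : Integrable (fun z : E D × E D' => ‖h z.1 - g z.1‖ ^ 2) ρ :=
    integrable_norm_sub_sq hh hhb hgm hgb
  obtain ⟨c, hAP, hJ⟩ := exists_polytope (X := X) (ω := ω) hR (fun _ => Set.mem_univ _) hA hL
  set v := drawnDirs Lv (numRuns n δ) ω with hv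
  set P := polytope X v c with hP
  have hregm : ∀ c : (Fin Lv → _) × _, MeasurableSet (region X v c) := fun c =>
    measurableSet_region (Ω := E D) (X := fun _ => X) (v := fun _ => v) measurable_const
      measurable_const measurable_id c
  have hAm : MeasurableSet (Prod.fst ⁻¹' A.cell : Set (E D × E D')) :=
    measurable_fst (measurableSet_of_mem_partition hA)
  have hPr : region X v (c, none) = P := by simp [region, outside, hP]
  have hPm : MeasurableSet (Prod.fst ⁻¹' P : Set (E D × E D')) := by
    rw [← hPr]; exact measurable_fst (hregm _)
  have hn0 : (0 : ℝ) < n := by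
    have : 0 < n := by omega
    exact_mod_cast this
  have hn' : (n : ℝ) / 2 ≤ n - (Lv + 2) := by
    have : (2 * (Lv + 2) : ℝ) ≤ n := by exact_mod_cast hn
    linarith
  have hmass' : ∀ c : (Fin Lv → _) × _, ρ.real (Prod.fst ⁻¹' region X v c) ≤
      4 * ((indicesIn X (region X v c)).card + ℓ) / n := fun c => by
    have h1 : ((n : ℝ) - (Lv + 2)) * ρ.real (Prod.fst ⁻¹' region X v c) / 2 <
        ((indicesIn X (region X v c)).card : ℝ) + ℓ := hmass c
    have h2 := mul_le_mul_of_nonneg_right hn'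
      (measureReal_nonneg (μ := ρ) (s := Prod.fst ⁻¹' region X v c))
    rw [le_div_iff₀ hn0]
    linarith
  set N : ℝ := ((indicesIn X A.cell).card : ℝ) with hN
  have hPmass : ρ.real (Prod.fst ⁻¹' P) ≤ 4 * (N + ℓ) / n := by
    have := hmass' (c, none)
    rwa [hPr, hP, hJ] at this
  have hΔ0 : 0 ≤ 64 * lam ^ 2 * (empMass X A.cell * dataDiam X A.cell ^ 2) := by
    have := empMass_nonneg (X := X) A.cell
    positivity
  -- A cell with at most `ℓ` sample points has mass of order `ℓ / n`, and the trivial bound for the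
  -- error suffices. Otherwise the points of the cell within its data diameter of the sample points
  -- are treated by `norm_sub_cellMean_sq_le`, and the others form a set of mass at most `4 ℓ / n`.
  rcases le_or_gt N ℓ with hcase | hcase
  · have h1 := setIntegral_le_of_cover hint hAm hPm MeasurableSet.empty
      (fun z hz => hAP hz) (sq_nonneg ΔY) le_rfl (b₂ := 0)
      (Filter.Eventually.of_forall fun z _ => Or.inl (hdiff z.1))
    refine h1.trans ?_
    have h2 : ΔY ^ 2 * ρ.real (Prod.fst ⁻¹' P) ≤ ΔY ^ 2 * (4 * (ℓ + ℓ) / n) :=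
      mul_le_mul_of_nonneg_left (hPmass.trans (by gcongr)) (sq_nonneg _)
    have h3 : ΔY ^ 2 * (4 * (ℓ + ℓ) / n) = 8 * ΔY ^ 2 * ℓ / n := by ring
    have h4 : 8 * ΔY ^ 2 * ℓ / n ≤ 68 * ΔY ^ 2 * ℓ / n := by gcongr; norm_num
    linarith
  · have hcard : 0 < (indicesIn X A.cell).card := by
      exact Nat.cast_pos.1 (hℓ.trans hcase)
    obtain ⟨l, hl⟩ := Finset.card_pos.1 hcard
    obtain ⟨j, hj1, hj2⟩ := exists_outside (X := X) A.cell (mem_indicesIn.1 hl)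
    set U := region X v (c, some (l, j)) with hU
    have hUm : MeasurableSet (Prod.fst ⁻¹' U : Set (E D × E D')) := measurable_fst (hregm _)
    have hUmass : ρ.real (Prod.fst ⁻¹' U) ≤ 4 * ℓ / n := by
      have h1 := hmass' (c, some (l, j))
      have h2 : indicesIn X (region X v (c, some (l, j))) = ∅ := by
        ext m
        rw [mem_indicesIn]
        simp only [Finset.notMem_empty, iff_false]
        rintro ⟨hmP, hmo⟩
        exact hj1 m (mem_indicesIn.1 (hJ ▸ mem_indicesIn.2 hmP)) hmo
      rwa [h2, Finset.card_empty, Nat.cast_zero, zero_add] at h1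
    have hdevA := hdev c
    rw [← hXdef, ← hP, hJ] at hdevA
    have hN0 : 0 < N := hℓ.trans hcase
    have h1 := setIntegral_le_of_cover hint hAm hPm hUm (fun z hz => hAP hz)
      (b₁ := 8 * ΔY ^ 2 * ℓ / N + 8 * lam ^ 2 * dataDiam X A.cell ^ 2) (by positivity)
      (sq_nonneg ΔY) (by
        filter_upwards [hhf, h𝒳] with z hz1 hz2 hzA
        by_cases ho : z.1 ∈ outside X (some (l, j))
        · exact Or.inr ⟨⟨hAP hzA, ho⟩, hdiff z.1⟩
        · refine Or.inl ?_
          rw [hg, regressor_eq_cellMean hA hzA]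
          exact norm_sub_cellMean_sq_le hhS hX hlam hLip hcard hdevA hz2 hz1
            (mem_indicesIn.1 hl) (hj2 _ ho))
    refine h1.trans ?_
    have h2 : (8 * ΔY ^ 2 * ℓ / N + 8 * lam ^ 2 * dataDiam X A.cell ^ 2) *
        ρ.real (Prod.fst ⁻¹' P) ≤
        (8 * ΔY ^ 2 * ℓ / N + 8 * lam ^ 2 * dataDiam X A.cell ^ 2) * (8 * N / n) := by
      refine mul_le_mul_of_nonneg_left (hPmass.trans ?_) (by positivity)
      exact div_le_div_of_nonneg_right (by linarith) hn0.le
    have h3 : ΔY ^ 2 * ρ.real (Prod.fst ⁻¹' U) ≤ ΔY ^ 2 * (4 * ℓ / n) :=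
      mul_le_mul_of_nonneg_left hUmass (sq_nonneg _)
    have h4 : (8 * ΔY ^ 2 * ℓ / N + 8 * lam ^ 2 * dataDiam X A.cell ^ 2) * (8 * N / n) +
        ΔY ^ 2 * (4 * ℓ / n) = 68 * ΔY ^ 2 * ℓ / n +
          64 * lam ^ 2 * (N / n * dataDiam X A.cell ^ 2) := by
      field_simp
      ring
    have h5 : empMass X A.cell = N / n := rfl
    rw [h5]
    linarith

/-- The excess risk is at most of the order of the criterion by which the partition is selected. -/
lemma integral_norm_sub_regressor_sq_le (hR : 0 < numRuns n δ) (hh : Measurable h)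
    (hhb : ∀ x, h x ∈ Metric.closedBall cY (ΔY / 2))
    (hhf : ∀ᵐ z ∂ρ, h z.1 = f z.1) (h𝒳 : ∀ᵐ z ∂ρ, z.1 ∈ 𝒳)
    (hlam : 0 ≤ lam) (hLip : ∀ x ∈ 𝒳, ∀ x' ∈ 𝒳, ‖f x - f x'‖ ≤ lam * ‖x - x'‖)
    (hy₀ : y₀ ∈ Metric.closedBall cY (ΔY / 2))
    (hX : ∀ i, (S i).1 ∈ 𝒳) (hY : ∀ i, (S i).2 ∈ Metric.closedBall cY (ΔY / 2))
    (hhS : ∀ i, h (S i).1 = f (S i).1) (hn : 2 * (Lv + 2) ≤ n) (hℓ : 0 < ℓ)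
    (hmass : MassControlled ρ S (drawnDirs Lv (numRuns n δ) ω) Lv ℓ)
    (hdev : NoiseControlled h S (drawnDirs Lv (numRuns n δ) ω) Lv ΔY ℓ)
    {i : ℕ} (hL : ∀ A ∈ partition (fun i => (S i).1) δ ω 𝒳 i, A.level ≤ Lv) :
    ∫ z, ‖h z.1 - regressor (fun i => (S i).1) (fun i => (S i).2) y₀
        (partition (fun i => (S i).1) δ ω Set.univ i) z.1‖ ^ 2 ∂ρ ≤
      68 * ΔY ^ 2 * ℓ / n * (partition (fun i => (S i).1) δ ω 𝒳 i).length + 64 * lam ^ 2 *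
        avgDiam (fun i => (S i).1) (partition (fun i => (S i).1) δ ω 𝒳 i) ^ 2 := by
  set X : Fin n → E D := fun i => (S i).1 with hXdef
  set g := regressor X (fun i => (S i).2) y₀ (partition X δ ω Set.univ i) with hg
  have hgm : Measurable g := measurable_regressor i
  have hgb : ∀ x, g x ∈ Metric.closedBall cY (ΔY / 2) := regressor_mem_closedBall hY hy₀ i
  have hint : Integrable (fun z : E D × E D' => ‖h z.1 - g z.1‖ ^ 2) ρ :=
    integrable_norm_sub_sq hh hhb hgm hgb
  have hcover : ∀ z : E D × E D', ∃ A ∈ partition X δ ω Set.univ i,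
      z ∈ (Prod.fst ⁻¹' A.cell : Set (E D × E D')) :=
    fun z => exists_mem_partition i (Set.mem_univ z.1)
  have hnn : ∀ z : E D × E D', 0 ≤ ‖h z.1 - g z.1‖ ^ 2 := fun z => sq_nonneg _
  have h1 := integral_le_sum_setIntegral hnn hint (partition X δ ω Set.univ i)
    (fun A => (Prod.fst ⁻¹' A.cell : Set (E D × E D'))) hcover
  refine h1.trans ?_
  have hlevel : ∀ A ∈ partition X δ ω Set.univ i, A.level ≤ Lv := fun A hA => by
    refine hL (A.restrict 𝒳) ?_
    rw [partition_eq_map_restrict hX]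
    exact List.mem_map_of_mem hA
  have hn1 : 1 ≤ n := by omega
  have hX' : ∀ i, X i ∈ 𝒳 := hX
  rw [avgDiam_partition_sq hn1 hX, sumSqDiam, partition_eq_map_restrict hX, List.length_map,
    List.map_map]
  have hfun : ((fun A : Node D => empMass X A.cell * dataDiam X A.cell ^ 2) ∘ Node.restrict 𝒳) =
      fun A => empMass X A.cell * dataDiam X A.cell ^ 2 := by
    funext A
    simp only [Function.comp_apply, Node.restrict, empMass, dataDiam_eq_idxDiam,
      indicesIn_inter hX']
  rw [hfun, ← List.sum_map_mul_left]
  have hconst : 68 * ΔY ^ 2 * ℓ / n * (partition X δ ω Set.univ i).length =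
      ((partition X δ ω Set.univ i).map fun _ => 68 * ΔY ^ 2 * ℓ / n).sum := by
    rw [List.map_const', List.sum_replicate, nsmul_eq_mul, mul_comm]
  rw [hconst, ← List.sum_map_add]
  refine List.sum_le_sum fun A hA => ?_
  exact setIntegral_cell_le hR hh hhb hhf h𝒳 hlam hLip hy₀ hX hY hhS hn hℓ hmass hdev hA
    (hlevel A hA)

end RiskBound

/-! ### Number of regions and level of confidence -/

section Count

open Real

/-- Bound on the levels of the cells of the returned partition, if the diameter decrease rate is at
most `log n`. -/
def maxLevel (n : ℕ) : ℕ := ⌊2 * logb 2 n⌋₊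

/-- Codes of half-spaces with a drawn direction and a sample point on the boundary. -/
abbrev SideCode (n : ℕ) (δ : ℝ) :=
  Option (DirIdx (maxLevel n) (numRuns n δ) × Bool × Fin n)

/-- Codes of regions. -/
abbrev RegionCode (n : ℕ) (δ : ℝ) := (Fin (maxLevel n) → SideCode n δ) × Option (Fin n × Fin n)

/-- Exponent of the failure probability that is allowed for a single region. -/
def confLevel (n : ℕ) (δ : ℝ) : ℝ := log (6 * Fintype.card (RegionCode n δ) / δ)

variable {n : ℕ} {δ : ℝ}

lemma card_regionCode_pos : (1 : ℝ) ≤ Fintype.card (RegionCode n δ) := by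
  have : 0 < Fintype.card (RegionCode n δ) := Fintype.card_pos_iff.2 ⟨(fun _ => none, none)⟩
  exact_mod_cast this

lemma confLevel_pos (hδ : 0 < δ) (hδ1 : δ < 1) : 0 < confLevel n δ := by
  refine Real.log_pos ?_
  rw [lt_div_iff₀ hδ]
  linarith [card_regionCode_pos (n := n) (δ := δ)]

/-- Union bound over the codes of the regions. -/
lemma card_mul_exp_neg_confLevel (hδ : 0 < δ) :
    Fintype.card (RegionCode n δ) * exp (-confLevel n δ) = δ / 6 := by
  have := card_regionCode_pos (n := n) (δ := δ)
  rw [confLevel, Real.exp_neg, Real.exp_log (by positivity)]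
  field_simp

lemma numRuns_pos (hn : 1 ≤ n) (hδ : 0 < δ) (hδ1 : δ < 1) : 0 < numRuns n δ := by
  refine Nat.ceil_pos.2 (Real.logb_pos (by norm_num) ?_)
  rw [lt_div_iff₀ hδ]
  have : (1 : ℝ) ≤ n := by exact_mod_cast hn
  nlinarith

lemma sq_mul_half_pow_numRuns_le (hn : 1 ≤ n) (hδ : 0 < δ) :
    (n : ℝ) ^ 2 * (1 / 2) ^ numRuns n δ ≤ δ / 6 := by
  have hn' : (0 : ℝ) < n := by exact_mod_cast hn
  have h1 : 6 * (n : ℝ) ^ 2 / δ ≤ 2 ^ numRuns n δ := by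
    have h2 : logb 2 (6 * (n : ℝ) ^ 2 / δ) ≤ numRuns n δ := Nat.le_ceil _
    rw [Real.logb_le_iff_le_rpow (by norm_num) (by positivity), Real.rpow_natCast] at h2
    exact h2
  rw [div_le_iff₀ hδ] at h1
  have h3 : (0 : ℝ) < 2 ^ numRuns n δ := by positivity
  rw [one_div, inv_pow, ← div_eq_mul_inv, div_le_div_iff₀ h3 (by norm_num)]
  linarith

lemma card_regionCode (n : ℕ) (δ : ℝ) : Fintype.card (RegionCode n δ) =
    (Fintype.card (DirIdx (maxLevel n) (numRuns n δ)) * (2 * n) + 1) ^ maxLevel n *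
      (n * n + 1) := by
  have h : Fintype.card (DirIdx (maxLevel n) (numRuns n δ) × Bool × Fin n) =
      Fintype.card (DirIdx (maxLevel n) (numRuns n δ)) * (2 * n) := by
    rw [Fintype.card_prod _ (Bool × Fin n), Fintype.card_prod Bool, Fintype.card_bool,
      Fintype.card_fin]
  rw [Fintype.card_prod, Fintype.card_fun, Fintype.card_option, Fintype.card_option,
    Fintype.card_prod (Fin n), Fintype.card_fin, Fintype.card_fin, h]

lemma logb_two_pow (m : ℕ) : logb 2 ((2 : ℝ) ^ m) = m := by
  rw [Real.logb_pow, Real.logb_self_eq_one (by norm_num), mul_one]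

lemma logb_two_mono {x y : ℝ} (hx : 0 < x) (hxy : x ≤ y) : logb 2 x ≤ logb 2 y :=
  Real.logb_le_logb_of_le (by norm_num) hx hxy

lemma logb_two_four_mul {x : ℝ} (hx : 0 < x) : logb 2 (4 * x) = 2 + logb 2 x := by
  rw [Real.logb_mul (by norm_num) hx.ne', show (4 : ℝ) = 2 ^ 2 by norm_num, logb_two_pow]
  norm_num

/-- Logarithm of a bound for the number of codes of half-spaces, in terms of the number `x` of
sample points, the number `R` of runs, the number `L` of levels and the number `K` of directions. -/
lemma logb_sideCount_le {x R K w : ℝ} {L : ℕ} (hx : 1 ≤ x) (hR1 : 1 ≤ R) (hK0 : 0 ≤ K)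
    (hK : K ≤ 2 ^ (L + 1) * (R * (L + 1))) (hL : (L : ℝ) ≤ 2 * logb 2 x)
    (hRw : logb 2 R ≤ 2 + w) (hLw : logb 2 ((L : ℝ) + 1) ≤ 2 + w) :
    logb 2 (K * (2 * x) + 1) ≤ 3 * logb 2 x + 7 + 2 * w := by
  have hL0 : (0 : ℝ) ≤ L := Nat.cast_nonneg _
  have h1 : K * (2 * x) + 1 ≤ 4 * (x * (2 ^ (L + 1) * (R * (L + 1)))) := by
    have h2 : (1 : ℝ) ≤ x * (2 ^ (L + 1) * (R * (L + 1))) := by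
      have h3 : (1 : ℝ) ≤ 2 ^ (L + 1) := one_le_pow₀ (by norm_num)
      have h4 : (1 : ℝ) ≤ R * (L + 1) := one_le_mul_of_one_le_of_one_le hR1 (by linarith)
      exact one_le_mul_of_one_le_of_one_le hx (one_le_mul_of_one_le_of_one_le h3 h4)
    have h3 : K * (2 * x) ≤ 2 ^ (L + 1) * (R * (L + 1)) * (2 * x) :=
      mul_le_mul_of_nonneg_right hK (by positivity)
    linarith
  refine (logb_two_mono (by positivity) h1).trans ?_
  have hLpos : (0 : ℝ) < L + 1 := by positivity
  rw [logb_two_four_mul (by positivity), Real.logb_mul (by positivity) (by positivity),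
    Real.logb_mul (by positivity) (by positivity), Real.logb_mul (by positivity) hLpos.ne',
    logb_two_pow]
  push_cast
  linarith

/-- The logarithm of the number of regions is of the order of `α(n)`. -/
lemma confLevel_le (hn : 16 ≤ n) (hδ : 0 < δ) (hδ1 : δ < 1) :
    confLevel n δ ≤ 8 * alpha n δ := by
  have hn' : (16 : ℝ) ≤ n := by exact_mod_cast hn
  have hn0 : (0 : ℝ) < n := by linarith
  -- In these variables `α(n) = t ^ 2 * u + s`, and the logarithm of the number of regions is at
  -- most a constant times `t ^ 2 + t * u`.
  obtain ⟨t, ht⟩ : ∃ t, t = logb 2 (n : ℝ) := ⟨_, rfl⟩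
  obtain ⟨s, hs⟩ : ∃ s, s = logb 2 (1 / δ) := ⟨_, rfl⟩
  obtain ⟨u, hu⟩ : ∃ u, u = logb 2 (logb 2 (n / δ)) := ⟨_, rfl⟩
  have ht4 : 4 ≤ t := by
    have := logb_two_mono (by norm_num) (show (2 : ℝ) ^ 4 ≤ n by linarith)
    rw [logb_two_pow, ← ht] at this
    exact_mod_cast this
  have hs0 : 0 ≤ s := hs ▸ Real.logb_nonneg (by norm_num) (by rw [le_div_iff₀ hδ]; linarith)
  have hts : logb 2 (n / δ) = t + s := by
    rw [div_eq_mul_one_div, Real.logb_mul hn0.ne' (by positivity), ht, hs]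
  have hu2 : 2 ≤ u := by
    have := logb_two_mono (by norm_num) (show (2 : ℝ) ^ 2 ≤ t + s by linarith)
    rw [logb_two_pow, ← hts, ← hu] at this
    exact_mod_cast this
  have hα : alpha n δ = t ^ 2 * u + s := by rw [alpha, ht, hs, hu]
  have hfour : logb 2 (4 * (t + s)) = 2 + u := by
    rw [logb_two_four_mul (by positivity), hu, hts]
  have hsix : logb 2 (6 : ℝ) ≤ 3 := by
    have := logb_two_mono (by norm_num) (show (6 : ℝ) ≤ 2 ^ 3 by norm_num)
    rw [logb_two_pow] at this
    exact_mod_cast this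
  have hsix0 : 0 ≤ logb 2 (6 : ℝ) := Real.logb_nonneg (by norm_num) (by norm_num)
  have hL : (maxLevel n : ℝ) ≤ 2 * t := by
    rw [ht]; exact Nat.floor_le (by rw [← ht]; linarith)
  have hRpos : (1 : ℝ) ≤ numRuns n δ := by exact_mod_cast numRuns_pos (by omega) hδ hδ1
  have hRle : (numRuns n δ : ℝ) ≤ 4 * (t + s) := by
    have h1 : logb 2 (6 * (n : ℝ) ^ 2 / δ) = logb 2 6 + 2 * t + s := by
      rw [div_eq_mul_one_div, Real.logb_mul (by positivity) (by positivity),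
        Real.logb_mul (by norm_num) (by positivity), Real.logb_pow, ht, hs, Nat.cast_ofNat]
    have h3 : (numRuns n δ : ℝ) ≤ logb 2 (6 * (n : ℝ) ^ 2 / δ) + 1 :=
      (Nat.ceil_lt_add_one (by rw [h1]; linarith)).le
    rw [h1] at h3
    linarith
  obtain ⟨K, hK⟩ : ∃ K, K = Fintype.card (DirIdx (maxLevel n) (numRuns n δ)) := ⟨_, rfl⟩
  have hKle : (K : ℝ) ≤ 2 ^ (maxLevel n + 1) * (numRuns n δ * (maxLevel n + 1)) := by
    have := card_dirIdx_le (maxLevel n) (numRuns n δ)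
    rw [← hK] at this
    exact_mod_cast this
  have hside : logb 2 ((K : ℝ) * (2 * n) + 1) ≤ 3 * t + 7 + 2 * u := by
    rw [ht]
    refine logb_sideCount_le (by linarith) hRpos (Nat.cast_nonneg _) hKle (ht ▸ hL) ?_ ?_
    · rw [← hfour]; exact logb_two_mono (by linarith) hRle
    · rw [← hfour]; exact logb_two_mono (by positivity) (by linarith)
  have hsq : logb 2 ((n : ℝ) * n + 1) ≤ 2 * t + 1 := by
    have h1 : (n : ℝ) * n + 1 ≤ 2 ^ 1 * (n * n) := by nlinarith
    refine (logb_two_mono (by positivity) h1).trans ?_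
    rw [Real.logb_mul (by norm_num) (by positivity), Real.logb_mul hn0.ne' hn0.ne', logb_two_pow,
      ← ht]
    push_cast
    linarith
  obtain ⟨m, hm⟩ : ∃ m, m = Fintype.card (RegionCode n δ) := ⟨_, rfl⟩
  have hm1 : (1 : ℝ) ≤ m := by rw [hm]; exact card_regionCode_pos
  have hcard : logb 2 (m : ℝ) ≤ 2 * t * (3 * t + 7 + 2 * u) + (2 * t + 1) := by
    rw [hm, card_regionCode, ← hK]
    push_cast
    have hb : 0 ≤ (K : ℝ) * (2 * n) := by positivity
    rw [Real.logb_mul (by positivity) (by positivity), Real.logb_pow]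
    have h1 : 0 ≤ logb 2 ((K : ℝ) * (2 * n) + 1) := Real.logb_nonneg (by norm_num) (by linarith)
    exact add_le_add (mul_le_mul hL hside h1 (by linarith)) hsq
  have hconf : confLevel n δ ≤ logb 2 6 + logb 2 (m : ℝ) + s := by
    have h2 := (confLevel_pos (n := n) hδ hδ1).le
    rw [confLevel, ← hm] at h2 ⊢
    rw [hs, ← Real.logb_mul (by norm_num) (by positivity), ← Real.logb_mul (by positivity)
      (by positivity), mul_one_div, Real.logb, le_div_iff₀ (Real.log_pos (by norm_num))]
    have h3 : log 2 ≤ 1 := by linarith [Real.log_two_lt_d9]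
    exact mul_le_of_le_one_right h2 h3
  rw [hα]
  have h1 : 4 * t ≤ t ^ 2 := by nlinarith
  have h2 : t ^ 2 * 2 ≤ t ^ 2 * u := by gcongr
  have h3 : 4 * t * u ≤ t ^ 2 * u := by gcongr
  nlinarith

/-- The bounded number of levels is negligible if `α(n) < n`. -/
lemma two_mul_maxLevel_le (hn : 16 ≤ n) (hδ : 0 < δ) (hδ1 : δ < 1) (hα : alpha n δ < n) :
    2 * (maxLevel n + 2) ≤ n := by
  have hn' : (16 : ℝ) ≤ n := by exact_mod_cast hn
  have hn0 : (0 : ℝ) < n := by linarith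
  have hpow : ∀ m : ℕ, logb 2 ((2 : ℝ) ^ m) = m := fun m => by
    rw [Real.logb_pow, Real.logb_self_eq_one (by norm_num), mul_one]
  have ht4 : 4 ≤ logb 2 (n : ℝ) := by
    have := Real.logb_le_logb_of_le (b := 2) (by norm_num) (by norm_num)
      (show (2 : ℝ) ^ 4 ≤ n by linarith)
    rw [hpow] at this
    exact_mod_cast this
  have hs0 : 0 ≤ logb 2 (1 / δ) :=
    Real.logb_nonneg (by norm_num) (by rw [le_div_iff₀ hδ]; linarith)
  have hu2 : 2 ≤ logb 2 (logb 2 (n / δ)) := by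
    have h1 : logb 2 (n / δ) = logb 2 (n : ℝ) + logb 2 (1 / δ) := by
      rw [div_eq_mul_one_div, Real.logb_mul hn0.ne' (by positivity)]
    have := Real.logb_le_logb_of_le (b := 2) (by norm_num) (by norm_num)
      (show (2 : ℝ) ^ 2 ≤ logb 2 (n / δ) by rw [h1]; linarith)
    rw [hpow] at this
    exact_mod_cast this
  have hL : (maxLevel n : ℝ) ≤ 2 * logb 2 n := Nat.floor_le (by positivity)
  have hα' : logb 2 (n : ℝ) ^ 2 * 2 ≤ alpha n δ := by
    have : logb 2 (n : ℝ) ^ 2 * 2 ≤ logb 2 (n : ℝ) ^ 2 * logb 2 (logb 2 (n / δ)) := by gcongr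
    unfold alpha
    linarith
  have : (2 * (maxLevel n + 2) : ℝ) ≤ n := by nlinarith
  exact_mod_cast this

/-- For small samples, for large `α(n)` and for large `k` the rate is bounded below, so that the
boundedness of the response suffices for the bound of the risk. -/
lemma one_div_sixteen_le_rpow (hn : 1 ≤ n) (hα : 1 ≤ alpha n δ) {k : ℝ} (hk : 0 < k)
    (h : n < 16 ∨ (n : ℝ) ≤ alpha n δ ∨ logb 2 n ≤ k) :
    1 / 16 ≤ (alpha n δ / n) ^ (2 / (2 + k)) := by
  have hn0 : (0 : ℝ) < n := by exact_mod_cast hn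
  have hp0 : 0 < 2 / (2 + k) := by positivity
  have hp1 : 2 / (2 + k) ≤ 1 := by rw [div_le_one (by positivity)]; linarith
  rcases le_or_gt (n : ℝ) (alpha n δ) with h1 | h1
  · have : 1 ≤ (alpha n δ / n) ^ (2 / (2 + k)) :=
      Real.one_le_rpow (by rwa [le_div_iff₀ hn0, one_mul]) hp0.le
    linarith
  rcases h with h | h | h
  · have hle : alpha n δ / n ≤ 1 := by rw [div_le_one hn0]; exact h1.le
    have h2 := Real.rpow_le_rpow_of_exponent_ge (by positivity) hle hp1
    rw [Real.rpow_one] at h2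
    refine le_trans ?_ h2
    have : (n : ℝ) ≤ 16 := by exact_mod_cast h.le
    exact div_le_div₀ (by linarith) hα hn0 this
  · linarith
  · have h2 : (n : ℝ) ≤ 2 ^ k := by
      rwa [← Real.logb_le_iff_le_rpow (by norm_num) hn0]
    have h3 : (1 / n : ℝ) ^ (2 / (2 + k)) ≤ (alpha n δ / n) ^ (2 / (2 + k)) := by gcongr
    refine le_trans ?_ h3
    have h4 : (n : ℝ) ^ (2 / (2 + k)) ≤ 4 := by
      calc (n : ℝ) ^ (2 / (2 + k)) ≤ (2 ^ k) ^ (2 / (2 + k)) := by gcongr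
        _ = 2 ^ (k * (2 / (2 + k))) := by rw [← Real.rpow_mul (by norm_num)]
        _ ≤ 2 ^ (2 : ℝ) := by
            refine Real.rpow_le_rpow_of_exponent_le (by norm_num) ?_
            rw [mul_div_assoc', div_le_iff₀ (by positivity)]
            linarith
        _ = 4 := by norm_num
    rw [Real.div_rpow (by norm_num) hn0.le, Real.one_rpow]
    exact one_div_le_one_div_of_le (by positivity) (by linarith)

/-- The cardinality of a cover being an integer, the Assouad dimension is the logarithm of an
integer. -/
lemma three_halves_le_of_hasAssouadDim {D : ℕ} {S : Set (E D)} {d : ℝ} (h : HasAssouadDim S d)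
    (hd : 1 < d) : 3 / 2 ≤ d := by
  obtain ⟨⟨hd0, hcov⟩, hmin⟩ := h
  set N := ⌊(2 : ℝ) ^ d⌋₊ with hN
  have hN2 : 2 ≤ N := Nat.le_floor (by
    push_cast
    exact (Real.self_le_rpow_of_one_le (by norm_num) hd.le))
  have hN0 : (0 : ℝ) < N := by positivity
  have hlog0 : 0 ≤ logb 2 (N : ℝ) := Real.logb_nonneg (by norm_num) (by
    have : (2 : ℝ) ≤ N := by exact_mod_cast hN2
    linarith)
  have hpow : (2 : ℝ) ^ logb 2 (N : ℝ) = N := Real.rpow_logb (by norm_num) (by norm_num) hN0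
  have hle : d ≤ logb 2 N := hmin ⟨hlog0, fun c r hr => by
    obtain ⟨T, hT, hT'⟩ := hcov c r hr
    refine ⟨T, ?_, hT'⟩
    rw [hpow]
    exact_mod_cast Nat.le_floor hT⟩
  have hN3 : 3 ≤ N := by
    by_contra hc
    have h2 : N = 2 := by omega
    rw [h2] at hle
    have : logb 2 ((2 : ℕ) : ℝ) = 1 := by
      push_cast
      exact Real.logb_self_eq_one (by norm_num)
    linarith
  have h3 : (3 : ℝ) ≤ 2 ^ d := by
    have h4 : (N : ℝ) ≤ 2 ^ d := Nat.floor_le (by positivity)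
    have h5 : (3 : ℝ) ≤ N := by exact_mod_cast hN3
    linarith
  by_contra hc
  push Not at hc
  have h6 : (2 : ℝ) ^ d ≤ 2 ^ (3 / 2 : ℝ) :=
    Real.rpow_le_rpow_of_exponent_le (by norm_num) hc.le
  have h7 : ((2 : ℝ) ^ (3 / 2 : ℝ)) ^ 2 = 8 := by
    rw [← Real.rpow_natCast, ← Real.rpow_mul (by norm_num)]
    norm_num
  have h8 : (0 : ℝ) < 2 ^ (3 / 2 : ℝ) := by positivity
  nlinarith

end Count

/-! ### Events of small probability -/

section Events

variable {D D' n : ℕ} {ρ : Measure (E D × E D')} [IsProbabilityMeasure ρ] {δ : ℝ}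

lemma prod_le_of_forall_slice {Ω₁ Ω₂ : Type*} [MeasurableSpace Ω₁] [MeasurableSpace Ω₂]
    {P : Measure Ω₁} {Q : Measure Ω₂} [SFinite P] [IsProbabilityMeasure Q] {B : Set (Ω₁ × Ω₂)}
    (hB : MeasurableSet B) {b : ℝ≥0∞} (h : ∀ y, P {x | (x, y) ∈ B} ≤ b) : P.prod Q B ≤ b := by
  rw [Measure.prod_apply_symm hB]
  calc ∫⁻ y, P ((fun x => (x, y)) ⁻¹' B) ∂Q ≤ ∫⁻ _, b ∂Q := lintegral_mono fun y => h y
    _ = b := by simp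

lemma measurable_sample_fst :
    Measurable fun a : (Fin n → E D × E D') × Draws D => fun i => (a.1 i).1 :=
  measurable_pi_lambda _ fun i => ((measurable_pi_apply i).comp measurable_fst).fst

lemma ae_jointLaw_sample {p : E D × E D' → Prop} (h : ∀ᵐ z ∂ρ, p z) :
    ∀ᵐ a ∂jointLaw ρ n, ∀ i, p (a.1 i) := by
  have h1 : ∀ᵐ S ∂(Measure.pi fun _ : Fin n => ρ), ∀ i, p (S i) :=
    ae_all_iff.2 fun i =>
      (measurePreserving_eval (fun _ : Fin n => ρ) i).quasiMeasurePreserving.ae h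
  exact Measure.quasiMeasurePreserving_fst.ae h1

lemma measurable_codeDirs :
    Measurable fun a : (Fin n → E D × E D') × Draws D =>
      (drawnDirs (maxLevel n) (numRuns n δ) a.2 : DirIdx (maxLevel n) (numRuns n δ) → E D) :=
  (measurable_drawnDirs _ _).comp measurable_snd

/-- Except with small probability no call of the core procedure returns a deep tree. -/
lemma jointLaw_exists_call_gt (hn : 1 ≤ n) (hδ : 0 < δ) (hδ1 : δ < 1) {S : Set (E D)} {d : ℝ}
    (hS : Doubling S d) (hd : 3 / 2 ≤ d) (hρ : ∀ᵐ z ∂ρ, z.1 ∈ S) :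
    jointLaw ρ n {a | ∃ i < n, ∃ b ∈ idxPartition (fun i => (a.1 i).1) δ a.2 i,
      ((⌊60000 * d * Real.logb 2 d⌋₊ : ℕ) : ℕ∞) < idxCoreDepth (fun i => (a.1 i).1) δ a.2 b} ≤
      ENNReal.ofReal (δ / 6) := by
  set k : ℕ∞ := ((⌊60000 * d * Real.logb 2 d⌋₊ : ℕ) : ℕ∞) with hk
  set B : Set ((Fin n → E D × E D') × Draws D) :=
    {a | ∃ i < n, ∃ b ∈ idxPartition (fun i => (a.1 i).1) δ a.2 i,
      k < idxCoreDepth (fun i => (a.1 i).1) δ a.2 b} with hB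
  have hBm : MeasurableSet B := by
    have : B = ⋃ i ∈ Set.Iio n, ⋃ b : IndexNode n,
        {a | b ∈ idxPartition (fun i => (a.1 i).1) δ a.2 i} ∩
          {a | k < idxCoreDepth (fun i => (a.1 i).1) δ a.2 b} := by
      ext a
      simp [hB]
    rw [this]
    refine MeasurableSet.biUnion (Set.to_countable _) fun i _ => MeasurableSet.iUnion fun b => ?_
    exact ((measurableFibers_idxPartition (δ := δ) measurable_sample_fst measurable_snd
        i).setOf_mem {L | b ∈ L}).inter
      ((measurableFibers_idxCoreDepth (δ := δ) measurable_sample_fst measurable_snd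
        b).setOf_mem {m | k < m})
  rw [jointLaw, Measure.prod_apply hBm]
  have hae : ∀ᵐ S' ∂(Measure.pi fun _ : Fin n => ρ), ∀ i, (S' i).1 ∈ S :=
    ae_all_iff.2 fun i =>
      (measurePreserving_eval (fun _ : Fin n => ρ) i).quasiMeasurePreserving.ae hρ
  calc ∫⁻ S', drawsLaw D (Prod.mk S' ⁻¹' B) ∂(Measure.pi fun _ : Fin n => ρ)
      ≤ ∫⁻ _, ENNReal.ofReal (δ / 6) ∂(Measure.pi fun _ : Fin n => ρ) := by
        refine lintegral_mono_ae ?_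
        filter_upwards [hae] with S' hS'
        refine (drawsLaw_exists_call_gt hS hd hS' (numRuns_pos hn hδ hδ1)).trans ?_
        exact ENNReal.ofReal_le_ofReal (sq_mul_half_pow_numRuns_le hn hδ)
    _ = ENNReal.ofReal (δ / 6) := by simp

/-- Except with small probability the masses of all regions are controlled. -/
lemma jointLaw_not_massControlled (hδ : 0 < δ) :
    jointLaw ρ n {a | ¬ MassControlled ρ a.1 (drawnDirs (maxLevel n) (numRuns n δ) a.2)
      (maxLevel n) (confLevel n δ)} ≤ ENNReal.ofReal (δ / 6) := by
  classical
  set ℓ := confLevel n δ with hℓ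
  set B : RegionCode n δ → Set ((Fin n → E D × E D') × Draws D) := fun c => {a |
    ((indicesIn (fun i => (a.1 i).1) (region (fun i => (a.1 i).1)
      (drawnDirs (maxLevel n) (numRuns n δ) a.2) c)).card : ℝ) + ℓ ≤
      ((n : ℝ) - (maxLevel n + 2)) * ρ.real (Prod.fst ⁻¹' region (fun i => (a.1 i).1)
        (drawnDirs (maxLevel n) (numRuns n δ) a.2) c) / 2} with hB
  have hsub : {a : (Fin n → E D × E D') × Draws D | ¬ MassControlled ρ a.1
      (drawnDirs (maxLevel n) (numRuns n δ) a.2) (maxLevel n) ℓ} ⊆ ⋃ c, B c := by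
    intro a ha
    simp only [MassControlled, Set.mem_ofPred_eq, not_forall, not_lt] at ha
    exact Set.mem_iUnion.2 ha
  have hBm : ∀ c, MeasurableSet (B c) := by
    intro c
    refine measurableSet_le ?_ ?_
    · simp only [card_indicesIn_eq_sum]
      refine Measurable.add_const (Finset.measurable_sum _ fun i _ => ?_) _
      refine Measurable.ite ?_ measurable_const measurable_const
      exact measurableSet_region measurable_sample_fst measurable_codeDirs
        ((measurable_pi_apply i).comp measurable_sample_fst) c
    · have hq : MeasurableSet {q : ((Fin n → E D × E D') × Draws D) × (E D × E D') |
          q.2.1 ∈ region (fun i => (q.1.1 i).1)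
            (drawnDirs (maxLevel n) (numRuns n δ) q.1.2) c} :=
        measurableSet_region (measurable_sample_fst.comp measurable_fst)
          (measurable_codeDirs.comp measurable_fst) measurable_snd.fst c
      exact ((measurable_measure_prodMk_left (ν := ρ) hq).ennreal_toReal.const_mul _).div_const 2
  have hBc : ∀ c, jointLaw ρ n (B c) ≤ ENNReal.ofReal (Real.exp (-ℓ)) := by
    intro c
    refine prod_le_of_forall_slice (hBm c) fun ω => ?_
    exact pi_region_mass (L := maxLevel n) ρ (drawnDirs (maxLevel n) (numRuns n δ) ω) c ℓ
  calc jointLaw ρ n _ ≤ ∑ c, jointLaw ρ n (B c) :=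
        (measure_mono hsub).trans (measure_iUnion_fintype_le _ _)
    _ ≤ ∑ _c : RegionCode n δ, ENNReal.ofReal (Real.exp (-ℓ)) :=
        Finset.sum_le_sum fun c _ => hBc c
    _ ≤ ENNReal.ofReal (δ / 6) := by
        rw [Finset.sum_const, nsmul_eq_mul, ← ENNReal.ofReal_natCast,
          ← ENNReal.ofReal_mul (Nat.cast_nonneg _), Finset.card_univ]
        refine ENNReal.ofReal_le_ofReal ?_
        have h1 := card_mul_exp_neg_confLevel (n := n) hδ
        exact h1.le

/-- Except with small probability the noise is controlled on all polyhedra. -/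
lemma jointLaw_not_noiseControlled (hδ : 0 < δ) (hδ1 : δ < 1) {ξ : E D × E D' → E D'}
    (hξ : Measurable ξ) {M : ℝ} (hξM : ∀ z, ‖ξ z‖ ≤ M)
    (hξ0 : ∀ T : Set (E D), MeasurableSet T → ∫ z in Prod.fst ⁻¹' T, ξ z ∂ρ = 0) :
    jointLaw ρ n {a | ¬ ∀ c : Fin (maxLevel n) → SideCode n δ,
      ‖∑ j ∈ indicesIn (fun i => (a.1 i).1) (polytope (fun i => (a.1 i).1)
        (drawnDirs (maxLevel n) (numRuns n δ) a.2) c), ξ (a.1 j)‖ ^ 2 ≤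
      4 * M ^ 2 * confLevel n δ * (indicesIn (fun i => (a.1 i).1) (polytope (fun i => (a.1 i).1)
        (drawnDirs (maxLevel n) (numRuns n δ) a.2) c)).card} ≤ ENNReal.ofReal (δ / 3) := by
  classical
  set ℓ := confLevel n δ with hℓ
  set J : (Fin (maxLevel n) → SideCode n δ) → ((Fin n → E D × E D') × Draws D) → Finset (Fin n) :=
    fun c a => indicesIn (fun i => (a.1 i).1) (polytope (fun i => (a.1 i).1)
      (drawnDirs (maxLevel n) (numRuns n δ) a.2) c) with hJ
  set B : (Fin (maxLevel n) → SideCode n δ) → Set ((Fin n → E D × E D') × Draws D) := fun c =>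
    {a | 4 * M ^ 2 * ℓ * (J c a).card < ‖∑ j ∈ J c a, ξ (a.1 j)‖ ^ 2} with hB
  have hsub : {a : (Fin n → E D × E D') × Draws D | ¬ ∀ c : Fin (maxLevel n) → SideCode n δ,
      ‖∑ j ∈ J c a, ξ (a.1 j)‖ ^ 2 ≤ 4 * M ^ 2 * ℓ * (J c a).card} ⊆ ⋃ c, B c := by
    intro a ha
    simp only [Set.mem_ofPred_eq, not_forall, not_le] at ha
    exact Set.mem_iUnion.2 ha
  have hfib : ∀ {Ω : Type} [MeasurableSpace Ω] {X : Ω → Fin n → E D}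
      {v : Ω → DirIdx (maxLevel n) (numRuns n δ) → E D} (_ : Measurable X) (_ : Measurable v)
      (c : Fin (maxLevel n) → SideCode n δ),
      MeasurableFibers fun a => indicesIn (X a) (polytope (X a) (v a) c) := by
    intro Ω _ X v hX hv c K
    have : {a | indicesIn (X a) (polytope (X a) (v a) c) = K} =
        ⋂ i, {a | X a i ∈ polytope (X a) (v a) c ↔ i ∈ K} := by
      ext a
      simp [Finset.ext_iff, mem_indicesIn]
    rw [this]
    refine MeasurableSet.iInter fun i => ?_
    exact (measurableSet_polytope hX hv ((measurable_pi_apply i).comp hX) c).iff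
      (MeasurableSet.const _)
  have hBm : ∀ c, MeasurableSet (B c) := fun c =>
    (hfib measurable_sample_fst measurable_codeDirs c).setOf_rel
      (P := fun K a => 4 * M ^ 2 * ℓ * (K.card : ℝ) < ‖∑ j ∈ K, ξ (a.1 j)‖ ^ 2) fun K =>
        measurableSet_lt measurable_const
          (((measurable_sum_comp hξ K).comp measurable_fst).norm.pow_const 2)
  have hBc : ∀ c, jointLaw ρ n (B c) ≤ ENNReal.ofReal (2 * Real.exp (-ℓ)) := fun c =>
    prod_le_of_forall_slice (hBm c) fun ω =>
      pi_norm_sum_gt_le hξ hξM hξ0 (fun X => indicesIn X (polytope X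
        (drawnDirs (maxLevel n) (numRuns n δ) ω) c))
        (hfib measurable_id measurable_const c) (confLevel_pos hδ hδ1).le
  have hcard : (Fintype.card (Fin (maxLevel n) → SideCode n δ) : ℝ) ≤
      Fintype.card (RegionCode n δ) := by
    exact_mod_cast Fintype.card_le_of_injective (fun c => ((c, none) : RegionCode n δ))
      fun c c' h => (Prod.ext_iff.1 h).1
  calc jointLaw ρ n _ ≤ ∑ c, jointLaw ρ n (B c) :=
        (measure_mono hsub).trans (measure_iUnion_fintype_le _ _)
    _ ≤ ∑ _c : Fin (maxLevel n) → SideCode n δ, ENNReal.ofReal (2 * Real.exp (-ℓ)) :=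
        Finset.sum_le_sum fun c _ => hBc c
    _ ≤ ENNReal.ofReal (δ / 3) := by
        rw [Finset.sum_const, nsmul_eq_mul, ← ENNReal.ofReal_natCast,
          ← ENNReal.ofReal_mul (Nat.cast_nonneg _), Finset.card_univ]
        refine ENNReal.ofReal_le_ofReal ?_
        have h1 := card_mul_exp_neg_confLevel (n := n) hδ
        have h2 := mul_le_mul_of_nonneg_right hcard (Real.exp_pos (-ℓ)).le
        rw [h1] at h2
        linarith

end Events

/-! ### Excess risk of the returned regressor -/

section Final

open Real

variable {D D' n : ℕ} {S : Fin n → E D × E D'} {δ : ℝ} {ω : Draws D} {𝒳 : Set (E D)}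
  {ρ : Measure (E D × E D')} [IsProbabilityMeasure ρ] {f h : E D → E D'} {y₀ cY : E D'}
  {ΔX ΔY lam : ℝ}

lemma dataDiam_le_of_subset_closedBall {X : Fin n → E D} {c : E D} (hn : 1 ≤ n)
    (hX : ∀ i, X i ∈ 𝒳) (hc : 𝒳 ⊆ Metric.closedBall c (ΔX / 2)) : dataDiam X 𝒳 ≤ ΔX := by
  have h0 : 0 ≤ ΔX / 2 := dist_nonneg.trans (Metric.mem_closedBall.1 (hc (hX ⟨0, hn⟩)))
  rw [dataDiam_eq_idxDiam, idxDiam_le_iff (by linarith)]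
  intro i _ j _
  have h1 := Metric.mem_closedBall.1 (hc (hX i))
  have h2 := Metric.mem_closedBall.1 (hc (hX j))
  linarith [dist_triangle_right (X i) (X j) c]

/-- On a sample without large deviations the excess risk of the returned regressor is bounded, for
every diameter decrease rate that is attained. -/
lemma integral_le_of_isReturned (hn : 1 ≤ n) (hδ : 0 < δ) (hδ1 : δ < 1)
    (hα : 1 ≤ alpha n δ) (hh : Measurable h)
    (hhb : ∀ x, h x ∈ Metric.closedBall cY (ΔY / 2))
    (hhf : ∀ᵐ z ∂ρ, h z.1 = f z.1) (h𝒳 : ∀ᵐ z ∂ρ, z.1 ∈ 𝒳)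
    (hlam : 0 ≤ lam) (hLip : ∀ x ∈ 𝒳, ∀ x' ∈ 𝒳, ‖f x - f x'‖ ≤ lam * ‖x - x'‖)
    (hy₀ : y₀ ∈ Metric.closedBall cY (ΔY / 2)) {c : E D} (hc : 𝒳 ⊆ Metric.closedBall c (ΔX / 2))
    (hX : ∀ i, (S i).1 ∈ 𝒳) (hY : ∀ i, (S i).2 ∈ Metric.closedBall cY (ΔY / 2))
    (hhS : ∀ i, h (S i).1 = f (S i).1)
    (hmass : MassControlled ρ S (drawnDirs (maxLevel n) (numRuns n δ) ω) (maxLevel n)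
      (confLevel n δ))
    (hdev : NoiseControlled h S (drawnDirs (maxLevel n) (numRuns n δ) ω) (maxLevel n) ΔY
      (confLevel n δ))
    {I : ℕ} (hI : StopsAt (fun i => (S i).1) δ ω 𝒳 I) {d k : ℝ} (hd : 0 < d)
    (hk : AttainsRate (fun i => (S i).1) δ ω 𝒳 d I k) {i : ℕ} (hi : i = I - 1 ∨ i = I)
    (hL : IsReturned (fun i => (S i).1) δ ω 𝒳 I (partition (fun i => (S i).1) δ ω 𝒳 i)) :
    ∫ z, ‖h z.1 - regressor (fun i => (S i).1) (fun i => (S i).2) y₀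
        (partition (fun i => (S i).1) δ ω Set.univ i) z.1‖ ^ 2 ∂ρ ≤
      2176 * (ΔY ^ 2 + lam ^ 2) * (ΔX ^ 2 + 1) * (alpha n δ / n) ^ (2 / (2 + k)) := by
  obtain ⟨X, hXdef⟩ : ∃ X : Fin n → E D, X = fun i => (S i).1 := ⟨_, rfl⟩
  rw [← hXdef] at hI hk hL ⊢
  have hX' : ∀ i, X i ∈ 𝒳 := by rw [hXdef]; exact hX
  have hn0 : (0 : ℝ) < n := by exact_mod_cast hn
  have hk0 : 0 < k := hd.trans_le hk.1
  have hrate := Real.rpow_nonneg (by positivity : 0 ≤ alpha n δ / n) (2 / (2 + k))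
  set r := (alpha n δ / n) ^ (2 / (2 + k)) with hr
  have hY2 : ΔY ^ 2 ≤ ΔY ^ 2 + lam ^ 2 := by linarith [sq_nonneg lam]
  -- In the degenerate cases the error of at most `ΔY ^ 2` is already of the claimed order.
  by_cases htriv : n < 16 ∨ (n : ℝ) ≤ alpha n δ ∨ logb 2 n ≤ k
  · have h1 := one_div_sixteen_le_rpow hn hα hk0 htriv
    rw [← hr] at h1
    have hgb : ∀ x, regressor X (fun i => (S i).2) y₀ (partition X δ ω Set.univ i) x ∈
        Metric.closedBall cY (ΔY / 2) := regressor_mem_closedBall hY hy₀ i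
    have h2 : ∫ z, ‖h z.1 - regressor X (fun i => (S i).2) y₀
        (partition X δ ω Set.univ i) z.1‖ ^ 2 ∂ρ ≤ ∫ _, ΔY ^ 2 ∂ρ :=
      integral_mono (integrable_norm_sub_sq hh hhb (measurable_regressor i) hgb)
        (integrable_const _) fun z => norm_sub_sq_le_of_mem_closedBall (hhb _) (hgb _)
    rw [integral_const, probReal_univ, one_smul] at h2
    calc _ ≤ ΔY ^ 2 := h2
      _ = 16 * ΔY ^ 2 * 1 * (1 / 16) := by ring
      _ ≤ 2176 * (ΔY ^ 2 + lam ^ 2) * (ΔX ^ 2 + 1) * r := by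
          gcongr
          · norm_num
          · linarith [sq_nonneg ΔX]
  push Not at htriv
  obtain ⟨hn16, hαn, hkn⟩ := htriv
  have hR := numRuns_pos hn hδ hδ1
  have hlevel : ∀ A ∈ partition X δ ω 𝒳 i, A.level ≤ maxLevel n := by
    intro A hA
    have h1 := level_le_of_stopsAt hn hX' hR hα hI hk0.le hk.2 (A := A)
      (by rcases hi with rfl | rfl
          · exact Or.inl hA
          · exact Or.inr hA)
    exact Nat.le_floor (by linarith)
  have hmain := integral_norm_sub_regressor_sq_le (S := S) (y₀ := y₀) hR hh hhb hhf h𝒳 hlam hLip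
    hy₀ hX hY hhS (two_mul_maxLevel_le hn16 hδ hδ1 hαn) (confLevel_pos hδ hδ1) hmass hdev (i := i)
    (by rw [← hXdef]; exact hlevel)
  rw [← hXdef] at hmain
  refine hmain.trans ?_
  have hscore := score_le hn hX' hR hα hαn.le hI hk0 hk.2 hL
  rw [← hr] at hscore
  have hdiam : dataDiam X 𝒳 ^ 2 ≤ ΔX ^ 2 :=
    pow_le_pow_left₀ (dataDiam_nonneg _) (dataDiam_le_of_subset_closedBall hn hX' hc) 2
  have hconf := confLevel_le hn16 hδ hδ1
  set len : ℝ := ((partition X δ ω 𝒳 i).length : ℝ) with hlen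
  set avg := avgDiam X (partition X δ ω 𝒳 i) with havg
  have hs : score X δ (partition X δ ω 𝒳 i) = alpha n δ / n * len + avg ^ 2 := rfl
  have h1 : 68 * ΔY ^ 2 * confLevel n δ / n * len ≤
      544 * (ΔY ^ 2 + lam ^ 2) * (alpha n δ / n * len) := by
    calc 68 * ΔY ^ 2 * confLevel n δ / n * len
        ≤ 68 * (ΔY ^ 2 + lam ^ 2) * (8 * alpha n δ) / n * len := by
          have := (confLevel_pos (n := n) hδ hδ1).le
          gcongr
      _ = _ := by ring
  have h2 : 64 * lam ^ 2 * avg ^ 2 ≤ 544 * (ΔY ^ 2 + lam ^ 2) * avg ^ 2 := by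
    have h3 : 0 ≤ ΔY ^ 2 + lam ^ 2 := by positivity
    have h4 : lam ^ 2 ≤ ΔY ^ 2 + lam ^ 2 := by linarith [sq_nonneg ΔY]
    gcongr
    norm_num
  calc _ ≤ 544 * (ΔY ^ 2 + lam ^ 2) * score X δ (partition X δ ω 𝒳 i) := by rw [hs]; linarith
    _ ≤ 544 * (ΔY ^ 2 + lam ^ 2) * (4 * (1 + ΔX ^ 2) * r) := by
        gcongr
        refine hscore.trans ?_
        gcongr
    _ = _ := by ring

/-- The bound of `integral_le_of_isReturned` in terms of the risk. -/
lemma risk_sub_le_and_sqDist_le {B : ℝ} (hX : ∀ i, (S i).1 ∈ 𝒳) (h𝒳 : ∀ᵐ z ∂ρ, z.1 ∈ 𝒳)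
    (hρY : ∀ᵐ z ∂ρ, z.2 ∈ Metric.closedBall cY (ΔY / 2)) (hh : Measurable h)
    (hhb : ∀ x, h x ∈ Metric.closedBall cY (ΔY / 2)) (hhf : ∀ᵐ z ∂ρ, h z.1 = f z.1)
    (hort : ∀ φ : E D → E D', Measurable φ → ∀ B, (∀ x, ‖φ x‖ ≤ B) →
      ∫ z, inner ℝ (φ z.1) (z.2 - h z.1) ∂ρ = 0)
    (hY : ∀ i, (S i).2 ∈ Metric.closedBall cY (ΔY / 2))
    (hy₀ : y₀ ∈ Metric.closedBall cY (ΔY / 2)) {i : ℕ}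
    (hB : ∫ z, ‖h z.1 - regressor (fun i => (S i).1) (fun i => (S i).2) y₀
        (partition (fun i => (S i).1) δ ω Set.univ i) z.1‖ ^ 2 ∂ρ ≤ B) :
    risk ρ (regressor (fun i => (S i).1) (fun i => (S i).2) y₀
        (partition (fun i => (S i).1) δ ω 𝒳 i)) - risk ρ f ≤ B ∧
      sqDist ρ (regressor (fun i => (S i).1) (fun i => (S i).2) y₀
        (partition (fun i => (S i).1) δ ω 𝒳 i)) f ≤ ENNReal.ofReal B := by
  set g := regressor (fun i => (S i).1) (fun i => (S i).2) y₀
    (partition (fun i => (S i).1) δ ω Set.univ i) with hg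
  have hgm : Measurable g := measurable_regressor i
  have hgb : ∀ x, g x ∈ Metric.closedBall cY (ΔY / 2) := regressor_mem_closedBall hY hy₀ i
  have hgg : ∀ᵐ z ∂ρ, regressor (fun i => (S i).1) (fun i => (S i).2) y₀
      (partition (fun i => (S i).1) δ ω 𝒳 i) z.1 = g z.1 :=
    h𝒳.mono fun z hz => regressor_eq_univ hX i hz
  refine ⟨?_, ?_⟩
  · rw [risk_sub_risk_eq hρY hh hhb hhf hort hgm hgb hgg]
    exact hB
  · exact (sqDist_le hhf hgg (integrable_norm_sub_sq hh hhb hgm hgb)).trans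
      (ENNReal.ofReal_le_ofReal hB)

end Final

end RPTree

end

theorem theorem2 :
    ∃ C C' : ℝ, 0 < C ∧ 0 < C' ∧
      ∀ (D D' : ℕ) (𝒳 : Set (E D)) (𝒴 : Set (E D')) (d ΔX ΔY lam : ℝ)
        (ρ : MeasureTheory.Measure (E D × E D')) [MeasureTheory.IsProbabilityMeasure ρ]
        (f : E D → E D') (y₀ : E D') (n : ℕ) (δ : ℝ),
        HasAssouadDim 𝒳 d → 1 < d →
        (∃ c, 𝒳 ⊆ Metric.closedBall c (ΔX / 2)) →
        (∃ c, 𝒴 ⊆ Metric.closedBall c (ΔY / 2)) →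
        (∀ᵐ z ∂ρ, z.1 ∈ 𝒳 ∧ z.2 ∈ 𝒴) →
        IsRegressionFunction ρ f →
        0 ≤ lam → (∀ x ∈ 𝒳, ∀ x' ∈ 𝒳, ‖f x - f x'‖ ≤ lam * ‖x - x'‖) →
        y₀ ∈ 𝒴 →
        1 ≤ n → 0 < δ → δ < 1 → (3 ≤ n ∨ δ ≤ 1 / 2) →
        jointLaw ρ n {ω | ¬ ∃ I : ℕ,
          StopsAt (fun i => (ω.1 i).1) δ ω.2 𝒳 I ∧
          (∃ k : ℝ, AttainsRate (fun i => (ω.1 i).1) δ ω.2 𝒳 d I k ∧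
            k ≤ C' * d * Real.logb 2 d) ∧
          ∀ k : ℝ, AttainsRate (fun i => (ω.1 i).1) δ ω.2 𝒳 d I k →
            ∀ L : List (Node D), IsReturned (fun i => (ω.1 i).1) δ ω.2 𝒳 I L →
              risk ρ (regressor (fun i => (ω.1 i).1) (fun i => (ω.1 i).2) y₀ L) - risk ρ f
                  ≤ C * (ΔY ^ 2 + lam ^ 2) * (ΔX ^ 2 + 1) *
                    (alpha n δ / n) ^ (2 / (2 + k)) ∧
              sqDist ρ (regressor (fun i => (ω.1 i).1) (fun i => (ω.1 i).2) y₀ L) f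
                  ≤ ENNReal.ofReal (C * (ΔY ^ 2 + lam ^ 2) * (ΔX ^ 2 + 1) *
                    (alpha n δ / n) ^ (2 / (2 + k)))}
          ≤ ENNReal.ofReal δ := by
  refine ⟨2176, 60000, by norm_num, by norm_num, ?_⟩
  rintro D D' 𝒳 𝒴 d ΔX ΔY lam ρ _ f y₀ n δ hdim hd1 ⟨cX, hcX⟩ ⟨cY, hcY⟩ hρ hf hlam hLip hy₀ hn hδ
    hδ1 hnδ
  have hd := three_halves_le_of_hasAssouadDim hdim hd1
  have hα := one_le_alpha hn hδ hδ1 hnδ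
  have hR := numRuns_pos hn hδ hδ1
  have h𝒳 : ∀ᵐ z ∂ρ, z.1 ∈ 𝒳 := hρ.mono fun z hz => hz.1
  have hρY : ∀ᵐ z ∂ρ, z.2 ∈ Metric.closedBall cY (ΔY / 2) := hρ.mono fun z hz => hcY hz.2
  have hΔY : 0 ≤ ΔY / 2 := dist_nonneg.trans (Metric.mem_closedBall.1 (hcY hy₀))
  obtain ⟨h, hh, hhb, hhf, hcent, hort⟩ := exists_measurable_version hΔY hρY hf
  -- the residual, truncated so that it is bounded everywhere
  set ξ : E D × E D' → E D' := fun z => if ‖z.2 - h z.1‖ ≤ ΔY then z.2 - h z.1 else 0 with hξdef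
  have hres : ∀ z : E D × E D', z.2 ∈ Metric.closedBall cY (ΔY / 2) → ξ z = z.2 - h z.1 := by
    intro z hz
    refine if_pos ?_
    have h1 := Metric.mem_closedBall.1 hz
    have h2 := Metric.mem_closedBall.1 (hhb z.1)
    rw [← dist_eq_norm]
    linarith [dist_triangle_right z.2 (h z.1) cY]
  have hresm : Measurable fun z : E D × E D' => z.2 - h z.1 :=
    measurable_snd.sub (hh.comp measurable_fst)
  have hξ : Measurable ξ :=
    Measurable.ite (measurableSet_le hresm.norm measurable_const) hresm measurable_const
  have hξM : ∀ z, ‖ξ z‖ ≤ ΔY := by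
    intro z
    by_cases hz : ‖z.2 - h z.1‖ ≤ ΔY
    · simp only [hξdef, if_pos hz]; exact hz
    · simp only [hξdef, if_neg hz, norm_zero]; linarith
  have hξ0 : ∀ T : Set (E D), MeasurableSet T → ∫ z in Prod.fst ⁻¹' T, ξ z ∂ρ = 0 := by
    intro T hT
    rw [← hcent T hT]
    exact setIntegral_congr_ae (measurable_fst hT) (hρY.mono fun z hz _ => hres z hz)
  have hB1 := jointLaw_exists_call_gt (ρ := ρ) (n := n) hn hδ hδ1 hdim.1.2 hd h𝒳
  have hB2 := jointLaw_not_massControlled (ρ := ρ) (n := n) hδ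
  have hB3 := jointLaw_not_noiseControlled (ρ := ρ) (n := n) hδ hδ1 hξ hξM hξ0
  have hgood := ae_jointLaw_sample (n := n) (hρ.and hhf)
  -- The control of the calls of the core procedure, of the masses and of the noise fails with
  -- probability at most `δ / 6`, `δ / 6` and `δ / 3`.
  have hsum : ENNReal.ofReal (δ / 6) + ENNReal.ofReal (δ / 6) + ENNReal.ofReal (δ / 3) ≤
      ENNReal.ofReal δ := by
    rw [← ENNReal.ofReal_add (by positivity) (by positivity),
      ← ENNReal.ofReal_add (by positivity) (by positivity)]
    exact ENNReal.ofReal_le_ofReal (by linarith)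
  refine le_trans ?_ (((measure_union_le _ _).trans
    (add_le_add ((measure_union_le _ _).trans (add_le_add hB1 hB2)) hB3)).trans hsum)
  refine measure_mono_ae ?_
  filter_upwards [hgood] with a ha hbad
  by_contra hout
  refine hbad ?_
  have hcall := fun hc => hout (Or.inl (Or.inl hc))
  have hmass := not_not.1 fun hc => hout (Or.inl (Or.inr hc))
  have hnoise := not_not.1 fun hc => hout (Or.inr hc)
  have hX : ∀ i, (a.1 i).1 ∈ 𝒳 := fun i => (ha i).1.1
  have hY : ∀ i, (a.1 i).2 ∈ Metric.closedBall cY (ΔY / 2) := fun i => hcY (ha i).1.2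
  have hlogd : 0 ≤ Real.logb 2 d := Real.logb_nonneg (by norm_num) hd1.le
  have hk0 : 0 ≤ 60000 * d * Real.logb 2 d := by positivity
  have hdepth : ∀ i < n, ∀ A ∈ partition (fun i => (a.1 i).1) δ a.2 𝒳 i, ∃ m : ℕ,
      coreDepth (fun i => (a.1 i).1) δ a.2 A = m ∧ (m : ℝ) ≤ 60000 * d * Real.logb 2 d := by
    intro i hi A hA
    have h1 : A.toIndex (fun i => (a.1 i).1) ∈ idxPartition (fun i => (a.1 i).1) δ a.2 i := by
      rw [← map_toIndex_partition hX]
      exact List.mem_map_of_mem hA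
    have h2 := not_lt.1 fun hlt => hcall ⟨i, hi, _, h1, hlt⟩
    rw [← coreDepth_eq] at h2
    obtain ⟨m, hm⟩ := ENat.ne_top_iff_exists.1 (ne_top_of_le_ne_top (ENat.natCast_ne_top _) h2)
    refine ⟨m, hm.symm, ?_⟩
    rw [← hm, Nat.cast_le] at h2
    exact (Nat.cast_le.2 h2).trans (Nat.floor_le hk0)
  obtain ⟨I, hIn, hI⟩ := exists_stopsAt hn hX hR hα fun i hi A hA =>
    (hdepth i hi A hA).imp fun m hm => hm.1
  -- A diameter decrease rate is at least `d` by definition; here `log d ≥ 1 / 2` since `d ≥ 3 / 2`.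
  have hdk : d ≤ 60000 * d * Real.logb 2 d := by
    have h1 : 1 / 2 ≤ Real.logb 2 d := by
      rw [Real.le_logb_iff_rpow_le (by norm_num) (by linarith), ← Real.sqrt_eq_rpow]
      exact (Real.sqrt_le_left (by norm_num)).2 (by norm_num) |>.trans hd
    nlinarith
  refine ⟨I, hI, ⟨_, ⟨hdk, fun i hi => hdepth i (hi.trans_le hIn)⟩, le_rfl⟩, ?_⟩
  intro k hk L hL
  obtain ⟨i, hi, rfl⟩ : ∃ i, (i = I - 1 ∨ i = I) ∧
      L = partition (fun i => (a.1 i).1) δ a.2 𝒳 i := by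
    rcases hL.1 with h1 | h1
    · exact ⟨_, Or.inl rfl, h1⟩
    · exact ⟨_, Or.inr rfl, h1⟩
  have hdev : NoiseControlled h a.1 (drawnDirs (maxLevel n) (numRuns n δ) a.2) (maxLevel n) ΔY
      (confLevel n δ) := by
    intro c
    have h1 := hnoise c
    rwa [Finset.sum_congr rfl fun j _ => hres (a.1 j) (hY j)] at h1
  exact risk_sub_le_and_sqDist_le hX h𝒳 hρY hh hhb hhf hort hY (hcY hy₀)
    (integral_le_of_isReturned hn hδ hδ1 hα hh hhb hhf h𝒳 hlam hLip (hcY hy₀) hcX hX hY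
      (fun i => (ha i).2) hmass hdev hI (by linarith) hk hi hL)
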